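/- Let $k$ be an algebraically closed field of characteristic zero, let $\mathfrak g$ be a Lie algebra over $k$, and let $H=U(\mathfrak g)$ with its standard comultiplication $\Delta$ and counit $\varepsilon$ (elements of $\mathfrak g$ are primitive). All maps are extended coefficientwise to formal power series in $h$, and the completed tensor powers of $H[[h]]$ over $k[[h]]$ are $H^{\otimes n}[[h]]$. An invariant twist on $H[[h]]$ is an invertible element $F\in H^{\otimes 2}[[h]]$ such that $F\Delta(x)=\Delta(x)F$ for all $x\in H[[h]]$, $(F\otimes 1)(\Delta\otimes I)(F)=(1\otimes F)(I\otimes\Delta)(F)$ and $(\varepsilon\otimes I)(F)=(I\otimes\varepsilon)(F)=1$. Invariant twists $F$, $F'$ are gauge isomorphic if there is an invertible element $a$ of the centre of $H[[h]]$ with $F\Delta(a)=(a\otimes a)F'$. Let $(\Lambda^2\mathfrak g)^{\mathfrak g}\subset\mathfrak g\otimes\mathfrak g$ be the space of $\mathfrak g$-invariant skew-symmetric tensors, mapped to $H\otimes H$ by the canonical map. For every sequence $X_1,X_2,\dots$ in $(\Lambda^2\mathfrak g)^{\mathfrak g}$ the infinite ordered product $$\prod_{i=1}^{\infty}\exp(X_ih^i)=\exp(X_1h)\exp(X_2h^2)\exp(X_3h^3)\cdots$$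 (the $h$-adic limit of the partial products) is an invariant twist on $U(\mathfrak g)[[h]]$, and every invariant twist $F$ on $U(\mathfrak g)[[h]]$ is gauge isomorphic to such a product for exactly one sequence $(X_i)_{i\ge 1}$ in $(\Lambda^2\mathfrak g)^{\mathfrak g}$. -/

import Mathlib

open scoped TensorProduct

noncomputable section

/-! ## The bialgebra structure of a universal enveloping algebra -/

namespace UniversalEnvelopingAlgebra

section Bialgebra

attribute [local instance 100] LieRing.ofAssociativeRing

variable (k : Type*) [CommRing k] (g : Type*) [LieRing g] [LieAlgebra k g]

/-- The Lie algebra map `x ↦ x ⊗ 1 + 1 ⊗ x` from `g` to `U(g) ⊗ U(g)`. -/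
def comulLieHom :
    g →ₗ⁅k⁆ UniversalEnvelopingAlgebra k g ⊗[k] UniversalEnvelopingAlgebra k g :=
  { (TensorProduct.mk k (UniversalEnvelopingAlgebra k g) (UniversalEnvelopingAlgebra k g)).flip 1 ∘ₗ
        (ι k : g →ₗ⁅k⁆ UniversalEnvelopingAlgebra k g).toLinearMap +
      TensorProduct.mk k (UniversalEnvelopingAlgebra k g) (UniversalEnvelopingAlgebra k g) 1 ∘ₗ
        (ι k : g →ₗ⁅k⁆ UniversalEnvelopingAlgebra k g).toLinearMap with
    map_lie' := by
      intro x y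
      have h : (ι k ⁅x, y⁆ : UniversalEnvelopingAlgebra k g) = ι k x * ι k y - ι k y * ι k x := by
        rw [LieHom.map_lie, LieRing.of_associative_ring_bracket]
      change ι k ⁅x, y⁆ ⊗ₜ[k] 1 + 1 ⊗ₜ[k] ι k ⁅x, y⁆ =
        ⁅ι k x ⊗ₜ[k] 1 + 1 ⊗ₜ[k] ι k x, ι k y ⊗ₜ[k] 1 + 1 ⊗ₜ[k] ι k y⁆
      rw [h, LieRing.of_associative_ring_bracket]
      simp only [mul_add, add_mul, Algebra.TensorProduct.tmul_mul_tmul, mul_one, one_mul,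
        TensorProduct.sub_tmul, TensorProduct.tmul_sub]
      abel }

theorem comulLieHom_apply (x : g) :
    comulLieHom k g x = ι k x ⊗ₜ[k] 1 + 1 ⊗ₜ[k] ι k x := rfl

/-- The comultiplication of `U(g)`. -/
def comulHom : UniversalEnvelopingAlgebra k g →ₐ[k]
    UniversalEnvelopingAlgebra k g ⊗[k] UniversalEnvelopingAlgebra k g :=
  lift k (comulLieHom k g)

/-- The counit of `U(g)`; it vanishes on `g`. -/
def counitHom : UniversalEnvelopingAlgebra k g →ₐ[k] k :=
  lift k (0 : g →ₗ⁅k⁆ k)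

theorem comulHom_ι (x : g) :
    comulHom k g (ι k x) = ι k x ⊗ₜ[k] 1 + 1 ⊗ₜ[k] ι k x := by
  rw [comulHom, lift_ι_apply, comulLieHom_apply]

theorem counitHom_ι (x : g) : counitHom k g (ι k x) = 0 := by
  rw [counitHom, lift_ι_apply, LieHom.zero_apply]

theorem algHom_ext_ι {A : Type*} [Ring A] [Algebra k A]
    {f₁ f₂ : UniversalEnvelopingAlgebra k g →ₐ[k] A} (h : ∀ x : g, f₁ (ι k x) = f₂ (ι k x)) :
    f₁ = f₂ :=
  hom_ext k (LieHom.ext h)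

/-- The standard bialgebra structure of `U(g)`, in which the elements of `g` are primitive. -/
instance instBialgebra : Bialgebra k (UniversalEnvelopingAlgebra k g) :=
  Bialgebra.ofAlgHom (comulHom k g) (counitHom k g)
    (by
      ext x
      simp [-ι_apply, comulHom_ι, TensorProduct.add_tmul, TensorProduct.tmul_add,
        Algebra.TensorProduct.one_def, add_assoc])
    (by
      refine algHom_ext_ι k g fun x => ?_
      change Algebra.TensorProduct.map (counitHom k g) (AlgHom.id k _) (comulHom k g (ι k x)) =
        (1 : k) ⊗ₜ[k] ι k x
      rw [comulHom_ι, map_add, Algebra.TensorProduct.map_tmul, Algebra.TensorProduct.map_tmul,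
        counitHom_ι, map_one (counitHom k g), TensorProduct.zero_tmul, zero_add, AlgHom.id_apply])
    (by
      refine algHom_ext_ι k g fun x => ?_
      change Algebra.TensorProduct.map (AlgHom.id k _) (counitHom k g) (comulHom k g (ι k x)) =
        ι k x ⊗ₜ[k] (1 : k)
      rw [comulHom_ι, map_add, Algebra.TensorProduct.map_tmul, Algebra.TensorProduct.map_tmul,
        counitHom_ι, map_one, TensorProduct.tmul_zero, add_zero, AlgHom.id_apply])

theorem comul_ι (x : g) :
    Bialgebra.comulAlgHom k (UniversalEnvelopingAlgebra k g) (ι k x) =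
      ι k x ⊗ₜ[k] 1 + 1 ⊗ₜ[k] ι k x :=
  comulHom_ι k g x

theorem counit_ι (x : g) :
    Bialgebra.counitAlgHom k (UniversalEnvelopingAlgebra k g) (ι k x) = 0 :=
  counitHom_ι k g x

end Bialgebra

end UniversalEnvelopingAlgebra

/-! ## Invariant twists on `H[[h]]`

For a bialgebra `H` over `k`, the `h`-adically complete bialgebra `H[[h]]` over `k[[h]]` is
`PowerSeries H`; its completed tensor square and cube over `k[[h]]` are `PowerSeries (H ⊗ H)` and
`PowerSeries (H ⊗ (H ⊗ H))`. A map of algebras over `k` is extended coefficientwise. -/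

namespace FormalTwist

section Twist

variable (k : Type*) [CommRing k] (H : Type*) [Ring H] [Bialgebra k H]

/-- `Δ : H[[h]] → (H ⊗ H)[[h]]`. -/
def comul : PowerSeries H →+* PowerSeries (H ⊗[k] H) :=
  PowerSeries.map (Bialgebra.comulAlgHom k H : H →+* H ⊗[k] H)

/-- `F ↦ F ⊗ 1`. -/
def tensorOne : PowerSeries (H ⊗[k] H) →+* PowerSeries (H ⊗[k] (H ⊗[k] H)) :=
  PowerSeries.map (((Algebra.TensorProduct.assoc k k k H H H).toAlgHom.comp
    (Algebra.TensorProduct.includeLeft : H ⊗[k] H →ₐ[k] (H ⊗[k] H) ⊗[k] H) :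
      H ⊗[k] H →ₐ[k] H ⊗[k] (H ⊗[k] H)) : H ⊗[k] H →+* H ⊗[k] (H ⊗[k] H))

/-- `F ↦ 1 ⊗ F`. -/
def oneTensor : PowerSeries (H ⊗[k] H) →+* PowerSeries (H ⊗[k] (H ⊗[k] H)) :=
  PowerSeries.map ((Algebra.TensorProduct.includeRight :
      H ⊗[k] H →ₐ[k] H ⊗[k] (H ⊗[k] H)) : H ⊗[k] H →+* H ⊗[k] (H ⊗[k] H))

/-- `Δ ⊗ I`. -/
def comulTensorId : PowerSeries (H ⊗[k] H) →+* PowerSeries (H ⊗[k] (H ⊗[k] H)) :=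
  PowerSeries.map (((Algebra.TensorProduct.assoc k k k H H H).toAlgHom.comp
    (Algebra.TensorProduct.map (Bialgebra.comulAlgHom k H) (AlgHom.id k H)) :
      H ⊗[k] H →ₐ[k] H ⊗[k] (H ⊗[k] H)) : H ⊗[k] H →+* H ⊗[k] (H ⊗[k] H))

/-- `I ⊗ Δ`. -/
def idTensorComul : PowerSeries (H ⊗[k] H) →+* PowerSeries (H ⊗[k] (H ⊗[k] H)) :=
  PowerSeries.map ((Algebra.TensorProduct.map (AlgHom.id k H) (Bialgebra.comulAlgHom k H) :
      H ⊗[k] H →ₐ[k] H ⊗[k] (H ⊗[k] H)) : H ⊗[k] H →+* H ⊗[k] (H ⊗[k] H))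

/-- `ε ⊗ I`. -/
def counitTensorId : PowerSeries (H ⊗[k] H) →+* PowerSeries H :=
  PowerSeries.map (((Algebra.TensorProduct.lid k H).toAlgHom.comp
    (Algebra.TensorProduct.map (Bialgebra.counitAlgHom k H) (AlgHom.id k H)) :
      H ⊗[k] H →ₐ[k] H) : H ⊗[k] H →+* H)

/-- `I ⊗ ε`. -/
def idTensorCounit : PowerSeries (H ⊗[k] H) →+* PowerSeries H :=
  PowerSeries.map (((Algebra.TensorProduct.rid k k H).toAlgHom.comp
    (Algebra.TensorProduct.map (AlgHom.id k H) (Bialgebra.counitAlgHom k H)) :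
      H ⊗[k] H →ₐ[k] H) : H ⊗[k] H →+* H)

/-- The element `a ⊗ b = (a ⊗ 1)(1 ⊗ b)` of `(H ⊗ H)[[h]]`, for `a` and `b` in `H[[h]]`. -/
def tmul (a b : PowerSeries H) : PowerSeries (H ⊗[k] H) :=
  PowerSeries.map ((Algebra.TensorProduct.includeLeft : H →ₐ[k] H ⊗[k] H) : H →+* H ⊗[k] H) a *
    PowerSeries.map ((Algebra.TensorProduct.includeRight : H →ₐ[k] H ⊗[k] H) : H →+* H ⊗[k] H) b

variable {H}

/-- Invariant twists on `H[[h]]`: the elements `F` for which `(id, F)` is a twisted automorphism. -/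
structure IsInvariantTwist (F : PowerSeries (H ⊗[k] H)) : Prop where
  isUnit : IsUnit F
  invariant : ∀ x : PowerSeries H, F * comul k H x = comul k H x * F
  cocycle : tensorOne k H F * comulTensorId k H F = oneTensor k H F * idTensorComul k H F
  counit_left : counitTensorId k H F = 1
  counit_right : idTensorCounit k H F = 1

/-- Gauge isomorphism `(id, F) → (id, F')`: an invertible `a` in `H[[h]]` with `a x = x a` for all
`x` in `H[[h]]` and `F Δ(a) = (a ⊗ a) F'`. -/
def GaugeIsomorphic (F F' : PowerSeries (H ⊗[k] H)) : Prop :=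
  ∃ a : PowerSeries H, IsUnit a ∧ (∀ x : PowerSeries H, a * x = x * a) ∧
    F * comul k H a = tmul k H a a * F'

end Twist

/-! ## Exponentials and infinite products of formal power series -/

section Exp

variable (k : Type*) [Field k] {A : Type*} [Ring A] [Algebra k A]

/-- `exp Y = ∑ m, Y ^ m / m!` for a formal power series `Y` without constant term. Since `h ^ m`
divides `Y ^ m`, only the summands with `m ≤ n` contribute to the coefficient of `h ^ n`. -/
def exp (Y : PowerSeries A) : PowerSeries A :=
  PowerSeries.mk fun n =>
    ∑ m ∈ Finset.range (n + 1), ((m.factorial : k)⁻¹) • PowerSeries.coeff n (Y ^ m)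

/-- `exp(X₁ h) exp(X₂ h²) ⋯ exp(Xₙ hⁿ)`. -/
def partialProd (X : ℕ+ → A) : ℕ → PowerSeries A
  | 0 => 1
  | n + 1 => partialProd X n * exp k (PowerSeries.monomial (n + 1) (X n.succPNat))

/-- The infinite ordered product `exp(X₁ h) exp(X₂ h²) exp(X₃ h³) ⋯`, the `h`-adic limit of the
partial products: its coefficient of `h ^ n` is that of all the partial products with at least `n`
factors. -/
def infiniteProd (X : ℕ+ → A) : PowerSeries A :=
  PowerSeries.mk fun n => PowerSeries.coeff n (partialProd k X n)

theorem coeff_exp_monomial_succ (Z : A) (N n : ℕ) (hn : n ≤ N) :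
    PowerSeries.coeff n (exp k (PowerSeries.monomial (N + 1) Z)) = if n = 0 then 1 else 0 := by
  rw [exp, PowerSeries.coeff_mk, Finset.sum_range_succ', Finset.sum_eq_zero]
  · simp [PowerSeries.coeff_one]
  · intro m _
    have h : PowerSeries.coeff n ((PowerSeries.monomial (N + 1) Z) ^ (m + 1)) = 0 := by
      rw [pow_succ, PowerSeries.coeff_mul, Finset.sum_eq_zero]
      intro p hp
      have hp' := Finset.HasAntidiagonal.mem_antidiagonal.mp hp
      rw [PowerSeries.coeff_monomial, if_neg (by omega), mul_zero]
    rw [h, smul_zero]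

theorem coeff_partialProd_succ (X : ℕ+ → A) (N n : ℕ) (hn : n ≤ N) :
    PowerSeries.coeff n (partialProd k X (N + 1)) = PowerSeries.coeff n (partialProd k X N) := by
  rw [partialProd, PowerSeries.coeff_mul, Finset.sum_eq_single (n, 0)]
  · rw [coeff_exp_monomial_succ k _ N 0 (Nat.zero_le _), if_pos rfl, mul_one]
  · rintro ⟨i, j⟩ hp hne
    have hp' := Finset.HasAntidiagonal.mem_antidiagonal.mp hp
    simp only at hp'
    have hj : j ≠ 0 := by
      rintro rfl
      exact hne (by simp_all)
    rw [coeff_exp_monomial_succ k _ N j (by omega), if_neg hj, mul_zero]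
  · intro h
    exact absurd (Finset.HasAntidiagonal.mem_antidiagonal.mpr (by simp)) h

theorem coeff_partialProd (X : ℕ+ → A) (N n : ℕ) (hn : n ≤ N) :
    PowerSeries.coeff n (partialProd k X N) = PowerSeries.coeff n (infiniteProd k X) := by
  induction N, hn using Nat.le_induction with
  | base => rw [infiniteProd, PowerSeries.coeff_mk]
  | succ N hN ih => rw [coeff_partialProd_succ k X N n hN, ih]

end Exp

/-! ## The invariant skew-symmetric tensors -/

section Invariants

variable (k : Type*) [Field k] (g : Type*) [LieRing g] [LieAlgebra k g]

/-- `(Λ² g)^g`: the skew-symmetric tensors in `g ⊗ g` that are annihilated by the action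
`z • (x ⊗ y) = [z, x] ⊗ y + x ⊗ [z, y]` of `g`. -/
def invariantSkew : Submodule k (g ⊗[k] g) where
  carrier := {X | TensorProduct.comm k g g X = -X ∧ ∀ z : g, ⁅z, X⁆ = 0}
  add_mem' := by
    rintro X Y ⟨hX, hX'⟩ ⟨hY, hY'⟩
    refine ⟨?_, fun z => ?_⟩
    · rw [map_add, hX, hY, neg_add]
    · rw [lie_add, hX', hY', add_zero]
  zero_mem' := by
    refine ⟨?_, fun z => ?_⟩
    · rw [map_zero, neg_zero]
    · rw [lie_zero]
  smul_mem' := by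
    rintro c X ⟨hX, hX'⟩
    refine ⟨?_, fun z => ?_⟩
    · rw [map_smul, hX, smul_neg]
    · rw [lie_smul, hX', smul_zero]

/-- The natural map `g ⊗ g → U(g) ⊗ U(g)`. -/
def toEnvelopingSquare :
    g ⊗[k] g →ₗ[k] UniversalEnvelopingAlgebra k g ⊗[k] UniversalEnvelopingAlgebra k g :=
  letI : LieRing (UniversalEnvelopingAlgebra k g) := LieRing.ofAssociativeRing
  TensorProduct.map (UniversalEnvelopingAlgebra.ι k : g →ₗ⁅k⁆ UniversalEnvelopingAlgebra k g).toLinearMap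
    (UniversalEnvelopingAlgebra.ι k : g →ₗ⁅k⁆ UniversalEnvelopingAlgebra k g).toLinearMap

/-- The product of the `exp(X_i h ^ i)` over `i = 1, 2, …`, in `(U(g) ⊗ U(g))[[h]]`. -/
def expProduct (X : ℕ+ → invariantSkew k g) :
    PowerSeries (UniversalEnvelopingAlgebra k g ⊗[k] UniversalEnvelopingAlgebra k g) :=
  infiniteProd k fun i => toEnvelopingSquare k g (X i : g ⊗[k] g)

end Invariants

end FormalTwist

end

/-! An invariant twist commutes with the image of Δ. Hence the invariant twists form a group under
multiplication, closed under h-adic limits (`IsInvariantTwist.mul`,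
`IsInvariantTwist.of_mul_eq_one`, `IsInvariantTwist.of_coeff_eq`). For an invariant X, each side of
the cocycle identity for exp(X hⁿ) is a product of two commuting exponentials, so the identity
reduces to the additive one for X, which holds because the elements of g are primitive. Products and
limits then give the first claim.

Conversely, let F = 1 + f hⁿ + ⋯ be an invariant twist. Then f is an invariant normalized 2-cocycle
of the coalgebra U(g), hence f = X + δb with X invariant and skew and b central
(`IsTwoCocycle.exists_invariantSkew_add_coboundary`). The gauge 1 - b hⁿ removes δb, dividing by
exp(X hⁿ) removes X, and what remains is a twist that is 1 modulo hⁿ⁺¹; iteration gives existence.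
The iteration can start because the units of U(g) ⊗ U(g) are scalars, so that the constant
coefficient of F is 1. For uniqueness, two products gauge isomorphic to F differ by a factor made of
elements Δ(a) and a ⊗ a, which the flip fixes. At the first index where the sequences differ, the
difference of the two tensors would be both symmetric and skew.

The cohomology rests on a grading obtained without the PBW theorem: U(g) is the direct sum over n of
the spans of the n-th powers of elements of g. These lie in eigenspaces of multiplication ∘ Δ for
the eigenvalues 2ⁿ, and they exhaust U(g) by polarization (`isInternal_powers`). So linear maps can
be defined degree by degree and compared on powers, and U(g) acquires the calculus of polynomials: a
projection p to g, a derivative d = (1 ⊗ p)Δ and a symmetrized product. A cocycle f gives a 1-form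
(1 ⊗ p)f, which is closed when (p ⊗ p)f is symmetric, and a Poincaré lemma then shows f to be a
coboundary. The same grading on the tensor algebra shows that g embeds into U(g), which p requires,
and leading symbols built from d determine the units. -/

noncomputable section

/-! ### Polynomial functions of a parameter and polarization -/

section Jet

variable {k : Type*} [Field k] {M N : Type*} [AddCommGroup M] [Module k M]
  [AddCommGroup N] [Module k N]

/-- `f` is a polynomial function of `t` with first two coefficients `a` and `b`. -/
def HasJet (f : k → M) (a b : M) : Prop :=
  ∃ c : ℕ →₀ M, c 0 = a ∧ c 1 = b ∧ ∀ t, f t = c.sum fun i m => t ^ i • m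

namespace HasJet

theorem const (a : M) : HasJet (fun _ : k => a) a 0 :=
  ⟨Finsupp.single 0 a, by simp, by simp, fun t => by simp⟩

theorem add {f g : k → M} {a b a' b' : M} (hf : HasJet f a b) (hg : HasJet g a' b') :
    HasJet (fun t => f t + g t) (a + a') (b + b') := by
  obtain ⟨c, rfl, rfl, hc⟩ := hf
  obtain ⟨d, rfl, rfl, hd⟩ := hg
  refine ⟨c + d, rfl, rfl, fun t => ?_⟩
  simp only [hc, hd]
  rw [Finsupp.sum_add_index' (by simp) (by simp)]

theorem map {f : k → M} {a b : M} (hf : HasJet f a b) (φ : M →ₗ[k] N) :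
    HasJet (fun t => φ (f t)) (φ a) (φ b) := by
  obtain ⟨c, rfl, rfl, hc⟩ := hf
  refine ⟨Finsupp.mapRange.linearMap φ c, by simp, by simp, fun t => ?_⟩
  simp only [hc]
  rw [Finsupp.mapRange.linearMap_apply, Finsupp.sum_mapRange_index (by simp), map_finsuppSum]
  simp

theorem smul_var {f : k → M} {a b : M} (hf : HasJet f a b) :
    HasJet (fun t => t • f t) 0 a := by
  obtain ⟨c, rfl, rfl, hc⟩ := hf
  refine ⟨c.mapDomain Nat.succ, ?_, ?_, fun t => ?_⟩
  · exact Finsupp.mapDomain_of_notMem_range _ _ (by simp)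
  · exact Finsupp.mapDomain_apply Nat.succ_injective c 0
  · simp only [hc]
    rw [Finsupp.sum_mapDomain_index (by simp) (by simp [smul_add]), Finsupp.smul_sum]
    simp [pow_succ', mul_smul]

/-- Composed with a functional that kills W, the function becomes a polynomial vanishing on the
infinite field k, so its linear coefficient is zero; functionals separate the points of M / W. This
is the substitute for differentiation: facts about all powers (u + t v)ⁿ pass to their derivatives
in t. -/
theorem mem [Infinite k] {f : k → M} {a b : M} (hf : HasJet f a b) (W : Submodule k M)
    (h : ∀ t, f t ∈ W) : b ∈ W := by
  obtain ⟨c, rfl, rfl, hc⟩ := hf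
  rw [← Submodule.Quotient.mk_eq_zero, ← Module.forall_dual_apply_eq_zero_iff k]
  intro φ
  let ψ : M →ₗ[k] k := φ ∘ₗ W.mkQ
  let P : Polynomial k := c.sum fun i m => Polynomial.monomial i (ψ m)
  have hP : P = 0 := by
    refine Polynomial.funext fun t => ?_
    have h0 : ψ (f t) = 0 := by
      simp [ψ, (Submodule.Quotient.mk_eq_zero W).2 (h t)]
    rw [hc, map_finsuppSum] at h0
    simp only [map_smul, smul_eq_mul] at h0
    simp only [P, Finsupp.sum, Polynomial.eval_finsetSum, Polynomial.eval_monomial,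
      Polynomial.eval_zero]
    rw [← h0]
    exact Finset.sum_congr rfl fun i _ => mul_comm _ _
  have h1 : P.coeff 1 = ψ (c 1) := by
    simp only [P, Finsupp.sum, Polynomial.finsetSum_coeff, Polynomial.coeff_monomial]
    rw [Finset.sum_ite_eq' c.support 1 fun i => ψ (c i)]
    split_ifs with h
    · rfl
    · rw [Finsupp.notMem_support_iff.1 h, map_zero]
  rw [hP, Polynomial.coeff_zero] at h1
  exact h1.symm

theorem unique [Infinite k] {f : k → M} {a b a' b' : M} (hf : HasJet f a b)
    (hg : HasJet f a' b') : b = b' := by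
  have h := (hf.add (hg.map (-LinearMap.id))).mem ⊥ (by simp)
  simpa [← sub_eq_add_neg, sub_eq_zero] using h

end HasJet

end Jet

section PowDeriv

/-- The coefficient of `t` in `(u + t v) ^ n`. -/
def powDeriv {A : Type*} [Ring A] (u v : A) : ℕ → A
  | 0 => 0
  | n + 1 => powDeriv u v n * u + u ^ n * v

variable {k : Type*} [Field k] {A : Type*} [Ring A] [Algebra k A]

theorem hasJet_pow (u v : A) (n : ℕ) :
    HasJet (fun t : k => (u + t • v) ^ n) (u ^ n) (powDeriv u v n) := by
  induction n with
  | zero => simpa [powDeriv] using HasJet.const (k := k) (1 : A)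
  | succ n ih =>
    have h := (ih.map (LinearMap.mulRight k u)).add (ih.map (LinearMap.mulRight k v)).smul_var
    simpa [pow_succ, mul_add, powDeriv] using h

theorem powDeriv_self (u : A) (n : ℕ) : powDeriv u u n = n • u ^ n := by
  induction n with
  | zero => simp [powDeriv]
  | succ n ih => rw [powDeriv, ih, smul_mul_assoc, ← pow_succ, succ_nsmul]

/-- The commutator with z is a derivation, so it differentiates uⁿ in the direction of the
commutator of z and u. -/
theorem powDeriv_commutator (z u : A) (n : ℕ) :
    powDeriv u (z * u - u * z) n = z * u ^ n - u ^ n * z := by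
  induction n with
  | zero => simp [powDeriv]
  | succ n ih => rw [powDeriv, ih]; simp only [pow_succ]; noncomm_ring

end PowDeriv

/-! ### Length filtration of a primitively generated algebra -/

/-- `L` is a Lie subalgebra of `A` whose elements are primitive for `Δ` and which generates `A`. -/
structure PrimitivelyGenerated {k : Type*} [Field k] {A : Type*} [Ring A] [Algebra k A]
    (Δ : A →ₐ[k] A ⊗[k] A) (L : Submodule k A) : Prop where
  prim : ∀ v ∈ L, Δ v = v ⊗ₜ 1 + 1 ⊗ₜ v
  lie : ∀ u ∈ L, ∀ v ∈ L, u * v - v * u ∈ L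
  gen : Algebra.adjoin k (L : Set A) = ⊤

namespace PrimitivelyGenerated

section Filtration

variable {k : Type*} [Field k] {A : Type*} [Ring A] [Algebra k A]

/-- The filtration of `A` by the length of products of elements of `L`. -/
def filt (L : Submodule k A) (n : ℕ) : Submodule k A := (1 ⊔ L) ^ n

theorem filt_zero (L : Submodule k A) : filt L 0 = 1 := pow_zero _

theorem filt_add (L : Submodule k A) (m n : ℕ) : filt L (m + n) = filt L m * filt L n :=
  pow_add _ _ _

theorem filt_succ (L : Submodule k A) (n : ℕ) : filt L (n + 1) = filt L n * (1 ⊔ L) :=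
  pow_succ _ _

theorem filt_mono (L : Submodule k A) {m n : ℕ} (h : m ≤ n) : filt L m ≤ filt L n :=
  pow_le_pow_right' le_sup_left h

theorem mul_mem_filt {L : Submodule k A} {n : ℕ} {a v : A} (ha : a ∈ filt L n) (hv : v ∈ L) :
    a * v ∈ filt L (n + 1) := by
  rw [filt_succ]
  exact Submodule.mul_mem_mul ha (Submodule.mem_sup_right hv)

theorem pow_mem_filt {L : Submodule k A} {u : A} (hu : u ∈ L) (n : ℕ) : u ^ n ∈ filt L n :=
  Submodule.pow_mem_pow _ (Submodule.mem_sup_right hu) n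

theorem exists_mem_filt {L : Submodule k A} (hL : Algebra.adjoin k (L : Set A) = ⊤) (a : A) :
    ∃ n, a ∈ filt L n := by
  have ha : a ∈ Algebra.adjoin k (L : Set A) := hL ▸ Algebra.mem_top
  induction ha using Algebra.adjoin_induction with
  | mem x hx => exact ⟨1, by simpa using pow_mem_filt hx 1⟩
  | algebraMap r => exact ⟨0, by rw [filt_zero]; exact Submodule.algebraMap_mem r⟩
  | add x y _ _ hx hy =>
    obtain ⟨m, hm⟩ := hx
    obtain ⟨n, hn⟩ := hy
    exact ⟨max m n, add_mem (filt_mono L (le_max_left _ _) hm) (filt_mono L (le_max_right _ _) hn)⟩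
  | mul x y _ _ hx hy =>
    obtain ⟨m, hm⟩ := hx
    obtain ⟨n, hn⟩ := hy
    exact ⟨m + n, by rw [filt_add]; exact Submodule.mul_mem_mul hm hn⟩

variable {L K : Submodule k A} (hK : ∀ v ∈ K, ∀ u ∈ L, v * u - u * v ∈ K)
include hK

theorem filt_mul_mul_mem {n : ℕ} {a u : A} (ha : a ∈ filt L n * K) (hu : u ∈ L) :
    a * u ∈ filt L (n + 1) * K := by
  induction ha using Submodule.mul_induction_on' with
  | mem_mul_mem b hb v hv =>
    have h : b * v * u = b * u * v + b * (v * u - u * v) := by noncomm_ring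
    rw [h]
    exact add_mem (Submodule.mul_mem_mul (mul_mem_filt hb hu) hv)
      (Submodule.mul_mem_mul (filt_mono L n.le_succ hb) (hK v hv u hu))
  | add x _ y _ hx hy => rw [add_mul]; exact add_mem hx hy

/-- Moving v to the right end in each of the n + 2 summands of the derivative produces commutators
that stay in K, each with one factor u fewer in front. It is used with K = L for spanning by powers,
and with K the relations of g for the embedding of g. -/
theorem powDeriv_sub_mem {u v : A} (hu : u ∈ L) (hv : v ∈ K) (n : ℕ) :
    powDeriv u v (n + 2) - (n + 2) • (u ^ (n + 1) * v) ∈ filt L n * K := by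
  induction n with
  | zero =>
    have h : powDeriv u v (0 + 2) - (0 + 2) • (u ^ (0 + 1) * v) = v * u - u * v := by
      simp [powDeriv]; noncomm_ring
    rw [h, filt_zero, one_mul]
    exact hK v hv u hu
  | succ n ih =>
    have h : powDeriv u v (n + 1 + 2) - (n + 1 + 2) • (u ^ (n + 1 + 1) * v) =
        (powDeriv u v (n + 2) - (n + 2) • (u ^ (n + 1) * v)) * u +
          (n + 2) • (u ^ (n + 1) * (v * u - u * v)) := by
      rw [show n + 1 + 2 = n + 2 + 1 from rfl, powDeriv, sub_mul, smul_mul_assoc, mul_sub, smul_sub,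
        mul_assoc, succ_nsmul, ← mul_assoc (u ^ (n + 1)) u v, ← pow_succ]
      abel
    rw [h]
    exact add_mem (filt_mul_mul_mem hK ih hu) (Submodule.smul_of_tower_mem _ _
      (Submodule.mul_mem_mul (pow_mem_filt hu _) (hK v hv u hu)))

end Filtration

/-! ### Grading by spans of powers -/

section Grading

variable {k : Type*} [Field k] {A : Type*} [Ring A] [Algebra k A]
  {Δ : A →ₐ[k] A ⊗[k] A} {L : Submodule k A}

/-- The span of the `n`-th powers of the elements of `L`. -/
def powers (L : Submodule k A) (n : ℕ) : Submodule k A := Submodule.span k {a | ∃ u ∈ L, u ^ n = a}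

theorem pow_mem_powers {u : A} (hu : u ∈ L) (n : ℕ) : u ^ n ∈ powers L n :=
  Submodule.subset_span ⟨u, hu, rfl⟩

theorem powDeriv_mem_powers [CharZero k] {u v : A} (hu : u ∈ L) (hv : v ∈ L) (n : ℕ) :
    powDeriv u v n ∈ powers L n :=
  (hasJet_pow (k := k) u v n).mem _ fun t =>
    pow_mem_powers (add_mem hu (L.smul_mem t hv)) n

variable (h : PrimitivelyGenerated Δ L)
include h

/-- u ⊗ 1 and 1 ⊗ u commute, so Δ(uⁿ) expands binomially; multiplication sends every term to a
binomial coefficient times uⁿ, and these sum to 2ⁿ. -/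
theorem mul'_comp_comul_pow {u : A} (hu : u ∈ L) (n : ℕ) :
    LinearMap.mul' k A (Δ (u ^ n)) = (2 : k) ^ n • u ^ n := by
  have hc : Commute (u ⊗ₜ[k] (1 : A)) (1 ⊗ₜ u) := by
    simp [Commute, SemiconjBy, Algebra.TensorProduct.tmul_mul_tmul]
  rw [map_pow, h.prim u hu, hc.add_pow, map_sum]
  have : ∀ m ∈ Finset.range (n + 1), LinearMap.mul' k A
      ((u ⊗ₜ[k] (1 : A)) ^ m * (1 ⊗ₜ u) ^ (n - m) * (n.choose m : A ⊗[k] A)) =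
        (n.choose m) • u ^ n := by
    intro m hm
    rw [← nsmul_eq_mul', map_nsmul, Algebra.TensorProduct.tmul_pow, Algebra.TensorProduct.tmul_pow,
      Algebra.TensorProduct.tmul_mul_tmul]
    simp [← pow_add, Nat.add_sub_cancel' (Nat.lt_succ_iff.1 (Finset.mem_range.1 hm))]
  rw [Finset.sum_congr rfl this, ← Finset.sum_smul, Nat.sum_range_choose,
    ← Nat.cast_smul_eq_nsmul k]
  simp

theorem powers_le_eigenspace (n : ℕ) :
    powers L n ≤ Module.End.eigenspace (LinearMap.mul' k A ∘ₗ Δ.toLinearMap) ((2 : k) ^ n) := by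
  rw [powers, Submodule.span_le]
  rintro _ ⟨u, hu, rfl⟩
  exact Module.End.mem_eigenspace_iff.2 (h.mul'_comp_comul_pow hu n)

variable [CharZero k]

/-- The derivative of uᵐ⁺¹ in the direction v is a combination of powers by polarization, and it
equals (m + 1) uᵐ v up to shorter products. Characteristic zero allows division by m + 1, and
induction on the length finishes. -/
theorem filt_le_iSup_powers (n : ℕ) : filt L n ≤ ⨆ m ≤ n, powers L m := by
  induction n with
  | zero =>
    rw [filt_zero, Submodule.one_le]
    refine Submodule.mem_iSup_of_mem 0 (Submodule.mem_iSup_of_mem le_rfl ?_)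
    simpa using pow_mem_powers L.zero_mem 0
  | succ n ih =>
    have hmono : (⨆ m ≤ n, powers L m) ≤ ⨆ m ≤ n + 1, powers L m :=
      iSup₂_le fun m hm => le_iSup₂_of_le m (hm.trans n.le_succ) le_rfl
    rw [filt_succ, Submodule.mul_sup, mul_one]
    refine sup_le (ih.trans hmono) ?_
    refine (mul_le_mul_left ih L).trans ?_
    rw [Submodule.iSup_mul]
    refine iSup_le fun m => ?_
    rw [Submodule.iSup_mul]
    refine iSup_le fun hm => ?_
    rw [Submodule.mul_le]
    intro a ha v hv
    induction ha using Submodule.span_induction with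
    | zero => simp
    | add x y _ _ hx hy => rw [add_mul]; exact add_mem hx hy
    | smul c x _ hx => rw [smul_mul_assoc]; exact Submodule.smul_mem _ _ hx
    | mem x hx =>
      obtain ⟨u, hu, rfl⟩ := hx
      have hD : powDeriv u v (m + 1) ∈ ⨆ m ≤ n + 1, powers L m :=
        Submodule.mem_iSup_of_mem (m + 1) (Submodule.mem_iSup_of_mem (by omega)
          (powDeriv_mem_powers hu hv _))
      cases m with
      | zero => simpa [powDeriv] using hD
      | succ m =>
        have h1 := powDeriv_sub_mem (K := L) (fun a ha b hb => h.lie a ha b hb) hu hv m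
        have h2 : filt L m * L ≤ ⨆ m ≤ n + 1, powers L m := by
          refine le_trans ?_ (ih.trans hmono)
          refine le_trans ?_ (filt_mono L hm)
          rw [filt_succ]
          exact mul_le_mul_right le_sup_right _
        have h3 := sub_mem hD (h2 h1)
        rw [sub_sub_cancel] at h3
        have hne : ((m + 2 : ℕ) : k) ≠ 0 := by exact_mod_cast (m + 1).succ_ne_zero
        have h4 := Submodule.smul_mem _ ((m + 2 : ℕ) : k)⁻¹ h3
        rwa [← Nat.cast_smul_eq_nsmul k, smul_smul, inv_mul_cancel₀ hne, one_smul] at h4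

theorem iSup_powers : ⨆ n, powers L n = ⊤ := by
  rw [eq_top_iff]
  intro a _
  obtain ⟨n, hn⟩ := exists_mem_filt h.gen a
  have hle : (⨆ m ≤ n, powers L m) ≤ ⨆ m, powers L m := iSup₂_le fun m _ => le_iSup _ m
  exact hle (h.filt_le_iSup_powers n hn)

/-- The numbers 2ⁿ are distinct in characteristic zero, so the spans of powers sit in different
eigenspaces of multiplication ∘ Δ and are independent. No basis of A is needed. -/
theorem isInternal_powers : DirectSum.IsInternal (powers L) := by
  refine DirectSum.isInternal_submodule_of_iSupIndep_of_iSup_eq_top ?_ h.iSup_powers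
  have hinj : Function.Injective fun n : ℕ => (2 : k) ^ n := by
    intro m n hmn
    have : ((2 ^ m : ℕ) : k) = ((2 ^ n : ℕ) : k) := by simpa using hmn
    exact Nat.pow_right_injective le_rfl (Nat.cast_injective this)
  exact ((Module.End.eigenspaces_iSupIndep _).comp hinj).mono h.powers_le_eigenspace

theorem exists_proj (n : ℕ) : ∃ π : A →ₗ[k] A, ∀ u ∈ L, ∀ m,
    π (u ^ m) = if m = n then u ^ m else 0 := by
  classical
  let D := h.isInternal_powers.chooseDecomposition
  refine ⟨(powers L n).subtype ∘ₗ DirectSum.component k ℕ (fun i => powers L i) n ∘ₗ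
    (DirectSum.decomposeLinearEquiv (powers L)).toLinearMap, fun u hu m => ?_⟩
  have hm := pow_mem_powers hu m
  simp only [LinearMap.comp_apply, LinearEquiv.coe_coe, DirectSum.decomposeLinearEquiv_apply,
    DirectSum.component, Submodule.subtype_apply]
  split_ifs with hmn
  · subst hmn
    exact DirectSum.decompose_of_mem_same _ hm
  · exact DirectSum.decompose_of_mem_ne _ hm hmn

/-- The projection of `A` to the span of the `n`-th powers. -/
def proj (n : ℕ) : A →ₗ[k] A := (h.exists_proj n).choose

theorem proj_pow {u : A} (hu : u ∈ L) (m n : ℕ) :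
    h.proj n (u ^ m) = if m = n then u ^ m else 0 :=
  (h.exists_proj n).choose_spec u hu m

theorem proj_powDeriv {u v : A} (hu : u ∈ L) (hv : v ∈ L) (m n : ℕ) :
    h.proj n (powDeriv u v m) = if m = n then powDeriv u v m else 0 := by
  have hj := (hasJet_pow (k := k) u v m)
  split_ifs with hmn
  · refine (hj.map (h.proj n)).unique (a' := u ^ m) ?_
    simpa [h.proj_pow (add_mem hu (L.smul_mem _ hv)), hmn] using hj
  · refine (hj.map (h.proj n)).unique (a' := 0) ?_
    simpa [h.proj_pow (add_mem hu (L.smul_mem _ hv)), hmn] using HasJet.const (k := k) (0 : A)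

/-- Together with `exists_linear_pow` this lets later operators be specified, and identities between
them checked, on powers alone. -/
theorem hom_ext {M : Type*} [AddCommGroup M] [Module k M] {f g : A →ₗ[k] M}
    (hfg : ∀ u ∈ L, ∀ n, f (u ^ n) = g (u ^ n)) : f = g := by
  refine LinearMap.ext fun a => ?_
  have ha : a ∈ ⨆ n, powers L n := h.iSup_powers ▸ Submodule.mem_top
  have hle : ⨆ n, powers L n ≤ LinearMap.eqLocus f g := by
    refine iSup_le fun n => Submodule.span_le.2 ?_
    rintro _ ⟨u, hu, rfl⟩
    exact hfg u hu n
  exact hle ha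

theorem exists_linear_pow {M : Type*} [AddCommGroup M] [Module k M] (c : ℕ → A →ₗ[k] M) :
    ∃ f : A →ₗ[k] M, ∀ u ∈ L, ∀ n, f (u ^ n) = c n (u ^ n) := by
  classical
  let D := h.isInternal_powers.chooseDecomposition
  refine ⟨DirectSum.toModule k ℕ M (fun n => c n ∘ₗ (powers L n).subtype) ∘ₗ
    (DirectSum.decomposeLinearEquiv (powers L)).toLinearMap, fun u hu n => ?_⟩
  have hm := pow_mem_powers hu n
  simp only [LinearMap.comp_apply, LinearEquiv.coe_coe, DirectSum.decomposeLinearEquiv_apply]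
  rw [DirectSum.decompose_of_mem _ hm]
  erw [DirectSum.toModule_lof]
  rfl

theorem proj_of_mem_filt {n m : ℕ} (hnm : n < m) {a : A} (ha : a ∈ filt L n) :
    h.proj m a = 0 := by
  have hle : (⨆ i ≤ n, powers L i) ≤ LinearMap.ker (h.proj m) := by
    refine iSup₂_le fun i hi => Submodule.span_le.2 ?_
    rintro _ ⟨u, hu, rfl⟩
    simp [h.proj_pow hu, show i ≠ m by omega]
  exact hle (h.filt_le_iSup_powers n ha)

/-- The derivative of uᵐ⁺² is homogeneous of degree m + 2, so it has no component of degree one.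
Hence the degree-one part of uᵐ⁺¹ v comes from products with a shorter prefix, and the descent ends
at elements of K itself. Consequently the left ideal generated by K meets L only in K. -/
theorem proj_one_mem {K : Submodule k A} (hKL : K ≤ L)
    (hK : ∀ v ∈ K, ∀ u ∈ L, v * u - u * v ∈ K) (n : ℕ) {a : A} (ha : a ∈ filt L n * K) :
    h.proj 1 a ∈ K := by
  induction n using Nat.strong_induction_on generalizing a with
  | _ n ih =>
  have hle : (⨆ i ≤ n, powers L i) * K ≤ K.comap (h.proj 1) := by
    rw [Submodule.iSup_mul]
    refine iSup_le fun m => ?_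
    rw [Submodule.iSup_mul]
    refine iSup_le fun hm => ?_
    rw [Submodule.mul_le]
    intro b hb v hv
    induction hb using Submodule.span_induction with
    | zero => simp
    | add x y _ _ hx hy => rw [add_mul]; exact add_mem hx hy
    | smul c x _ hx => rw [smul_mul_assoc]; exact Submodule.smul_mem _ _ hx
    | mem x hx =>
      obtain ⟨u, hu, rfl⟩ := hx
      cases m with
      | zero =>
        have := h.proj_pow (hKL hv) 1 1
        simp only [pow_one, if_true] at this
        simpa [this] using hv
      | succ m =>
        have h1 := ih m (by omega) (powDeriv_sub_mem hK hu hv m)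
        rw [map_sub, h.proj_powDeriv hu (hKL hv), if_neg (by omega), zero_sub, map_nsmul] at h1
        have hne : ((m + 2 : ℕ) : k) ≠ 0 := by exact_mod_cast (m + 1).succ_ne_zero
        have h4 := Submodule.smul_mem _ ((m + 2 : ℕ) : k)⁻¹ (neg_mem h1)
        rwa [neg_neg, ← Nat.cast_smul_eq_nsmul k, smul_smul, inv_mul_cancel₀ hne,
          one_smul] at h4
  exact hle (mul_le_mul_left (h.filt_le_iSup_powers n) K ha)

end Grading

end PrimitivelyGenerated

/-! ### Lie polynomials in the tensor algebra and their values in g -/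

namespace UniversalEnvelopingAlgebra

section FreeCover

variable (k : Type*) [Field k] (g : Type*) [LieRing g] [LieAlgebra k g]

/-- The comultiplication of the tensor algebra for which the elements of `g` are primitive. -/
def tensorComul : TensorAlgebra k g →ₐ[k] TensorAlgebra k g ⊗[k] TensorAlgebra k g :=
  TensorAlgebra.lift k
    ((TensorProduct.mk k (TensorAlgebra k g) (TensorAlgebra k g)).flip 1 ∘ₗ TensorAlgebra.ι k +
      TensorProduct.mk k (TensorAlgebra k g) (TensorAlgebra k g) 1 ∘ₗ TensorAlgebra.ι k)

theorem tensorComul_ι (x : g) : tensorComul k g (TensorAlgebra.ι k x) =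
    TensorAlgebra.ι k x ⊗ₜ 1 + 1 ⊗ₜ TensorAlgebra.ι k x := by
  simp [tensorComul]

/-- The action of the tensor algebra on `g × k` by `x • (w, c) = (⁅x, w⁆ + c x, 0)`. -/
def affineRep : TensorAlgebra k g →ₐ[k] Module.End k (g × k) :=
  TensorAlgebra.lift k (LinearMap.mk₂ k (fun (x : g) (p : g × k) => ((⁅x, p.1⁆ + p.2 • x, 0) : g × k))
    (by intro x y p; ext <;> simp [add_lie]; abel)
    (by intro c x p; ext <;> simp [smul_add, smul_comm c])
    (by intro x p q; ext <;> simp [add_smul]; abel)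
    (by intro c x p; ext <;> simp [smul_add, mul_smul]))

theorem affineRep_ι (x w : g) (c : k) :
    affineRep k g (TensorAlgebra.ι k x) (w, c) = (⁅x, w⁆ + c • x, 0) := by
  simp [affineRep]

/-- Pairs of a primitive homogeneous tensor of degree `n + 1` and its value in `g`. -/
def evalGraph (n : ℕ) : Submodule k (TensorAlgebra k g × g) where
  carrier := {p | p.1 ∈ LinearMap.range (TensorAlgebra.ι k : g →ₗ[k] TensorAlgebra k g) ^ (n + 1) ∧
    tensorComul k g p.1 = p.1 ⊗ₜ 1 + 1 ⊗ₜ p.1 ∧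
    ∀ (w : g) (c : k), affineRep k g p.1 (w, c) = (⁅p.2, w⁆ + c • ((n + 1 : ℕ) : k) • p.2, 0)}
  add_mem' := by
    rintro p q ⟨h1, h2, h3⟩ ⟨h1', h2', h3'⟩
    refine ⟨add_mem h1 h1', ?_, fun w c => ?_⟩
    · rw [Prod.fst_add, map_add, h2, h2', TensorProduct.add_tmul, TensorProduct.tmul_add]
      abel
    · rw [Prod.fst_add, map_add, LinearMap.add_apply, h3, h3', Prod.mk_add_mk, Prod.snd_add, add_lie,
        smul_add, smul_add, add_zero]
      congr 1
      abel
  zero_mem' := ⟨by simp, by simp, fun w c => by simp [Prod.ext_iff]⟩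
  smul_mem' := by
    rintro a p ⟨h1, h2, h3⟩
    refine ⟨Submodule.smul_mem _ a h1, ?_, fun w c => ?_⟩
    · rw [Prod.smul_fst, map_smul, h2, smul_add, TensorProduct.smul_tmul', TensorProduct.tmul_smul]
    · rw [Prod.smul_fst, map_smul, LinearMap.smul_apply, h3, Prod.smul_mk, Prod.smul_snd, smul_lie,
        smul_add, smul_zero, smul_comm a c, smul_comm a ((n + 1 : ℕ) : k)]

/-- The representation is by affine maps: the linear part is ad of the value and the translation
part is the value times the degree. The commutator of (ad v, r v) and (ad w, s w) has translation
part s[v, w] - r[w, v] = (r + s)[v, w], so degrees add. Here r = m + 1 and s = n + 1. -/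
theorem bracket_mem_evalGraph {m n : ℕ} {p q : TensorAlgebra k g × g} (hp : p ∈ evalGraph k g m)
    (hq : q ∈ evalGraph k g n) :
    (p.1 * q.1 - q.1 * p.1, ⁅p.2, q.2⁆) ∈ evalGraph k g (m + n + 1) := by
  obtain ⟨h1, h2, h3⟩ := hp
  obtain ⟨h1', h2', h3'⟩ := hq
  refine ⟨sub_mem ?_ ?_, ?_, fun w c => ?_⟩
  · rw [show m + n + 1 + 1 = (m + 1) + (n + 1) by omega, pow_add]
    exact Submodule.mul_mem_mul h1 h1'
  · rw [show m + n + 1 + 1 = (n + 1) + (m + 1) by omega, pow_add]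
    exact Submodule.mul_mem_mul h1' h1
  · simp only [map_sub, map_mul, h2, h2', mul_add, add_mul, Algebra.TensorProduct.tmul_mul_tmul,
      mul_one, one_mul, TensorProduct.sub_tmul, TensorProduct.tmul_sub]
    abel
  · simp only [map_sub, map_mul, LinearMap.sub_apply, Module.End.mul_apply, h3, h3']
    ext
    · simp only [zero_smul, add_zero, lie_add, lie_smul, Prod.fst_sub, lie_lie]
      rw [← lie_skew q.2 p.2]
      push_cast
      module
    · simp

/-- The graph of the evaluation in `g` of Lie polynomials in elements of `g`. -/
def evalRelation : Submodule k (TensorAlgebra k g × g) := ⨆ n, evalGraph k g n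

theorem bracket_mem_evalRelation {p q : TensorAlgebra k g × g} (hp : p ∈ evalRelation k g)
    (hq : q ∈ evalRelation k g) : (p.1 * q.1 - q.1 * p.1, ⁅p.2, q.2⁆) ∈ evalRelation k g := by
  induction hp using Submodule.iSup_induction' with
  | zero =>
    convert zero_mem (evalRelation k g) using 1
    ext <;> simp
  | add x y _ _ hx hy =>
    convert add_mem hx hy using 1
    ext <;> simp [add_mul, mul_add]
    abel
  | mem m p hp =>
    induction hq using Submodule.iSup_induction' with
    | zero =>
      convert zero_mem (evalRelation k g) using 1
      ext <;> simp
    | add x y _ _ hx hy =>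
      convert add_mem hx hy using 1
      ext <;> simp [add_mul, mul_add]
      abel
    | mem n q hq => exact Submodule.mem_iSup_of_mem _ (bracket_mem_evalGraph k g hp hq)

theorem tensorComul_of_mem_evalRelation {p : TensorAlgebra k g × g} (hp : p ∈ evalRelation k g) :
    tensorComul k g p.1 = p.1 ⊗ₜ 1 + 1 ⊗ₜ p.1 := by
  induction hp using Submodule.iSup_induction' with
  | zero => simp
  | add x y _ _ hx hy =>
    rw [Prod.fst_add, map_add, hx, hy, TensorProduct.add_tmul, TensorProduct.tmul_add]
    abel
  | mem m p hp => exact hp.2.1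

theorem ι_mem_evalRelation (x : g) : (TensorAlgebra.ι k x, x) ∈ evalRelation k g := by
  refine Submodule.mem_iSup_of_mem 0 ⟨?_, tensorComul_ι k g x, fun w c => ?_⟩
  · rw [zero_add, pow_one]
    exact ⟨x, rfl⟩
  · simpa using affineRep_ι k g x w c

/-- Evaluation of Lie polynomials is thereby well defined: the graph is split by tensor degree, and
the affine representation recovers the value in each degree. -/
theorem eq_zero_of_mem_evalRelation [CharZero k] {v : g} (hv : (0, v) ∈ evalRelation k g) :
    v = 0 := by
  classical
  obtain ⟨f, hf⟩ := (Submodule.mem_iSup_iff_exists_dfinsupp' _ _).1 hv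
  have hfst : (f.sum fun _ p => (p : TensorAlgebra k g × g).1) = 0 := by
    have := congrArg Prod.fst hf
    rwa [DFinsupp.sum, Prod.fst_sum] at this
  have hsnd : (f.sum fun _ p => (p : TensorAlgebra k g × g).2) = v := by
    have := congrArg Prod.snd hf
    rwa [DFinsupp.sum, Prod.snd_sum] at this
  have hcomp : ∀ n, (f n : TensorAlgebra k g × g).1 = 0 := by
    intro n
    by_cases hn : n ∈ f.support
    · have h := congrArg (fun t => (DirectSum.decompose (fun i : ℕ =>
        LinearMap.range (TensorAlgebra.ι k : g →ₗ[k] TensorAlgebra k g) ^ i) t (n + 1) :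
          TensorAlgebra k g)) hfst
      simp only [DFinsupp.sum, DirectSum.decompose_sum, DirectSum.decompose_zero] at h
      rw [DFinsupp.finsetSum_apply, AddSubmonoidClass.coe_finsetSum,
        Finset.sum_eq_single n] at h
      · rwa [DirectSum.decompose_of_mem_same _ (f n).2.1] at h
      · intro m _ hmn
        exact DirectSum.decompose_of_mem_ne _ (f m).2.1 (by omega)
      · exact fun h => absurd hn h
    · rw [DFinsupp.notMem_support_iff.1 hn]
      rfl
  rw [← hsnd]
  refine Finset.sum_eq_zero fun n _ => ?_
  -- Applied to (0, 1), the zero tensor of degree n + 1 must give n + 1 times its value.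
  have h := (f n).2.2.2 0 1
  rw [hcomp n, map_zero, LinearMap.zero_apply, lie_zero, zero_add, one_smul] at h
  have h' : (0 : g) = ((n + 1 : ℕ) : k) • (f n : TensorAlgebra k g × g).2 := congrArg Prod.fst h
  exact (smul_eq_zero.1 h'.symm).resolve_left (by exact_mod_cast n.succ_ne_zero)

/-- The Lie polynomials in elements of `g`. -/
def lieTensors : Submodule k (TensorAlgebra k g) :=
  (evalRelation k g).map (LinearMap.fst k _ _)

/-- The Lie polynomials in elements of `g` that evaluate to zero in `g`. -/
def lieRelations : Submodule k (TensorAlgebra k g) :=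
  (evalRelation k g).comap (LinearMap.inl k _ _)

theorem mem_lieTensors {u : TensorAlgebra k g} :
    u ∈ lieTensors k g ↔ ∃ v, (u, v) ∈ evalRelation k g := by
  constructor
  · rintro ⟨p, hp, rfl⟩
    exact ⟨p.2, hp⟩
  · rintro ⟨v, hv⟩
    exact ⟨_, hv, rfl⟩

theorem mem_lieRelations {u : TensorAlgebra k g} :
    u ∈ lieRelations k g ↔ (u, 0) ∈ evalRelation k g := Iff.rfl

theorem primitivelyGenerated_tensor :
    PrimitivelyGenerated (tensorComul k g) (lieTensors k g) where
  prim := by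
    intro v hv
    obtain ⟨x, hx⟩ := (mem_lieTensors k g).1 hv
    exact tensorComul_of_mem_evalRelation k g hx
  lie := by
    intro u hu v hv
    obtain ⟨x, hx⟩ := (mem_lieTensors k g).1 hu
    obtain ⟨y, hy⟩ := (mem_lieTensors k g).1 hv
    exact (mem_lieTensors k g).2 ⟨_, bracket_mem_evalRelation k g hx hy⟩
  gen := by
    rw [eq_top_iff, ← TensorAlgebra.adjoin_range_ι]
    refine Algebra.adjoin_mono ?_
    rintro _ ⟨x, rfl⟩
    exact (mem_lieTensors k g).2 ⟨x, ι_mem_evalRelation k g x⟩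

theorem lieRelations_le : lieRelations k g ≤ lieTensors k g :=
  fun _ hu => (mem_lieTensors k g).2 ⟨0, hu⟩

theorem commutator_mem_lieRelations : ∀ v ∈ lieRelations k g, ∀ u ∈ lieTensors k g,
    v * u - u * v ∈ lieRelations k g := by
  intro v hv u hu
  obtain ⟨x, hx⟩ := (mem_lieTensors k g).1 hu
  have := bracket_mem_evalRelation k g ((mem_lieRelations k g).1 hv) hx
  rwa [zero_lie] at this

end FreeCover

/-! ### Embedding of g into U(g) -/

section Injective

variable (k : Type*) [Field k] (g : Type*) [LieRing g] [LieAlgebra k g]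

/-- The ideal of the tensor algebra generated by the relations of `g`. -/
def relationIdeal : Submodule (TensorAlgebra k g) (TensorAlgebra k g) :=
  Submodule.span _ (lieRelations k g : Set (TensorAlgebra k g))

theorem exists_filt_of_mem_relationIdeal {a : TensorAlgebra k g} (ha : a ∈ relationIdeal k g) :
    ∃ n, a ∈ PrimitivelyGenerated.filt (lieTensors k g) n * lieRelations k g := by
  have hmono {m n : ℕ} (h : m ≤ n) : PrimitivelyGenerated.filt (lieTensors k g) m *
      lieRelations k g ≤ PrimitivelyGenerated.filt (lieTensors k g) n * lieRelations k g :=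
    mul_le_mul_left (PrimitivelyGenerated.filt_mono _ h) _
  induction ha using Submodule.span_induction with
  | mem x hx => exact ⟨0, by rwa [PrimitivelyGenerated.filt_zero, one_mul]⟩
  | zero => exact ⟨0, zero_mem _⟩
  | add x y _ _ hx hy =>
    obtain ⟨m, hm⟩ := hx
    obtain ⟨n, hn⟩ := hy
    exact ⟨max m n, add_mem (hmono (le_max_left _ _) hm) (hmono (le_max_right _ _) hn)⟩
  | smul t x _ hx =>
    obtain ⟨n, hn⟩ := hx
    obtain ⟨m, hm⟩ := PrimitivelyGenerated.exists_mem_filt (primitivelyGenerated_tensor k g).gen t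
    refine ⟨m + n, ?_⟩
    rw [PrimitivelyGenerated.filt_add, mul_assoc]
    exact Submodule.mul_mem_mul hm hn

/-- The commutator of a relation with a Lie polynomial is again a relation, so this left ideal is
two-sided. It follows that the relation between x y - y x and [x, y] acts by zero on the whole
quotient, which is thus a g-module. -/
theorem mul_mem_relationIdeal {a : TensorAlgebra k g} (ha : a ∈ relationIdeal k g)
    (t : TensorAlgebra k g) : a * t ∈ relationIdeal k g := by
  have ht : t ∈ Algebra.adjoin k (lieTensors k g : Set (TensorAlgebra k g)) :=
    (primitivelyGenerated_tensor k g).gen ▸ Algebra.mem_top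
  induction ht using Algebra.adjoin_induction generalizing a with
  | mem u hu =>
    induction ha using Submodule.span_induction with
    | mem x hx =>
      rw [← sub_add_cancel (x * u) (u * x)]
      exact add_mem (Submodule.subset_span (commutator_mem_lieRelations k g x hx u hu))
        (Submodule.smul_mem _ u (Submodule.subset_span hx))
    | zero => simp
    | add x y _ _ hx hy => rw [add_mul]; exact add_mem hx hy
    | smul s x _ hx => rw [smul_mul_assoc]; exact Submodule.smul_mem _ s hx
  | algebraMap r =>
    rw [← Algebra.commutes]
    exact Submodule.smul_mem _ (algebraMap k (TensorAlgebra k g) r) ha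
  | add x y _ _ hx hy => rw [mul_add]; exact add_mem (hx ha) (hy ha)
  | mul x y _ _ hx hy => rw [← mul_assoc]; exact hy (hx ha)

attribute [local instance 100] LieRing.ofAssociativeRing

/-- The action of `g` on the quotient of the tensor algebra by the relations of `g`. -/
def relationQuotientRep : g →ₗ⁅k⁆ Module.End k (TensorAlgebra k g ⧸ relationIdeal k g) :=
  { (Algebra.lsmul k k (TensorAlgebra k g ⧸ relationIdeal k g)).toLinearMap ∘ₗ
      TensorAlgebra.ι k with
    map_lie' := by
      intro x y
      refine LinearMap.ext fun q => ?_
      obtain ⟨t, rfl⟩ := Submodule.Quotient.mk_surjective _ q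
      have h1 : TensorAlgebra.ι k x * TensorAlgebra.ι k y -
          TensorAlgebra.ι k y * TensorAlgebra.ι k x - TensorAlgebra.ι k ⁅x, y⁆ ∈
            lieRelations k g := by
        have := sub_mem (bracket_mem_evalRelation k g (ι_mem_evalRelation k g x)
          (ι_mem_evalRelation k g y)) (ι_mem_evalRelation k g ⁅x, y⁆)
        rw [mem_lieRelations]
        simpa using this
      have h2 := mul_mem_relationIdeal k g (Submodule.subset_span h1) t
      rw [← Submodule.Quotient.mk_eq_zero] at h2
      rw [LieRing.of_associative_ring_bracket]
      let q : TensorAlgebra k g ⧸ relationIdeal k g := Submodule.Quotient.mk t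
      change TensorAlgebra.ι k ⁅x, y⁆ • q =
        TensorAlgebra.ι k x • TensorAlgebra.ι k y • q -
          TensorAlgebra.ι k y • TensorAlgebra.ι k x • q
      rw [← sub_eq_zero, ← neg_eq_zero, ← h2]
      simp only [q, ← Submodule.Quotient.mk_smul, ← Submodule.Quotient.mk_sub,
        ← Submodule.Quotient.mk_neg, smul_eq_mul]
      congr 1
      noncomm_ring }

theorem relationQuotientRep_mk_one (x : g) : relationQuotientRep k g x (Submodule.Quotient.mk 1) =
    Submodule.Quotient.mk (TensorAlgebra.ι k x) := by
  change TensorAlgebra.ι k x • (Submodule.Quotient.mk 1 : TensorAlgebra k g ⧸ relationIdeal k g) = _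
  rw [← Submodule.Quotient.mk_smul, smul_eq_mul, mul_one]

/-- A Lie algebra embeds into its universal enveloping algebra. -/
theorem ι_injective [CharZero k] :
    Function.Injective (ι k : g →ₗ⁅k⁆ UniversalEnvelopingAlgebra k g) := by
  refine (injective_iff_map_eq_zero _).2 fun x hx => ?_
  -- If x vanishes in U(g), it acts by zero on the class of 1, so the tensor x lies in the ideal of
  -- relations. Its degree-one part, which is itself, is then a relation: x evaluates both to x and
  -- to 0.
  have h := lift_ι_apply k (relationQuotientRep k g) x
  rw [hx, map_zero] at h
  have h1 := relationQuotientRep_mk_one k g x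
  rw [← h, LinearMap.zero_apply, eq_comm, Submodule.Quotient.mk_eq_zero] at h1
  obtain ⟨n, hn⟩ := exists_filt_of_mem_relationIdeal k g h1
  have h2 := (primitivelyGenerated_tensor k g).proj_one_mem (lieRelations_le k g)
    (commutator_mem_lieRelations k g) n hn
  have h3 := (primitivelyGenerated_tensor k g).proj_pow
    ((mem_lieTensors k g).2 ⟨x, ι_mem_evalRelation k g x⟩) 1 1
  rw [pow_one, if_pos rfl] at h3
  rw [h3, mem_lieRelations] at h2
  refine eq_zero_of_mem_evalRelation k g ?_
  simpa using sub_mem (ι_mem_evalRelation k g x) h2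

end Injective

end UniversalEnvelopingAlgebra

/-! ### Polynomial calculus on U(g) -/

namespace UniversalEnvelopingAlgebra

section Operators

variable (k : Type*) [Field k] (g : Type*) [LieRing g] [LieAlgebra k g]

attribute [local instance 100] LieRing.ofAssociativeRing

local notation "U" => UniversalEnvelopingAlgebra k g
local notation "Δ" => Bialgebra.comulAlgHom k (UniversalEnvelopingAlgebra k g)
local notation "ε" => Bialgebra.counitAlgHom k (UniversalEnvelopingAlgebra k g)

theorem ι_lie (x y : g) : (ι k ⁅x, y⁆ : U) = ι k x * ι k y - ι k y * ι k x := by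
  rw [LieHom.map_lie, LieRing.of_associative_ring_bracket]

/-- The universal property sends U(g) into the subalgebra generated by g, and the composite with the
inclusion is the identity. -/
theorem adjoin_range_ι : Algebra.adjoin k
    (LinearMap.range (ι k : g →ₗ⁅k⁆ U).toLinearMap : Set U) = ⊤ := by
  let S := Algebra.adjoin k (LinearMap.range (ι k : g →ₗ⁅k⁆ U).toLinearMap : Set U)
  have hS (x : g) : ι k x ∈ S := Algebra.subset_adjoin ⟨x, rfl⟩
  let φ : U →ₐ[k] S := lift k
    { (ι k : g →ₗ⁅k⁆ U).toLinearMap.codRestrict (Subalgebra.toSubmodule S) hS with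
      map_lie' := by
        intro x y
        exact Subtype.ext (ι_lie k g x y) }
  have h : S.val.comp φ = AlgHom.id k U := by
    refine algHom_ext_ι k g fun x => ?_
    change ((φ (ι k x) : S) : U) = ι k x
    rw [show φ (ι k x) = _ from lift_ι_apply k _ x]
    rfl
  refine eq_top_iff.2 fun a _ => ?_
  have := congrArg (fun f : U →ₐ[k] U => f a) h
  rw [show a = (φ a : U) from this.symm]
  exact (φ a).2

theorem primitivelyGenerated :
    PrimitivelyGenerated Δ (LinearMap.range (ι k : g →ₗ⁅k⁆ U).toLinearMap) where
  prim := by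
    rintro _ ⟨x, rfl⟩
    exact comul_ι k g x
  lie := by
    rintro _ ⟨x, rfl⟩ _ ⟨y, rfl⟩
    exact ⟨⁅x, y⁆, ι_lie k g x y⟩
  gen := adjoin_range_ι k g

variable {k g} in
theorem ι_mem_range (x : g) : ι k x ∈ LinearMap.range (ι k : g →ₗ⁅k⁆ U).toLinearMap := ⟨x, rfl⟩

theorem comul_pow (x : g) (n : ℕ) : Δ (ι k x ^ n) =
    ∑ m ∈ Finset.HasAntidiagonal.antidiagonal n, n.choose m.1 • ((ι k x ^ m.1) ⊗ₜ[k] (ι k x ^ m.2)) := by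
  have hc : Commute ((ι k x : U) ⊗ₜ[k] (1 : U)) (1 ⊗ₜ ι k x) := by
    simp only [Commute, SemiconjBy, Algebra.TensorProduct.tmul_mul_tmul, one_mul, mul_one]
  rw [map_pow, comul_ι, hc.add_pow']
  simp only [Algebra.TensorProduct.tmul_pow, Algebra.TensorProduct.tmul_mul_tmul, one_pow, one_mul,
    mul_one]

theorem hasJet_ι_pow (x v : g) (n : ℕ) :
    HasJet (fun t : k => (ι k (x + t • v) : U) ^ n) (ι k x ^ n) (powDeriv (ι k x) (ι k v) n) := by
  simpa only [map_add, map_smul] using hasJet_pow (k := k) (ι k x : U) (ι k v) n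

theorem counit_pow (x : g) (n : ℕ) : ε (ι k x ^ n) = if n = 0 then 1 else 0 := by
  rw [map_pow, counit_ι]
  split_ifs with h
  · rw [h, pow_zero]
  · rw [zero_pow h]

variable [CharZero k]

variable {k g} in
theorem linearMap_ext_pow {M : Type*} [AddCommGroup M] [Module k M] {f f' : U →ₗ[k] M}
    (h : ∀ (x : g) (n : ℕ), f (ι k x ^ n) = f' (ι k x ^ n)) : f = f' := by
  refine (primitivelyGenerated k g).hom_ext ?_
  rintro _ ⟨x, rfl⟩ n
  exact h x n

variable {k g} in
theorem tensor_linearMap_ext_pow {M V : Type*} [AddCommGroup M] [Module k M] [AddCommGroup V]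
    [Module k V] {f f' : U ⊗[k] V →ₗ[k] M}
    (h : ∀ (x : g) (n : ℕ) (v : V), f ((ι k x ^ n) ⊗ₜ v) = f' ((ι k x ^ n) ⊗ₜ v)) : f = f' :=
  TensorProduct.ext (linearMap_ext_pow fun x n => LinearMap.ext fun v => h x n v)

theorem exists_linear_pow {M : Type*} [AddCommGroup M] [Module k M] (c : ℕ → U →ₗ[k] M) :
    ∃ f : U →ₗ[k] M, ∀ (x : g) n, f (ι k x ^ n) = c n (ι k x ^ n) := by
  obtain ⟨f, hf⟩ := (primitivelyGenerated k g).exists_linear_pow c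
  exact ⟨f, fun x n => hf _ (ι_mem_range x) n⟩

/-- The embedding of g enters here: in degree one the projection is a linear left inverse of `ι`. -/
theorem exists_primitivePart :
    ∃ p : U →ₗ[k] g, ∀ (x : g) n, p (ι k x ^ n) = if n = 1 then x else 0 := by
  obtain ⟨r, hr⟩ := (ι k : g →ₗ⁅k⁆ U).toLinearMap.exists_leftInverse_of_injective
    (LinearMap.ker_eq_bot.2 (ι_injective k g))
  obtain ⟨p, hp⟩ := exists_linear_pow k g fun n => if n = 1 then r else 0
  refine ⟨p, fun x n => ?_⟩
  rw [hp]
  split_ifs with h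
  · rw [h, pow_one]
    exact LinearMap.congr_fun hr x
  · rfl

/-- The projection of `U(g)` to its primitive part `g` that vanishes on the other powers of
elements of `g`. -/
def primitivePart : U →ₗ[k] g := (exists_primitivePart k g).choose

theorem primitivePart_pow (x : g) (n : ℕ) :
    primitivePart k g (ι k x ^ n) = if n = 1 then x else 0 :=
  (exists_primitivePart k g).choose_spec x n

theorem primitivePart_ι (x : g) : primitivePart k g (ι k x) = x := by
  simpa only [pow_one, if_true] using primitivePart_pow k g x 1

theorem primitivePart_one : primitivePart k g 1 = 0 := by
  simpa only [pow_zero, zero_ne_one, if_false] using primitivePart_pow k g 0 0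

/-- The linear map with `x ^ n ↦ c n • x ^ n` for `x` in `g`. -/
def scalePow (c : ℕ → k) : U →ₗ[k] U := (exists_linear_pow k g fun n => c n • LinearMap.id).choose

theorem scalePow_pow (c : ℕ → k) (x : g) (n : ℕ) :
    scalePow k g c (ι k x ^ n) = c n • ι k x ^ n :=
  (exists_linear_pow k g fun n => c n • LinearMap.id).choose_spec x n

/-- The product xⁿ v and the symmetrized one differ by products of length at most n, which the
projection to degree n + 1 kills. So the symmetrized product is the top component of the ordinary
one, and its linearity is automatic. -/
theorem exists_symMul : ∃ f : U →ₗ[k] g →ₗ[k] U, ∀ (x v : g) n,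
    f (ι k x ^ n) v = ((n + 1 : ℕ) : k)⁻¹ • powDeriv (ι k x) (ι k v) (n + 1) := by
  obtain ⟨f, hf⟩ := exists_linear_pow k g fun n =>
    ((LinearMap.mul k U).compl₂ (ι k : g →ₗ⁅k⁆ U).toLinearMap).compr₂
      ((primitivelyGenerated k g).proj (n + 1))
  refine ⟨f, fun x v n => ?_⟩
  rw [hf]
  change (primitivelyGenerated k g).proj (n + 1) (ι k x ^ n * ι k v) = _
  have hD := (primitivelyGenerated k g).proj_powDeriv (ι_mem_range x) (ι_mem_range v) (n + 1) (n + 1)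
  rw [if_pos rfl] at hD
  have hne : ((n + 1 : ℕ) : k) ≠ 0 := by exact_mod_cast n.succ_ne_zero
  rw [eq_inv_smul_iff₀ hne, Nat.cast_smul_eq_nsmul, ← map_nsmul, ← sub_eq_zero]
  conv_lhs => rw [← hD]
  rw [← map_sub]
  cases n with
  | zero => simp [powDeriv]
  | succ n =>
    refine (primitivelyGenerated k g).proj_of_mem_filt (n + 1).lt_succ_self ?_
    rw [← neg_mem_iff, neg_sub]
    have h := PrimitivelyGenerated.powDeriv_sub_mem (primitivelyGenerated k g).lie (ι_mem_range x)
      (ι_mem_range v) n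
    rw [PrimitivelyGenerated.filt_succ]
    have hle := mul_le_mul_right (le_sup_right : LinearMap.range (ι k : g →ₗ⁅k⁆ U).toLinearMap ≤ 1 ⊔ _)
      (PrimitivelyGenerated.filt (LinearMap.range (ι k : g →ₗ⁅k⁆ U).toLinearMap) n)
    exact hle h

/-- The symmetrized product `U(g) ⊗ g → U(g)`. -/
def symMul : U ⊗[k] g →ₗ[k] U := TensorProduct.lift (exists_symMul k g).choose

theorem symMul_pow (x v : g) (n : ℕ) : symMul k g ((ι k x ^ n) ⊗ₜ v) =
    ((n + 1 : ℕ) : k)⁻¹ • powDeriv (ι k x) (ι k v) (n + 1) := by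
  rw [symMul, TensorProduct.lift.tmul]
  exact (exists_symMul k g).choose_spec x v n

/-- The total derivative `U(g) → U(g) ⊗ g`, namely `x ^ n ↦ n x ^ (n - 1) ⊗ x`. -/
def totalDeriv : U →ₗ[k] U ⊗[k] g := (primitivePart k g).lTensor U ∘ₗ (Δ).toLinearMap

theorem totalDeriv_apply (a : U) : totalDeriv k g a = (primitivePart k g).lTensor U (Δ a) := rfl

theorem totalDeriv_one : totalDeriv k g 1 = 0 := by
  rw [totalDeriv_apply, map_one, Algebra.TensorProduct.one_def, LinearMap.lTensor_tmul,
    primitivePart_one, TensorProduct.tmul_zero]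

theorem totalDeriv_pow_succ (x : g) (n : ℕ) :
    totalDeriv k g (ι k x ^ (n + 1)) = ((n + 1 : ℕ) : k) • ((ι k x ^ n) ⊗ₜ x) := by
  rw [totalDeriv_apply, comul_pow, map_sum, Finset.sum_eq_single (n, 1)]
  · rw [map_nsmul, LinearMap.lTensor_tmul, primitivePart_pow, if_pos rfl, Nat.choose_succ_self_right,
      Nat.cast_smul_eq_nsmul]
  · rintro ⟨i, j⟩ hij hne
    have hij' := Finset.HasAntidiagonal.mem_antidiagonal.1 hij
    simp only at hij'
    rw [map_nsmul, LinearMap.lTensor_tmul, primitivePart_pow, if_neg, TensorProduct.tmul_zero,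
      smul_zero]
    rintro rfl
    exact hne (by rw [show i = n by omega])
  · exact fun h => (h (Finset.HasAntidiagonal.mem_antidiagonal.2 rfl)).elim

/-- This is the formula for powers at x + t v, compared at first order in t. -/
theorem totalDeriv_powDeriv_succ (x v : g) (n : ℕ) :
    totalDeriv k g (powDeriv (ι k x) (ι k v) (n + 1)) =
      ((n + 1 : ℕ) : k) • ((ι k x ^ n) ⊗ₜ v + powDeriv (ι k x) (ι k v) n ⊗ₜ x) := by
  have hj := hasJet_ι_pow k g x v n
  refine ((hasJet_ι_pow k g x v (n + 1)).map (totalDeriv k g)).unique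
    (a' := ((n + 1 : ℕ) : k) • ((ι k x ^ n) ⊗ₜ x + 0)) ?_
  have h := ((hj.map ((TensorProduct.mk k U g).flip x)).add
    (hj.map ((TensorProduct.mk k U g).flip v)).smul_var).map (((n + 1 : ℕ) : k) • LinearMap.id)
  simp only [LinearMap.smul_apply, LinearMap.id_apply, LinearMap.flip_apply,
    TensorProduct.mk_apply] at h
  rw [add_comm ((ι k x ^ n) ⊗ₜ[k] v)]
  convert h using 2 with t
  rw [totalDeriv_pow_succ, TensorProduct.tmul_add, TensorProduct.tmul_smul]

/-- Euler's identity for homogeneous polynomials. -/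
theorem symMul_comp_totalDeriv :
    symMul k g ∘ₗ totalDeriv k g = scalePow k g fun n => (n : k) := by
  refine linearMap_ext_pow fun x n => ?_
  rw [LinearMap.comp_apply, scalePow_pow]
  cases n with
  | zero => rw [pow_zero, totalDeriv_one, map_zero, Nat.cast_zero, zero_smul]
  | succ n =>
    have hne : ((n + 1 : ℕ) : k) ≠ 0 := by exact_mod_cast n.succ_ne_zero
    rw [totalDeriv_pow_succ, map_smul, symMul_pow, powDeriv_self, smul_smul, mul_inv_cancel₀ hne,
      one_smul, Nat.cast_smul_eq_nsmul]

/-- The derivative in the first factor, `U(g) ⊗ g → U(g) ⊗ (g ⊗ g)`. -/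
def derivLeft : U ⊗[k] g →ₗ[k] U ⊗[k] (g ⊗[k] g) :=
  (TensorProduct.assoc k U g g).toLinearMap ∘ₗ (totalDeriv k g).rTensor g

/-- The map `u ⊗ (v ⊗ w) ↦ (u v) ⊗ w` for the symmetrized product. -/
def symMulLeft : U ⊗[k] (g ⊗[k] g) →ₗ[k] U ⊗[k] g :=
  (symMul k g).rTensor g ∘ₗ (TensorProduct.assoc k U g g).symm.toLinearMap

theorem symMulLeft_derivLeft (G : U ⊗[k] g) : symMulLeft k g (derivLeft k g G) =
    (scalePow k g fun n => (n : k)).rTensor g G := by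
  rw [← symMul_comp_totalDeriv, LinearMap.rTensor_comp]
  simp [symMulLeft, derivLeft]

/-- The product rule for a ⊗ v ↦ a v: differentiating v returns G, and differentiating a gives the
other term. There the old factor v is multiplied in while the new one survives, which is why the two
factors in g are swapped. -/
theorem totalDeriv_symMul (G : U ⊗[k] g) : totalDeriv k g (symMul k g G) =
    G + symMulLeft k g ((TensorProduct.comm k g g).toLinearMap.lTensor U (derivLeft k g G)) := by
  have h : totalDeriv k g ∘ₗ symMul k g = LinearMap.id +
      symMulLeft k g ∘ₗ (TensorProduct.comm k g g).toLinearMap.lTensor U ∘ₗ derivLeft k g := by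
    refine tensor_linearMap_ext_pow fun x n v => ?_
    have hne (n : ℕ) : ((n + 1 : ℕ) : k) ≠ 0 := by exact_mod_cast n.succ_ne_zero
    simp only [LinearMap.comp_apply, LinearMap.add_apply, LinearMap.id_apply]
    rw [symMul_pow, map_smul, totalDeriv_powDeriv_succ, smul_smul,
      inv_mul_cancel₀ (hne n), one_smul]
    congr 1
    cases n with
    | zero =>
      simp only [derivLeft, LinearMap.comp_apply, LinearMap.rTensor_tmul, pow_zero, totalDeriv_one,
        TensorProduct.zero_tmul, map_zero, powDeriv]
    | succ n =>
      simp only [derivLeft, symMulLeft, LinearMap.comp_apply, LinearMap.rTensor_tmul,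
        totalDeriv_pow_succ, LinearEquiv.coe_coe, ← TensorProduct.smul_tmul', map_smul,
        TensorProduct.assoc_tmul, LinearMap.lTensor_tmul, TensorProduct.comm_tmul,
        TensorProduct.assoc_symm_tmul, symMul_pow]
      rw [smul_smul, mul_inv_cancel₀ (hne n), one_smul]
  exact LinearMap.congr_fun h G

/-- The commutator with z sends xⁿ to the derivative of xⁿ in the direction [z, x]. It therefore
preserves the degree, and on degree one it is ad z. -/
theorem primitivePart_lie (z : g) (a : U) :
    primitivePart k g (ι k z * a - a * ι k z) = ⁅z, primitivePart k g a⁆ := by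
  have h : primitivePart k g ∘ₗ (LinearMap.mulLeft k (ι k z) - LinearMap.mulRight k (ι k z)) =
      LieAlgebra.ad k g z ∘ₗ primitivePart k g := by
    refine linearMap_ext_pow fun x n => ?_
    simp only [LinearMap.comp_apply, LinearMap.sub_apply, LinearMap.mulLeft_apply,
      LinearMap.mulRight_apply, LieAlgebra.ad_apply, primitivePart_pow]
    rw [← powDeriv_commutator, ← ι_lie]
    have hj := (hasJet_ι_pow k g x ⁅z, x⁆ n).map (primitivePart k g)
    simp only [primitivePart_pow] at hj
    split_ifs at hj ⊢ with hn
    · have h1 := ((HasJet.const (k := k) x).add (HasJet.const (k := k) ⁅z, x⁆).smul_var)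
      simpa using hj.unique h1
    · simpa using hj.unique (HasJet.const (k := k) (0 : g))
  exact LinearMap.congr_fun h a

/-- The counit sees degree zero, and the degree operator is invertible on the positive degrees.
Since 0⁻¹ = 0, the second summand contributes nothing in degree zero. With Euler's identity, an
element is determined by its counit and its derivative. -/
theorem decomposition_counit : LinearMap.id = (Algebra.linearMap k U) ∘ₗ (ε).toLinearMap +
    (scalePow k g fun n => (n : k)⁻¹) ∘ₗ (scalePow k g fun n => (n : k)) := by
  refine linearMap_ext_pow fun x n => ?_
  simp only [LinearMap.id_apply, LinearMap.add_apply, LinearMap.comp_apply, AlgHom.toLinearMap_apply,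
    counit_pow, scalePow_pow, map_smul, smul_smul, Algebra.linearMap_apply]
  cases n with
  | zero => simp
  | succ n =>
    have hne : ((n + 1 : ℕ) : k) ≠ 0 := by exact_mod_cast n.succ_ne_zero
    rw [if_neg n.succ_ne_zero, map_zero, zero_add, mul_inv_cancel₀ hne, one_smul]

end Operators

end UniversalEnvelopingAlgebra

/-! ### Second cohomology of the coalgebra U(g) -/

namespace UniversalEnvelopingAlgebra

section Cohomology

variable (k : Type*) [Field k] (g : Type*) [LieRing g] [LieAlgebra k g]

attribute [local instance 100] LieRing.ofAssociativeRing

local notation "U" => UniversalEnvelopingAlgebra k g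
local notation "Δ" => Bialgebra.comulAlgHom k (UniversalEnvelopingAlgebra k g)
local notation "ε" => Bialgebra.counitAlgHom k (UniversalEnvelopingAlgebra k g)

/-- The normalized 2-cocycles of the coalgebra `U(g)`. -/
structure IsTwoCocycle (f : U ⊗[k] U) : Prop where
  cocycle : TensorProduct.assoc k U U U (f ⊗ₜ 1) +
    TensorProduct.assoc k U U U ((Δ).toLinearMap.rTensor U f) =
      1 ⊗ₜ f + (Δ).toLinearMap.lTensor U f
  counit_left : (ε).toLinearMap.rTensor U f = 0
  counit_right : (ε).toLinearMap.lTensor U f = 0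

/-- The coboundary of an element of `U(g)`. -/
def coboundary (b : U) : U ⊗[k] U := Δ b - b ⊗ₜ 1 - 1 ⊗ₜ b

variable {k g}

theorem IsTwoCocycle.sub {f f' : U ⊗[k] U} (hf : IsTwoCocycle k g f) (hf' : IsTwoCocycle k g f') :
    IsTwoCocycle k g (f - f') where
  cocycle := by
    have h := congrArg₂ (· - ·) hf.cocycle hf'.cocycle
    beta_reduce at h
    rw [TensorProduct.sub_tmul, map_sub, map_sub, map_sub, map_sub, TensorProduct.tmul_sub,
      sub_add_sub_comm, sub_add_sub_comm, h]
  counit_left := by rw [map_sub, hf.counit_left, hf'.counit_left, sub_zero]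
  counit_right := by rw [map_sub, hf.counit_right, hf'.counit_right, sub_zero]

theorem isTwoCocycle_tmul_ι (x y : g) : IsTwoCocycle k g (ι k x ⊗ₜ ι k y) where
  cocycle := by
    simp only [LinearMap.rTensor_tmul, LinearMap.lTensor_tmul, AlgHom.toLinearMap_apply, comul_ι,
      TensorProduct.add_tmul, TensorProduct.tmul_add, map_add, TensorProduct.assoc_tmul]
    abel
  counit_left := by
    rw [LinearMap.rTensor_tmul, AlgHom.toLinearMap_apply, counit_ι, TensorProduct.zero_tmul]
  counit_right := by
    rw [LinearMap.lTensor_tmul, AlgHom.toLinearMap_apply, counit_ι, TensorProduct.tmul_zero]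

theorem IsTwoCocycle.add {f f' : U ⊗[k] U} (hf : IsTwoCocycle k g f) (hf' : IsTwoCocycle k g f') :
    IsTwoCocycle k g (f + f') where
  cocycle := by
    have h := congrArg₂ (· + ·) hf.cocycle hf'.cocycle
    beta_reduce at h
    rw [TensorProduct.add_tmul, map_add, map_add, map_add, map_add, TensorProduct.tmul_add,
      add_add_add_comm, h, add_add_add_comm]
  counit_left := by rw [map_add, hf.counit_left, hf'.counit_left, add_zero]
  counit_right := by rw [map_add, hf.counit_right, hf'.counit_right, add_zero]

theorem isTwoCocycle_toEnvelopingSquare (X : g ⊗[k] g) :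
    IsTwoCocycle k g (FormalTwist.toEnvelopingSquare k g X) := by
  induction X using TensorProduct.induction_on with
  | zero =>
    rw [map_zero]
    exact ⟨by simp, by simp, by simp⟩
  | tmul x y => exact isTwoCocycle_tmul_ι x y
  | add X Y hX hY => rw [map_add]; exact hX.add hY

theorem isTwoCocycle_coboundary {b : U} (hb : ε b = 0) : IsTwoCocycle k g (coboundary k g b) where
  cocycle := by
    have hco : TensorProduct.assoc k U U U ((Δ).toLinearMap.rTensor U (Δ b)) =
        (Δ).toLinearMap.lTensor U (Δ b) := Coalgebra.coassoc_apply b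
    have h1 : TensorProduct.assoc k U U U ((Δ).toLinearMap.rTensor U (1 ⊗ₜ b)) =
        1 ⊗ₜ (1 ⊗ₜ b) := by
      rw [LinearMap.rTensor_tmul, AlgHom.toLinearMap_apply, map_one, Algebra.TensorProduct.one_def,
        TensorProduct.assoc_tmul]
    have h2 : (Δ).toLinearMap.lTensor U (b ⊗ₜ 1) = b ⊗ₜ[k] ((1 : U) ⊗ₜ[k] (1 : U)) := by
      rw [LinearMap.lTensor_tmul, AlgHom.toLinearMap_apply, map_one, Algebra.TensorProduct.one_def]
    simp only [coboundary, TensorProduct.sub_tmul, TensorProduct.tmul_sub, map_sub, hco, h1, h2,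
      TensorProduct.assoc_tmul]
    simp only [LinearMap.rTensor_tmul, LinearMap.lTensor_tmul, AlgHom.toLinearMap_apply]
    abel
  counit_left := by
    have h1 : (ε).toLinearMap.rTensor U (Δ b) = 1 ⊗ₜ b := Coalgebra.rTensor_counit_comul b
    simp only [coboundary, map_sub, h1, LinearMap.rTensor_tmul, AlgHom.toLinearMap_apply, hb,
      TensorProduct.zero_tmul, map_one (ε), sub_zero, sub_self]
  counit_right := by
    have h1 : (ε).toLinearMap.lTensor U (Δ b) = b ⊗ₜ 1 := Coalgebra.lTensor_counit_comul b
    simp only [coboundary, map_sub, h1, LinearMap.lTensor_tmul, AlgHom.toLinearMap_apply, hb,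
      TensorProduct.tmul_zero, map_one (ε), sub_self]

theorem comul_ι_mul_toEnvelopingSquare (z : g) (X : g ⊗[k] g) :
    Δ (ι k z) * FormalTwist.toEnvelopingSquare k g X -
      FormalTwist.toEnvelopingSquare k g X * Δ (ι k z) =
        FormalTwist.toEnvelopingSquare k g ⁅z, X⁆ := by
  induction X using TensorProduct.induction_on with
  | zero => simp
  | tmul x y =>
    rw [TensorProduct.LieModule.lie_tmul_right, map_add]
    change Δ (ι k z) * (ι k x ⊗ₜ ι k y) - (ι k x ⊗ₜ ι k y) * Δ (ι k z) =
      ι k ⁅z, x⁆ ⊗ₜ ι k y + ι k x ⊗ₜ ι k ⁅z, y⁆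
    simp only [comul_ι, ι_lie, add_mul, mul_add, Algebra.TensorProduct.tmul_mul_tmul, one_mul,
      mul_one, TensorProduct.sub_tmul, TensorProduct.tmul_sub]
    abel
  | add X Y hX hY =>
    rw [lie_add, map_add, map_add, ← hX, ← hY]
    noncomm_ring

theorem commute_of_commute_ι {a : U} (h : ∀ z : g, Commute (ι k z) a) (x : U) : Commute x a := by
  have hx : x ∈ Algebra.adjoin k (LinearMap.range (ι k : g →ₗ⁅k⁆ U).toLinearMap : Set U) :=
    adjoin_range_ι k g ▸ Algebra.mem_top
  induction hx using Algebra.adjoin_induction with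
  | mem x hx =>
    obtain ⟨z, rfl⟩ := hx
    exact h z
  | algebraMap r => exact Algebra.commutes r a
  | add x y _ _ hx hy => exact hx.add_left hy
  | mul x y _ _ hx hy => exact hx.mul_left hy

theorem commute_comul_of_commute_comul_ι {f : U ⊗[k] U} (h : ∀ z : g, Commute (Δ (ι k z)) f) (x : U) :
    Commute (Δ x) f := by
  have hx : x ∈ Algebra.adjoin k (LinearMap.range (ι k : g →ₗ⁅k⁆ U).toLinearMap : Set U) :=
    adjoin_range_ι k g ▸ Algebra.mem_top
  induction hx using Algebra.adjoin_induction with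
  | mem x hx =>
    obtain ⟨z, rfl⟩ := hx
    exact h z
  | algebraMap r =>
    rw [AlgHom.commutes]
    exact Algebra.commutes r f
  | add x y _ _ hx hy => rw [map_add]; exact hx.add_left hy
  | mul x y _ _ hx hy => rw [map_mul]; exact hx.mul_left hy

theorem commute_comul_toEnvelopingSquare {X : g ⊗[k] g} (hX : ∀ z : g, ⁅z, X⁆ = 0) (x : U) :
    Commute (Δ x) (FormalTwist.toEnvelopingSquare k g X) := by
  refine commute_comul_of_commute_comul_ι (fun z => ?_) x
  rw [commute_iff_eq, ← sub_eq_zero, comul_ι_mul_toEnvelopingSquare, hX, map_zero]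

theorem comm_lie (z : g) (X : g ⊗[k] g) :
    TensorProduct.comm k g g ⁅z, X⁆ = ⁅z, TensorProduct.comm k g g X⁆ := by
  induction X using TensorProduct.induction_on with
  | zero => simp
  | tmul x y =>
    rw [TensorProduct.comm_tmul, TensorProduct.LieModule.lie_tmul_right,
      TensorProduct.LieModule.lie_tmul_right, map_add, TensorProduct.comm_tmul,
      TensorProduct.comm_tmul, add_comm]
  | add X Y hX hY => rw [lie_add, map_add, hX, hY, map_add, lie_add]

variable [CharZero k]

/-- The projection p to g is applied to the third factor of the cocycle identity: f ⊗ 1 dies since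
p(1) = 0, and (1 ⊗ Δ)f becomes (1 ⊗ d)f. -/
theorem IsTwoCocycle.lTensor_primitivePart {f : U ⊗[k] U} (hf : IsTwoCocycle k g f) :
    TensorProduct.assoc k U U g ((Δ).toLinearMap.rTensor g ((primitivePart k g).lTensor U f)) =
      1 ⊗ₜ ((primitivePart k g).lTensor U f) + (totalDeriv k g).lTensor U f := by
  have h := congrArg (((primitivePart k g).lTensor U).lTensor U) hf.cocycle
  have h1 : ∀ d : U ⊗[k] U, ∀ b : U, ((primitivePart k g).lTensor U).lTensor U
      (TensorProduct.assoc k U U U (d ⊗ₜ b)) =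
        TensorProduct.assoc k U U g (d ⊗ₜ primitivePart k g b) := by
    intro d b
    induction d using TensorProduct.induction_on with
    | zero => simp
    | tmul x y => simp
    | add x y hx hy => simp only [TensorProduct.add_tmul, map_add, hx, hy]
  have h2 : ((primitivePart k g).lTensor U).lTensor U
      (TensorProduct.assoc k U U U ((Δ).toLinearMap.rTensor U f)) =
        TensorProduct.assoc k U U g
          ((Δ).toLinearMap.rTensor g ((primitivePart k g).lTensor U f)) := by
    clear h hf
    induction f using TensorProduct.induction_on with
    | zero => simp
    | tmul x y => rw [LinearMap.rTensor_tmul, h1, LinearMap.lTensor_tmul, LinearMap.rTensor_tmul]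
    | add x y hx hy => simp only [map_add, hx, hy]
  rw [map_add, map_add, h1, h2, primitivePart_one, TensorProduct.tmul_zero, map_zero, zero_add,
    LinearMap.lTensor_tmul, ← LinearMap.comp_apply (LinearMap.lTensor U _), ← LinearMap.lTensor_comp]
    at h
  exact h

/-- Only degree two contributes, where x² ↦ 2 x ⊗ x: a Hessian at the origin is symmetric. -/
theorem comm_rTensor_totalDeriv (a : U) :
    TensorProduct.comm k g g ((primitivePart k g).rTensor g (totalDeriv k g a)) =
      (primitivePart k g).rTensor g (totalDeriv k g a) := by
  have h : (TensorProduct.comm k g g).toLinearMap ∘ₗ (primitivePart k g).rTensor g ∘ₗ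
      totalDeriv k g = (primitivePart k g).rTensor g ∘ₗ totalDeriv k g := by
    refine linearMap_ext_pow fun x n => ?_
    simp only [LinearMap.comp_apply, LinearEquiv.coe_coe]
    cases n with
    | zero => simp only [pow_zero, totalDeriv_one, map_zero]
    | succ n =>
      rw [totalDeriv_pow_succ, map_smul, map_smul, LinearMap.rTensor_tmul, primitivePart_pow]
      split_ifs
      · rw [TensorProduct.comm_tmul]
      · simp
  exact LinearMap.congr_fun h a

/-- This is closedness of the 1-form G = (1 ⊗ p)f. Projecting the middle factor of
`IsTwoCocycle.lTensor_primitivePart` to g expresses the derivative of G as 1 ⊗ (p ⊗ p)f, symmetric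
by assumption, plus Hessians, symmetric always. -/
theorem IsTwoCocycle.comm_derivLeft {f : U ⊗[k] U} (hf : IsTwoCocycle k g f)
    (hs : TensorProduct.comm k g g (TensorProduct.map (primitivePart k g) (primitivePart k g) f) =
      TensorProduct.map (primitivePart k g) (primitivePart k g) f) :
    (TensorProduct.comm k g g).toLinearMap.lTensor U
      (derivLeft k g ((primitivePart k g).lTensor U f)) =
        derivLeft k g ((primitivePart k g).lTensor U f) := by
  have h := congrArg (((primitivePart k g).rTensor g).lTensor U) hf.lTensor_primitivePart
  have h1 : ∀ d : U ⊗[k] U, ∀ b : g, ((primitivePart k g).rTensor g).lTensor U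
      (TensorProduct.assoc k U U g (d ⊗ₜ b)) =
        TensorProduct.assoc k U g g ((primitivePart k g).lTensor U d ⊗ₜ b) := by
    intro d b
    induction d using TensorProduct.induction_on with
    | zero => simp
    | tmul x y => simp
    | add x y hx hy => simp only [TensorProduct.add_tmul, map_add, hx, hy]
  have h2 : ∀ G : U ⊗[k] g, ((primitivePart k g).rTensor g).lTensor U
      (TensorProduct.assoc k U U g ((Δ).toLinearMap.rTensor g G)) = derivLeft k g G := by
    intro G
    induction G using TensorProduct.induction_on with
    | zero => simp
    | tmul x y =>
      rw [LinearMap.rTensor_tmul, h1]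
      rfl
    | add x y hx hy => simp only [map_add, hx, hy]
  have h3 : (primitivePart k g).rTensor g ((primitivePart k g).lTensor U f) =
      TensorProduct.map (primitivePart k g) (primitivePart k g) f := by
    rw [← LinearMap.comp_apply, LinearMap.rTensor_comp_lTensor]
  have h4 : (TensorProduct.comm k g g).toLinearMap ∘ₗ (primitivePart k g).rTensor g ∘ₗ
      totalDeriv k g = (primitivePart k g).rTensor g ∘ₗ totalDeriv k g :=
    LinearMap.ext comm_rTensor_totalDeriv
  rw [h2, map_add, LinearMap.lTensor_tmul, h3, ← LinearMap.comp_apply (LinearMap.lTensor _ _),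
    ← LinearMap.lTensor_comp] at h
  rw [h, map_add, LinearMap.lTensor_tmul, LinearEquiv.coe_coe, hs,
    ← LinearMap.comp_apply (LinearMap.lTensor _ _), ← LinearMap.lTensor_comp, h4]

/-- The derivative lowers the degree by one, hence the shift from n to n + 1. -/
theorem totalDeriv_scalePow_inv (a : U) : totalDeriv k g (scalePow k g (fun n => (n : k)⁻¹) a) =
    (scalePow k g fun n => ((n + 1 : ℕ) : k)⁻¹).rTensor g (totalDeriv k g a) := by
  have h : totalDeriv k g ∘ₗ scalePow k g (fun n => (n : k)⁻¹) =
      (scalePow k g fun n => ((n + 1 : ℕ) : k)⁻¹).rTensor g ∘ₗ totalDeriv k g := by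
    refine linearMap_ext_pow fun x n => ?_
    simp only [LinearMap.comp_apply, scalePow_pow]
    cases n with
    | zero => simp only [pow_zero, map_smul, totalDeriv_one, map_zero, smul_zero]
    | succ n =>
      rw [map_smul, totalDeriv_pow_succ, map_smul, LinearMap.rTensor_tmul, scalePow_pow,
        ← TensorProduct.smul_tmul', smul_comm]
  exact LinearMap.congr_fun h a

theorem scalePow_inv_succ_comp : (scalePow k g fun n => ((n + 1 : ℕ) : k)⁻¹) ∘ₗ
    (LinearMap.id + scalePow k g fun n => (n : k)) = LinearMap.id := by
  refine linearMap_ext_pow fun x n => ?_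
  have hne : ((n + 1 : ℕ) : k) ≠ 0 := by exact_mod_cast n.succ_ne_zero
  simp only [LinearMap.comp_apply, LinearMap.add_apply, LinearMap.id_apply, scalePow_pow, map_add,
    map_smul]
  rw [smul_smul, ← add_smul, ← one_add_mul, mul_comm,
    show (1 + n : k) = ((n + 1 : ℕ) : k) by push_cast; ring, inv_mul_cancel₀ hne, one_smul]

theorem counit_scalePow_inv (a : U) : ε (scalePow k g (fun n => (n : k)⁻¹) a) = 0 := by
  have h : (ε).toLinearMap ∘ₗ scalePow k g (fun n => (n : k)⁻¹) = 0 := by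
    refine linearMap_ext_pow fun x n => ?_
    simp only [LinearMap.comp_apply, scalePow_pow, AlgHom.toLinearMap_apply, map_smul, counit_pow,
      LinearMap.zero_apply]
    split_ifs with hn
    · simp [hn]
    · simp
  exact LinearMap.congr_fun h a

theorem primitivePart_eq_counit_totalDeriv (a : U) :
    primitivePart k g a = TensorProduct.lid k g ((ε).toLinearMap.rTensor g (totalDeriv k g a)) := by
  have h : primitivePart k g = (TensorProduct.lid k g).toLinearMap ∘ₗ
      (ε).toLinearMap.rTensor g ∘ₗ totalDeriv k g := by
    refine linearMap_ext_pow fun x n => ?_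
    simp only [LinearMap.comp_apply, LinearEquiv.coe_coe]
    cases n with
    | zero => simp only [pow_zero, totalDeriv_one, map_zero, primitivePart_one]
    | succ n =>
      rw [totalDeriv_pow_succ, primitivePart_pow, map_smul, map_smul, LinearMap.rTensor_tmul,
        AlgHom.toLinearMap_apply, counit_pow, TensorProduct.lid_tmul]
      cases n with
      | zero => simp
      | succ n => simp
  exact LinearMap.congr_fun h a

/-- A normalized 2-cocycle of `U(g)` with symmetric primitive part is a coboundary. -/
theorem IsTwoCocycle.exists_eq_coboundary {f : U ⊗[k] U} (hf : IsTwoCocycle k g f)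
    (hs : TensorProduct.comm k g g (TensorProduct.map (primitivePart k g) (primitivePart k g) f) =
      TensorProduct.map (primitivePart k g) (primitivePart k g) f) :
    ∃ b : U, ε b = 0 ∧ primitivePart k g b = 0 ∧ f = coboundary k g b := by
  set G := (primitivePart k g).lTensor U f with hG
  -- The primitive of the Poincaré lemma: contract the 1-form with the Euler field and divide by the
  -- degree. Closedness turns the product rule into (1 + degree)G, and the division cancels this
  -- factor.
  let b : U := scalePow k g (fun n => (n : k)⁻¹) (symMul k g G)
  have hεb : ε b = 0 := counit_scalePow_inv _
  have hb : totalDeriv k g b = G := by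
    rw [totalDeriv_scalePow_inv, totalDeriv_symMul, hf.comm_derivLeft hs, symMulLeft_derivLeft]
    have h1 : G + (scalePow k g fun n => (n : k)).rTensor g G =
        (LinearMap.id + scalePow k g fun n => (n : k)).rTensor g G := by
      rw [LinearMap.rTensor_add, LinearMap.rTensor_id, LinearMap.add_apply, LinearMap.id_apply]
    rw [h1, ← LinearMap.comp_apply, ← LinearMap.rTensor_comp, scalePow_inv_succ_comp,
      LinearMap.rTensor_id, LinearMap.id_apply]
  have hpb : primitivePart k g b = 0 := by
    rw [primitivePart_eq_counit_totalDeriv, hb, hG, ← LinearMap.comp_apply (LinearMap.rTensor _ _),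
      LinearMap.rTensor_comp_lTensor, ← LinearMap.lTensor_comp_rTensor, LinearMap.comp_apply,
      hf.counit_left, map_zero, map_zero]
  refine ⟨b, hεb, hpb, ?_⟩
  have hf' := hf.sub (isTwoCocycle_coboundary hεb)
  rw [← sub_eq_zero]
  set f' := f - coboundary k g b
  -- The corrected cocycle has zero 1-form, so the projected cocycle identity leaves (1 ⊗ d)f' = 0.
  -- With the normalization in the second factor this forces f' = 0.
  have hG' : (primitivePart k g).lTensor U f' = 0 := by
    simp only [f', coboundary, map_sub, LinearMap.lTensor_tmul, primitivePart_one, hpb,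
      TensorProduct.tmul_zero, sub_zero]
    rw [← totalDeriv_apply, hb, ← hG, sub_self]
  have h2 := hf'.lTensor_primitivePart
  rw [hG', map_zero, map_zero, TensorProduct.tmul_zero, zero_add] at h2
  have h3 : (scalePow k g fun n => (n : k)).lTensor U f' = 0 := by
    rw [← symMul_comp_totalDeriv, LinearMap.lTensor_comp, LinearMap.comp_apply, ← h2, map_zero]
  have h4 : f' = (LinearMap.id : U →ₗ[k] U).lTensor U f' := by
    rw [LinearMap.lTensor_id, LinearMap.id_apply]
  rw [h4, decomposition_counit, LinearMap.lTensor_add, LinearMap.add_apply, LinearMap.lTensor_comp,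
    LinearMap.lTensor_comp, LinearMap.comp_apply, LinearMap.comp_apply, h3, hf'.counit_right,
    map_zero, map_zero, add_zero]

/-- Projecting the second factor of the coboundary to g gives the derivative of c, the other terms
vanishing because c and 1 have no primitive part. An element with zero derivative and zero counit is
zero. -/
theorem eq_zero_of_coboundary_eq_zero {c : U} (hc : coboundary k g c = 0) (hε : ε c = 0)
    (hp : primitivePart k g c = 0) : c = 0 := by
  have h1 : totalDeriv k g c = 0 := by
    have h := congrArg ((primitivePart k g).lTensor U) hc
    simpa only [coboundary, map_sub, LinearMap.lTensor_tmul, primitivePart_one, hp,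
      TensorProduct.tmul_zero, sub_zero, map_zero, ← totalDeriv_apply] using h
  have h2 : scalePow k g (fun n => (n : k)) c = 0 := by
    rw [← symMul_comp_totalDeriv, LinearMap.comp_apply, h1, map_zero]
  have h3 := LinearMap.congr_fun (decomposition_counit k g) c
  rwa [LinearMap.add_apply, LinearMap.comp_apply, LinearMap.comp_apply, h2,
    AlgHom.toLinearMap_apply, hε, map_zero, map_zero, add_zero] at h3

theorem map_primitivePart_lie (z : g) (f : U ⊗[k] U) :
    TensorProduct.map (primitivePart k g) (primitivePart k g) (Δ (ι k z) * f - f * Δ (ι k z)) =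
      ⁅z, TensorProduct.map (primitivePart k g) (primitivePart k g) f⁆ := by
  induction f using TensorProduct.induction_on with
  | zero => simp
  | tmul x y =>
    have h : Δ (ι k z) * (x ⊗ₜ[k] y) - (x ⊗ₜ[k] y) * Δ (ι k z) =
        (ι k z * x - x * ι k z) ⊗ₜ y + x ⊗ₜ (ι k z * y - y * ι k z) := by
      simp only [comul_ι, add_mul, mul_add, Algebra.TensorProduct.tmul_mul_tmul, one_mul, mul_one,
        TensorProduct.sub_tmul, TensorProduct.tmul_sub]
      abel
    rw [h, map_add, TensorProduct.map_tmul, TensorProduct.map_tmul, TensorProduct.map_tmul,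
      primitivePart_lie, primitivePart_lie, TensorProduct.LieModule.lie_tmul_right]
  | add x y hx hy =>
    rw [map_add, lie_add, ← hx, ← hy, ← map_add]
    congr 1
    noncomm_ring

theorem map_primitivePart_toEnvelopingSquare (X : g ⊗[k] g) :
    TensorProduct.map (primitivePart k g) (primitivePart k g)
      (FormalTwist.toEnvelopingSquare k g X) = X := by
  induction X using TensorProduct.induction_on with
  | zero => simp
  | tmul x y =>
    change TensorProduct.map (primitivePart k g) (primitivePart k g) (ι k x ⊗ₜ ι k y) = _
    rw [TensorProduct.map_tmul, primitivePart_ι, primitivePart_ι]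
  | add X Y hX hY => rw [map_add, map_add, hX, hY]

theorem toEnvelopingSquare_injective :
    Function.Injective (FormalTwist.toEnvelopingSquare k g) :=
  Function.LeftInverse.injective map_primitivePart_toEnvelopingSquare

/-- An invariant normalized 2-cocycle of `U(g)` is the sum of an invariant skew-symmetric tensor
and the coboundary of a central element. -/
theorem IsTwoCocycle.exists_invariantSkew_add_coboundary {f : U ⊗[k] U} (hf : IsTwoCocycle k g f)
    (hinv : ∀ x : U, Commute (Δ x) f) :
    ∃ X : FormalTwist.invariantSkew k g, ∃ b : U, ε b = 0 ∧ (∀ x : U, Commute x b) ∧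
      f = FormalTwist.toEnvelopingSquare k g X + coboundary k g b := by
  set Y := TensorProduct.map (primitivePart k g) (primitivePart k g) f with hY
  -- Subtracting the skew part of (p ⊗ p)f leaves a cocycle whose primitive part is symmetric, hence
  -- a coboundary.
  let X : g ⊗[k] g := (2 : k)⁻¹ • (Y - TensorProduct.comm k g g Y)
  have hYz (z : g) : ⁅z, Y⁆ = 0 := by
    rw [hY, ← map_primitivePart_lie, (hinv (ι k z)).eq, sub_self, map_zero]
  have hcomm2 (T : g ⊗[k] g) : TensorProduct.comm k g g (TensorProduct.comm k g g T) = T :=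
    (TensorProduct.comm k g g).symm_apply_apply T
  have hX : X ∈ FormalTwist.invariantSkew k g := by
    refine ⟨?_, fun z => ?_⟩
    · rw [map_smul, map_sub, hcomm2, ← smul_neg, neg_sub]
    · rw [lie_smul, lie_sub, ← comm_lie, hYz, map_zero, sub_zero, smul_zero]
  have hf' := hf.sub (isTwoCocycle_toEnvelopingSquare X)
  obtain ⟨b, hεb, hpb, hb⟩ := hf'.exists_eq_coboundary (by
    rw [map_sub, map_primitivePart_toEnvelopingSquare, ← hY, map_sub, map_smul, map_sub, hcomm2]
    module)
  refine ⟨⟨X, hX⟩, b, hεb, commute_of_commute_ι fun z => ?_, by rw [← hb]; abel⟩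
  have hz : Commute (Δ (ι k z)) (coboundary k g b) := by
    rw [← hb]
    exact (hinv _).sub_right (commute_comul_toEnvelopingSquare hX.2 _)
  -- The commutator of z and b has coboundary [Δ(z), δb] = 0, counit zero and primitive part [z,
  -- p(b)] = 0, so it vanishes.
  rw [commute_iff_eq, ← sub_eq_zero]
  refine eq_zero_of_coboundary_eq_zero ?_ ?_ ?_
  · have h := sub_eq_zero.2 hz.eq
    rw [← h]
    simp only [coboundary, map_sub, map_mul, mul_sub, sub_mul]
    simp only [comul_ι, add_mul, mul_add, Algebra.TensorProduct.tmul_mul_tmul, one_mul, mul_one,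
      TensorProduct.sub_tmul, TensorProduct.tmul_sub]
    abel
  · rw [map_sub, map_mul, map_mul, mul_comm, sub_self]
  · rw [primitivePart_lie, hpb, lie_zero]

end Cohomology

end UniversalEnvelopingAlgebra

/-! ### Symbols and the units of U(g) -/

namespace UniversalEnvelopingAlgebra

section Units

variable {k : Type*} [Field k] {g : Type*} [LieRing g] [LieAlgebra k g]

attribute [local instance 100] LieRing.ofAssociativeRing

local notation "U" => UniversalEnvelopingAlgebra k g
local notation "Δ" => Bialgebra.comulAlgHom k (UniversalEnvelopingAlgebra k g)
local notation "ε" => Bialgebra.counitAlgHom k (UniversalEnvelopingAlgebra k g)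
local notation "R" => LinearMap.range (LieHom.toLinearMap (ι k : g →ₗ⁅k⁆ UniversalEnvelopingAlgebra k g))

variable {B : Type*} (bs : Module.Basis B k g)

/-- An element of `g` as a linear polynomial in its coordinates. -/
def linearPolynomial : g →ₗ[k] MvPolynomial B k :=
  Finsupp.linearCombination k MvPolynomial.X ∘ₗ bs.repr.toLinearMap

theorem pderiv_linearPolynomial (i : B) (x : g) :
    MvPolynomial.pderiv i (linearPolynomial bs x) = MvPolynomial.C (bs.repr x i) := by
  classical
  rw [linearPolynomial, LinearMap.comp_apply, LinearEquiv.coe_coe, Finsupp.linearCombination_apply,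
    map_finsuppSum, Finsupp.sum, Finset.sum_eq_single i]
  · simp [MvPolynomial.C_eq_smul_one]
  · intro j _ hj
    simp [MvPolynomial.pderiv_X_of_ne hj]
  · intro h
    simp [Finsupp.notMem_support_iff.1 h]

variable [CharZero k]

/-- The symbol of order `n` of an element of `U(g)`, a homogeneous polynomial; it is multiplied by
`n!`, so that `x ^ n ↦ n! x ^ n`. -/
def symbol : ℕ → U →ₗ[k] MvPolynomial B k
  | 0 => Algebra.linearMap k (MvPolynomial B k) ∘ₗ (ε).toLinearMap
  | n + 1 => LinearMap.mul' k (MvPolynomial B k) ∘ₗ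
      TensorProduct.map (symbol n) (linearPolynomial bs) ∘ₗ totalDeriv k g

theorem symbol_pow (x : g) (m n : ℕ) : symbol bs n (ι k x ^ m) =
    if m = n then (n.factorial : k) • linearPolynomial bs x ^ n else 0 := by
  induction n generalizing m with
  | zero =>
    rw [symbol, LinearMap.comp_apply, AlgHom.toLinearMap_apply, counit_pow]
    split_ifs <;> simp
  | succ n ih =>
    rw [symbol, LinearMap.comp_apply, LinearMap.comp_apply]
    cases m with
    | zero => simp [totalDeriv_one]
    | succ m =>
      rw [totalDeriv_pow_succ, map_smul, map_smul, TensorProduct.map_tmul, ih,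
        LinearMap.mul'_apply]
      by_cases h : m = n
      · rw [if_pos h, if_pos (by rw [h]), h, smul_mul_assoc, smul_smul, ← pow_succ,
          Nat.factorial_succ, Nat.cast_mul]
      · rw [if_neg h, if_neg (by omega), zero_mul, smul_zero]

theorem symbol_of_mem_filt {m n : ℕ} (h : m < n) {a : U}
    (ha : a ∈ PrimitivelyGenerated.filt R m) : symbol bs n a = 0 := by
  have hle : (⨆ i ≤ m, PrimitivelyGenerated.powers R i) ≤ LinearMap.ker (symbol bs n) := by
    refine iSup₂_le fun i hi => Submodule.span_le.2 ?_
    rintro _ ⟨_, ⟨x, rfl⟩, rfl⟩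
    refine (symbol_pow bs x i n).trans (if_neg (by omega))
  exact hle ((primitivelyGenerated k g).filt_le_iSup_powers m ha)

/-- The derivative of a v splits according to Δ(v) = v ⊗ 1 + 1 ⊗ v. In the inductive step the first
part gives n + 1 copies of the product of symbols. In the second only the term xᵐ ⊗ 1 of Δ(xᵐ) can
have a nonzero symbol of that order, and it gives one more copy. -/
theorem symbol_pow_mul_ι (x v : g) {m n : ℕ} (h : m ≤ n) : symbol bs (n + 1) (ι k x ^ m * ι k v) =
    ((n + 1 : ℕ) : k) • (symbol bs n (ι k x ^ m) * linearPolynomial bs v) := by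
  induction n generalizing m with
  | zero =>
    obtain rfl : m = 0 := by omega
    rw [pow_zero, one_mul]
    have h1 := symbol_pow bs v 1 1
    have h0 := symbol_pow bs v 0 0
    simp only [pow_one, pow_zero, if_true, Nat.factorial, Nat.cast_one, one_smul, zero_add,
      mul_one] at h1 h0 ⊢
    rw [h1, h0, one_mul]
  | succ n ih =>
    have hD : totalDeriv k g (ι k x ^ m * ι k v) =
        (LinearMap.mulRight k (ι k v)).rTensor g (totalDeriv k g (ι k x ^ m)) +
          (primitivePart k g ∘ₗ LinearMap.mulRight k (ι k v)).lTensor U (Δ (ι k x ^ m)) := by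
      rw [totalDeriv_apply, totalDeriv_apply, map_mul, comul_ι, mul_add, map_add]
      have h1 (d : U ⊗[k] U) : (primitivePart k g).lTensor U (d * ι k v ⊗ₜ 1) =
          (LinearMap.mulRight k (ι k v)).rTensor g ((primitivePart k g).lTensor U d) := by
        induction d using TensorProduct.induction_on with
        | zero => simp
        | tmul x y => simp [-ι_apply]
        | add x y hx hy => simp only [add_mul, map_add, hx, hy]
      have h2 (d : U ⊗[k] U) : (primitivePart k g).lTensor U (d * 1 ⊗ₜ ι k v) =
          (primitivePart k g ∘ₗ LinearMap.mulRight k (ι k v)).lTensor U d := by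
        induction d using TensorProduct.induction_on with
        | zero => simp
        | tmul x y => simp [-ι_apply]
        | add x y hx hy => simp only [add_mul, map_add, hx, hy]
      rw [h1, h2]
    have h1 : LinearMap.mul' k (MvPolynomial B k) (TensorProduct.map (symbol bs (n + 1))
        (linearPolynomial bs) ((LinearMap.mulRight k (ι k v)).rTensor g
          (totalDeriv k g (ι k x ^ m)))) =
        ((n + 1 : ℕ) : k) • (symbol bs (n + 1) (ι k x ^ m) * linearPolynomial bs v) := by
      cases m with
      | zero =>
        rw [symbol_pow, if_neg (by omega), pow_zero, totalDeriv_one]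
        simp
      | succ m =>
        rw [totalDeriv_pow_succ, map_smul, map_smul, map_smul, LinearMap.rTensor_tmul,
          LinearMap.mulRight_apply, TensorProduct.map_tmul, ih (by omega), LinearMap.mul'_apply,
          symbol, LinearMap.comp_apply, LinearMap.comp_apply, totalDeriv_pow_succ, map_smul,
          map_smul, TensorProduct.map_tmul, LinearMap.mul'_apply, smul_mul_assoc, smul_mul_assoc,
          smul_comm]
        congr 2
        ring
    have h2 : LinearMap.mul' k (MvPolynomial B k) (TensorProduct.map (symbol bs (n + 1))
        (linearPolynomial bs) ((primitivePart k g ∘ₗ LinearMap.mulRight k (ι k v)).lTensor U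
          (Δ (ι k x ^ m)))) = symbol bs (n + 1) (ι k x ^ m) * linearPolynomial bs v := by
      rw [comul_pow, map_sum, map_sum, map_sum, Finset.sum_eq_single (m, 0)]
      · rw [Nat.choose_self, one_smul, LinearMap.lTensor_tmul, TensorProduct.map_tmul,
          LinearMap.mul'_apply, LinearMap.comp_apply, LinearMap.mulRight_apply, pow_zero, one_mul,
          primitivePart_ι]
      · rintro ⟨i, j⟩ hij hne
        have hij' := Finset.HasAntidiagonal.mem_antidiagonal.1 hij
        simp only at hij'
        have hj : j ≠ 0 := by
          rintro rfl
          exact hne (by rw [show i = m by omega])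
        rw [map_nsmul, map_nsmul, map_nsmul, LinearMap.lTensor_tmul, TensorProduct.map_tmul,
          LinearMap.mul'_apply, symbol_pow, if_neg (by omega), zero_mul, smul_zero]
      · exact fun h => (h (Finset.HasAntidiagonal.mem_antidiagonal.2 (add_zero m))).elim
    rw [symbol, LinearMap.comp_apply, LinearMap.comp_apply, hD, map_add, map_add, h1, h2,
      Nat.cast_succ (n + 1), add_smul, one_smul]

theorem symbol_mul_ι {n : ℕ} {a : U} (ha : a ∈ PrimitivelyGenerated.filt R n) (v : g) :
    symbol bs (n + 1) (a * ι k v) =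
      ((n + 1 : ℕ) : k) • (symbol bs n a * linearPolynomial bs v) := by
  have hle : (⨆ i ≤ n, PrimitivelyGenerated.powers R i) ≤ LinearMap.eqLocus
      (symbol bs (n + 1) ∘ₗ LinearMap.mulRight k (ι k v))
      (((n + 1 : ℕ) : k) • LinearMap.mulRight k (linearPolynomial bs v) ∘ₗ symbol bs n) := by
    refine iSup₂_le fun i hi => Submodule.span_le.2 ?_
    rintro _ ⟨_, ⟨x, rfl⟩, rfl⟩
    exact symbol_pow_mul_ι bs x v hi
  exact hle ((primitivelyGenerated k g).filt_le_iSup_powers n ha)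

theorem symbol_mul_pow {p : ℕ} {a : U} (ha : a ∈ PrimitivelyGenerated.filt R p) (y : g) (q : ℕ) :
    (p.factorial : k) • symbol bs (p + q) (a * ι k y ^ q) =
      ((p + q).factorial : k) • (symbol bs p a * linearPolynomial bs y ^ q) := by
  induction q with
  | zero => simp
  | succ q ih =>
    have hm : a * ι k y ^ q ∈ PrimitivelyGenerated.filt R (p + q) := by
      rw [PrimitivelyGenerated.filt_add]
      exact Submodule.mul_mem_mul ha (PrimitivelyGenerated.pow_mem_filt (ι_mem_range y) q)
    rw [pow_succ, ← mul_assoc, ← add_assoc, symbol_mul_ι bs hm, smul_comm, ← smul_mul_assoc, ih,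
      smul_mul_assoc, smul_smul, Nat.factorial_succ, Nat.cast_mul, pow_succ, mul_assoc]

/-- After division of each symbol by the factorial of its order this says that leading terms
multiply. -/
theorem symbol_mul {p q : ℕ} {a b : U} (ha : a ∈ PrimitivelyGenerated.filt R p)
    (hb : b ∈ PrimitivelyGenerated.filt R q) :
    ((p.factorial : k) * q.factorial) • symbol bs (p + q) (a * b) =
      ((p + q).factorial : k) • (symbol bs p a * symbol bs q b) := by
  have hle : (⨆ i ≤ q, PrimitivelyGenerated.powers R i) ≤ LinearMap.eqLocus
      (((p.factorial : k) * q.factorial) • symbol bs (p + q) ∘ₗ LinearMap.mulLeft k a)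
      (((p + q).factorial : k) • LinearMap.mulLeft k (symbol bs p a) ∘ₗ symbol bs q) := by
    refine iSup₂_le fun i hi => Submodule.span_le.2 ?_
    rintro _ ⟨_, ⟨y, rfl⟩, rfl⟩
    change ((p.factorial : k) * q.factorial) • symbol bs (p + q) (a * ι k y ^ i) =
      ((p + q).factorial : k) • (symbol bs p a * symbol bs q (ι k y ^ i))
    rw [symbol_pow]
    split_ifs with h
    · rw [h, mul_comm (p.factorial : k), mul_smul, symbol_mul_pow bs ha, mul_smul_comm, smul_comm]
    · rw [symbol_of_mem_filt bs (m := p + i) (by omega), mul_zero, smul_zero, smul_zero]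
      rw [PrimitivelyGenerated.filt_add]
      exact Submodule.mul_mem_mul ha (PrimitivelyGenerated.pow_mem_filt (ι_mem_range y) i)
  exact hle ((primitivelyGenerated k g).filt_le_iSup_powers q hb)

/-- The derivative in the direction of a coordinate. -/
def partialDeriv [DecidableEq B] (i : B) : U →ₗ[k] U :=
  Finsupp.lapply i ∘ₗ (TensorProduct.equivFinsuppOfBasisRight bs).toLinearMap ∘ₗ totalDeriv k g

theorem partialDeriv_one [DecidableEq B] (i : B) : partialDeriv bs i (1 : U) = 0 := by
  rw [partialDeriv, LinearMap.comp_apply, LinearMap.comp_apply, totalDeriv_one, map_zero, map_zero]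

theorem partialDeriv_pow_succ [DecidableEq B] (i : B) (x : g) (n : ℕ) :
    partialDeriv bs i (ι k x ^ (n + 1)) =
      (((n + 1 : ℕ) : k) * bs.repr x i) • (ι k x : U) ^ n := by
  rw [partialDeriv, LinearMap.comp_apply, LinearMap.comp_apply, totalDeriv_pow_succ, map_smul,
    map_smul, Finsupp.lapply_apply, LinearEquiv.coe_coe,
    TensorProduct.equivFinsuppOfBasisRight_apply_tmul_apply, smul_smul]

theorem pderiv_symbol [DecidableEq B] (i : B) (n : ℕ) (a : U) :
    MvPolynomial.pderiv i (symbol bs (n + 1) a) =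
      ((n + 1 : ℕ) : k) • symbol bs n (partialDeriv bs i a) := by
  have h : (MvPolynomial.pderiv i).toLinearMap ∘ₗ symbol bs (n + 1) =
      ((n + 1 : ℕ) : k) • symbol bs n ∘ₗ partialDeriv bs i := by
    refine linearMap_ext_pow fun x m => ?_
    change MvPolynomial.pderiv i (symbol bs (n + 1) (ι k x ^ m)) =
      ((n + 1 : ℕ) : k) • symbol bs n (partialDeriv bs i (ι k x ^ m))
    rw [symbol_pow]
    cases m with
    | zero => rw [if_neg (by omega), map_zero, pow_zero, partialDeriv_one, map_zero, smul_zero]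
    | succ m =>
      rw [partialDeriv_pow_succ, map_smul, symbol_pow]
      by_cases hm : m = n
      · rw [if_pos (by rw [hm]), if_pos hm, hm, Derivation.map_smul, Derivation.leibniz_pow,
          pderiv_linearPolynomial, Nat.factorial_succ]
        simp only [Nat.add_sub_cancel, smul_smul, smul_eq_mul, MvPolynomial.C_eq_smul_one,
          mul_smul_comm, mul_one, ← Nat.cast_smul_eq_nsmul k]
        congr 1
        push_cast
        ring
      · rw [if_neg (by omega), if_neg hm, map_zero, smul_zero, smul_zero]
  exact LinearMap.congr_fun h a

theorem proj_partialDeriv [DecidableEq B] (i : B) (n : ℕ) (a : U) :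
    (primitivelyGenerated k g).proj n (partialDeriv bs i a) =
      partialDeriv bs i ((primitivelyGenerated k g).proj (n + 1) a) := by
  have h : (primitivelyGenerated k g).proj n ∘ₗ partialDeriv bs i =
      partialDeriv bs i ∘ₗ (primitivelyGenerated k g).proj (n + 1) := by
    refine linearMap_ext_pow fun x m => ?_
    rw [LinearMap.comp_apply, LinearMap.comp_apply,
      (primitivelyGenerated k g).proj_pow (ι_mem_range x)]
    cases m with
    | zero => rw [pow_zero, partialDeriv_one, map_zero, if_neg (by omega), map_zero]
    | succ m =>
      rw [partialDeriv_pow_succ, map_smul, (primitivelyGenerated k g).proj_pow (ι_mem_range x)]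
      by_cases hm : m = n
      · rw [if_pos hm, if_pos (by rw [hm]), partialDeriv_pow_succ]
      · rw [if_neg hm, if_neg (by omega), smul_zero, map_zero]
  exact LinearMap.congr_fun h a

/-- The symbol of order n is faithful on degree n. A zero polynomial has zero partial derivatives,
so by induction all partial derivatives of the component vanish, and Euler's identity recovers the
component from them. -/
theorem proj_eq_zero_of_symbol_eq_zero {n : ℕ} {a : U} (h : symbol bs n a = 0) :
    (primitivelyGenerated k g).proj n a = 0 := by
  classical
  induction n generalizing a with
  | zero =>
    have h0 : (primitivelyGenerated k g).proj 0 = Algebra.linearMap k U ∘ₗ (ε).toLinearMap := by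
      refine linearMap_ext_pow fun x m => ?_
      rw [(primitivelyGenerated k g).proj_pow (ι_mem_range x), LinearMap.comp_apply,
        AlgHom.toLinearMap_apply, counit_pow]
      split_ifs with hm
      · rw [hm, pow_zero, Algebra.linearMap_apply, map_one]
      · rw [map_zero]
    have h1 : ε a = 0 := (algebraMap k (MvPolynomial B k)).injective (by rw [map_zero]; exact h)
    rw [h0, LinearMap.comp_apply, AlgHom.toLinearMap_apply, h1, map_zero]
  | succ n ih =>
    have hne : ((n + 1 : ℕ) : k) ≠ 0 := by exact_mod_cast n.succ_ne_zero
    have h1 (i : B) : partialDeriv bs i ((primitivelyGenerated k g).proj (n + 1) a) = 0 := by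
      rw [← proj_partialDeriv]
      refine ih ?_
      have h2 := pderiv_symbol bs i n a
      rw [h, map_zero, eq_comm, smul_eq_zero] at h2
      exact h2.resolve_left hne
    have h2 : totalDeriv k g ((primitivelyGenerated k g).proj (n + 1) a) = 0 := by
      refine (TensorProduct.equivFinsuppOfBasisRight bs).injective (Finsupp.ext fun i => ?_)
      rw [map_zero]
      exact h1 i
    have h3 : scalePow k g (fun n => (n : k)) ∘ₗ (primitivelyGenerated k g).proj (n + 1) =
        ((n + 1 : ℕ) : k) • (primitivelyGenerated k g).proj (n + 1) := by
      refine linearMap_ext_pow fun x m => ?_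
      rw [LinearMap.comp_apply, LinearMap.smul_apply,
        (primitivelyGenerated k g).proj_pow (ι_mem_range x)]
      split_ifs with hm
      · rw [scalePow_pow, hm]
      · rw [map_zero, smul_zero]
    have h4 := LinearMap.congr_fun h3 a
    rw [← symMul_comp_totalDeriv, LinearMap.comp_apply, LinearMap.comp_apply, h2, map_zero,
      LinearMap.smul_apply, eq_comm, smul_eq_zero] at h4
    exact h4.resolve_left hne

theorem sub_proj_mem_filt {n : ℕ} {a : U} (ha : a ∈ PrimitivelyGenerated.filt R (n + 1)) :
    a - (primitivelyGenerated k g).proj (n + 1) a ∈ PrimitivelyGenerated.filt R n := by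
  have hle : (⨆ i ≤ n + 1, PrimitivelyGenerated.powers R i) ≤ (PrimitivelyGenerated.filt R n).comap
      (LinearMap.id - (primitivelyGenerated k g).proj (n + 1)) := by
    refine iSup₂_le fun i hi => Submodule.span_le.2 ?_
    rintro _ ⟨_, ⟨x, rfl⟩, rfl⟩
    change (ι k x : U) ^ i - (primitivelyGenerated k g).proj (n + 1) (ι k x ^ i) ∈
      PrimitivelyGenerated.filt R n
    rw [(primitivelyGenerated k g).proj_pow (ι_mem_range x)]
    split_ifs with h
    · rw [sub_self]
      exact zero_mem _
    · rw [sub_zero]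
      exact PrimitivelyGenerated.filt_mono _ (by omega)
        (PrimitivelyGenerated.pow_mem_filt (ι_mem_range x) i)
  exact hle ((primitivelyGenerated k g).filt_le_iSup_powers (n + 1) ha)

/-- The least filtration degree works: if the symbol there vanished, so would the top component, and
the element would lie one step lower. -/
theorem exists_symbol_ne_zero {a : U} (ha : a ≠ 0) :
    ∃ n, a ∈ PrimitivelyGenerated.filt R n ∧ symbol bs n a ≠ 0 := by
  classical
  have hex := PrimitivelyGenerated.exists_mem_filt (adjoin_range_ι k g) a
  refine ⟨Nat.find hex, Nat.find_spec hex, fun h => ?_⟩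
  have hp := proj_eq_zero_of_symbol_eq_zero bs h
  rcases hn : Nat.find hex with _ | n
  · have h0 := Nat.find_spec hex
    rw [hn] at h0 h
    rw [PrimitivelyGenerated.filt_zero] at h0
    obtain ⟨r, rfl⟩ := Submodule.mem_one.1 h0
    have h1 : ε (algebraMap k U r) = 0 :=
      (algebraMap k (MvPolynomial B k)).injective (by rw [map_zero]; exact h)
    rw [AlgHom.commutes] at h1
    refine ha ?_
    rw [show r = 0 from h1, map_zero]
  · have h0 := Nat.find_spec hex
    rw [hn] at h0 hp
    have h1 := sub_proj_mem_filt h0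
    rw [hp, sub_zero] at h1
    exact Nat.find_min hex (m := n) (by omega) h1

/-- The units of `U(g)` are scalars. -/
theorem exists_algebraMap_eq_of_isUnit {a : U} (ha : IsUnit a) : ∃ r : k, algebraMap k U r = a := by
  let bs := Module.Basis.ofVectorSpace k g
  obtain ⟨b, hab⟩ := ha.exists_right_inv
  have h1 : (1 : U) ≠ 0 := fun h => one_ne_zero (α := k) (by
    rw [← map_one ε, h, map_zero])
  obtain ⟨p, hp, hp'⟩ := exists_symbol_ne_zero bs (left_ne_zero_of_mul (hab ▸ h1 : a * b ≠ 0))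
  obtain ⟨q, hq, hq'⟩ := exists_symbol_ne_zero bs (right_ne_zero_of_mul (hab ▸ h1 : a * b ≠ 0))
  -- Polynomials form a domain, so the product a b = 1 has a nonzero symbol of order p + q; but 1 =
  -- 0⁰ has none in positive order.
  have h2 := symbol_mul bs hp hq
  have h3 : p + q = 0 := by
    by_contra hpq
    have h4 := symbol_pow bs (0 : g) 0 (p + q)
    rw [pow_zero, if_neg (Ne.symm hpq)] at h4
    rw [hab, h4, smul_zero, eq_comm, smul_eq_zero] at h2
    exact h2.elim (by exact_mod_cast (p + q).factorial_ne_zero) (mul_ne_zero hp' hq')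
  obtain rfl : p = 0 := by omega
  rw [PrimitivelyGenerated.filt_zero] at hp
  exact Submodule.mem_one.1 hp

end Units

/-! ### U(g) ⊗ U(g) inside U(g × g) -/

section TensorSquare

variable (k : Type*) [Field k] (g : Type*) [LieRing g] [LieAlgebra k g]

attribute [local instance 100] LieRing.ofAssociativeRing

local notation "U" => UniversalEnvelopingAlgebra k g

/-- The map `U(g × g) → U(g) ⊗ U(g)`. -/
def prodToTensor : UniversalEnvelopingAlgebra k (g × g) →ₐ[k] U ⊗[k] U :=
  lift k
    { ((TensorProduct.mk k U U).flip 1 ∘ₗ (ι k : g →ₗ⁅k⁆ U).toLinearMap ∘ₗ LinearMap.fst k g g) +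
      (TensorProduct.mk k U U 1 ∘ₗ (ι k : g →ₗ⁅k⁆ U).toLinearMap ∘ₗ LinearMap.snd k g g) with
      map_lie' := by
        rintro ⟨x, x'⟩ ⟨y, y'⟩
        change ι k ⁅x, y⁆ ⊗ₜ[k] 1 + 1 ⊗ₜ[k] ι k ⁅x', y'⁆ =
          ⁅(ι k x ⊗ₜ[k] 1 + 1 ⊗ₜ[k] ι k x' : U ⊗[k] U), ι k y ⊗ₜ[k] 1 + 1 ⊗ₜ[k] ι k y'⁆
        rw [ι_lie, ι_lie, LieRing.of_associative_ring_bracket]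
        simp only [mul_add, add_mul, Algebra.TensorProduct.tmul_mul_tmul, mul_one, one_mul,
          TensorProduct.sub_tmul, TensorProduct.tmul_sub]
        abel }

theorem prodToTensor_ι (x y : g) :
    prodToTensor k g (ι k (x, y)) = ι k x ⊗ₜ 1 + 1 ⊗ₜ ι k y :=
  lift_ι_apply k _ (x, y)

/-- The map `U(g) → U(g × g)` induced by a Lie algebra map `g → g × g`. -/
def mapToProd (φ : g →ₗ⁅k⁆ g × g) : U →ₐ[k] UniversalEnvelopingAlgebra k (g × g) :=
  lift k ((ι k).comp φ)

theorem mapToProd_ι (φ : g →ₗ⁅k⁆ g × g) (x : g) : mapToProd k g φ (ι k x) = ι k (φ x) :=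
  lift_ι_apply k _ x

theorem commute_mapToProd (a b : U) :
    Commute (mapToProd k g (LieHom.inl k g g) a) (mapToProd k g (LieHom.inr k g g) b) := by
  have hι (x y : g) : Commute (ι k (x, (0 : g)) : UniversalEnvelopingAlgebra k (g × g))
      (ι k ((0 : g), y)) := by
    rw [commute_iff_eq, ← sub_eq_zero, ← ι_lie, LieAlgebra.Prod.bracket_apply, lie_zero, zero_lie,
      Prod.mk_zero_zero, map_zero (ι k)]
  have ha : a ∈ Algebra.adjoin k (LinearMap.range (ι k : g →ₗ⁅k⁆ U).toLinearMap : Set U) :=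
    adjoin_range_ι k g ▸ Algebra.mem_top
  have hb : b ∈ Algebra.adjoin k (LinearMap.range (ι k : g →ₗ⁅k⁆ U).toLinearMap : Set U) :=
    adjoin_range_ι k g ▸ Algebra.mem_top
  induction ha using Algebra.adjoin_induction with
  | algebraMap r => rw [AlgHom.commutes]; exact Algebra.commutes r _
  | add x y _ _ hx hy => rw [map_add]; exact hx.add_left hy
  | mul x y _ _ hx hy => rw [map_mul]; exact hx.mul_left hy
  | mem a ha =>
    obtain ⟨x, rfl⟩ := ha
    induction hb using Algebra.adjoin_induction with
    | algebraMap r => rw [AlgHom.commutes]; exact Algebra.commute_algebraMap_right r _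
    | add x y _ _ hx hy => rw [map_add]; exact hx.add_right hy
    | mul x y _ _ hx hy => rw [map_mul]; exact hx.mul_right hy
    | mem b hb =>
      obtain ⟨y, rfl⟩ := hb
      change Commute (mapToProd k g _ (ι k x)) (mapToProd k g _ (ι k y))
      rw [mapToProd_ι, mapToProd_ι]
      exact hι x y

/-- The map `U(g) ⊗ U(g) → U(g × g)`. -/
def tensorToProd : U ⊗[k] U →ₐ[k] UniversalEnvelopingAlgebra k (g × g) :=
  Algebra.TensorProduct.lift (mapToProd k g (LieHom.inl k g g)) (mapToProd k g (LieHom.inr k g g))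
    (commute_mapToProd k g)

/-- One-sided inversion suffices: a unit of U(g) ⊗ U(g) becomes a scalar in U(g × g) and returns as
the same scalar. -/
theorem prodToTensor_tensorToProd (f : U ⊗[k] U) :
    prodToTensor k g (tensorToProd k g f) = f := by
  have h1 : (prodToTensor k g).comp (mapToProd k g (LieHom.inl k g g)) =
      Algebra.TensorProduct.includeLeft := by
    refine algHom_ext_ι k g fun x => ?_
    rw [AlgHom.comp_apply, mapToProd_ι, LieHom.inl_apply, prodToTensor_ι, map_zero (ι k),
      TensorProduct.tmul_zero, add_zero]
    rfl
  have h2 : (prodToTensor k g).comp (mapToProd k g (LieHom.inr k g g)) =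
      Algebra.TensorProduct.includeRight := by
    refine algHom_ext_ι k g fun x => ?_
    rw [AlgHom.comp_apply, mapToProd_ι, LieHom.inr_apply, prodToTensor_ι, map_zero (ι k),
      TensorProduct.zero_tmul, zero_add]
    rfl
  induction f using TensorProduct.induction_on with
  | zero => simp
  | tmul a b =>
    rw [tensorToProd, Algebra.TensorProduct.lift_tmul, map_mul, ← AlgHom.comp_apply,
      ← AlgHom.comp_apply (prodToTensor k g), h1, h2]
    simp
  | add a b ha hb => rw [map_add, map_add, ha, hb]

/-- The units of `U(g) ⊗ U(g)` are scalars. -/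
theorem exists_algebraMap_eq_of_isUnit_tensor [CharZero k] {f : U ⊗[k] U} (hf : IsUnit f) :
    ∃ r : k, algebraMap k (U ⊗[k] U) r = f := by
  obtain ⟨r, hr⟩ := exists_algebraMap_eq_of_isUnit (hf.map (tensorToProd k g))
  refine ⟨r, ?_⟩
  rw [← prodToTensor_tensorToProd k g f, ← hr, AlgHom.commutes]

end TensorSquare

end UniversalEnvelopingAlgebra

/-! ### Power series modulo hⁿ⁺¹ -/

namespace FormalTwist

section PowerSeries

variable {A B : Type*} [Ring A] [Ring B]

theorem isUnit_of_coeff_zero {P : PowerSeries A} (h : PowerSeries.coeff 0 P = 1) : IsUnit P :=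
  PowerSeries.isUnit_iff_constantCoeff.2 (by
    rw [← PowerSeries.coeff_zero_eq_constantCoeff_apply, h]
    exact isUnit_one)

theorem coeff_mul_congr {P P' Q Q' : PowerSeries A} {n : ℕ}
    (hP : ∀ m ≤ n, PowerSeries.coeff m P = PowerSeries.coeff m P')
    (hQ : ∀ m ≤ n, PowerSeries.coeff m Q = PowerSeries.coeff m Q') :
    ∀ m ≤ n, PowerSeries.coeff m (P * Q) = PowerSeries.coeff m (P' * Q') := by
  intro m hm
  rw [PowerSeries.coeff_mul, PowerSeries.coeff_mul]
  refine Finset.sum_congr rfl fun p hp => ?_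
  have hp' := Finset.HasAntidiagonal.mem_antidiagonal.1 hp
  rw [hP _ (by omega), hQ _ (by omega)]

theorem commute_of_commute_coeff {P Q : PowerSeries A}
    (h : ∀ i j, Commute (PowerSeries.coeff i P) (PowerSeries.coeff j Q)) : Commute P Q := by
  refine PowerSeries.ext fun n => ?_
  rw [PowerSeries.coeff_mul, PowerSeries.coeff_mul, ← Finset.Nat.sum_antidiagonal_swap]
  exact Finset.sum_congr rfl fun p _ => h _ _

theorem commute_C_iff {c : A} {P : PowerSeries A} :
    Commute (PowerSeries.C c) P ↔ ∀ n, Commute c (PowerSeries.coeff n P) := by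
  constructor
  · intro h n
    have := congrArg (PowerSeries.coeff n) h.eq
    rwa [PowerSeries.coeff_C_mul, PowerSeries.coeff_mul_C] at this
  · intro h
    refine PowerSeries.ext fun n => ?_
    rw [PowerSeries.coeff_C_mul, PowerSeries.coeff_mul_C]
    exact h n

theorem map_monomial (f : A →+* B) (n : ℕ) (a : A) :
    PowerSeries.map f (PowerSeries.monomial n a) = PowerSeries.monomial n (f a) := by
  refine PowerSeries.ext fun m => ?_
  rw [PowerSeries.coeff_map, PowerSeries.coeff_monomial, PowerSeries.coeff_monomial]
  split_ifs <;> simp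

/-- `P = 1 + p h ^ n` modulo `h ^ (n + 1)`. -/
def EqOneAdd (n : ℕ) (p : A) (P : PowerSeries A) : Prop :=
  ∀ m ≤ n, PowerSeries.coeff m P = PowerSeries.coeff m (1 + PowerSeries.monomial n p)

theorem EqOneAdd.coeff_self {n : ℕ} (hn : n ≠ 0) {p : A} {P : PowerSeries A} (h : EqOneAdd n p P) :
    PowerSeries.coeff n P = p := by
  rw [h n le_rfl, map_add, PowerSeries.coeff_one, if_neg hn, PowerSeries.coeff_monomial_same,
    zero_add]

theorem EqOneAdd.coeff_of_lt {n m : ℕ} (hm : m < n) {p : A} {P : PowerSeries A}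
    (h : EqOneAdd n p P) : PowerSeries.coeff m P = PowerSeries.coeff m 1 := by
  rw [h m hm.le, map_add, PowerSeries.coeff_monomial, if_neg hm.ne, add_zero]

theorem EqOneAdd.of_coeff_of_lt {n : ℕ} (hn : n ≠ 0) {P : PowerSeries A}
    (h : ∀ m < n, PowerSeries.coeff m P = PowerSeries.coeff m 1) :
    EqOneAdd n (PowerSeries.coeff n P) P := by
  intro m hm
  rw [map_add, PowerSeries.coeff_monomial]
  split_ifs with hmn
  · rw [hmn, PowerSeries.coeff_one, if_neg hn, zero_add]
  · rw [h m (by omega), add_zero]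

/-- The cross term has order 2n > n. This linearizes multiplicative identities at the first
nontrivial order. -/
theorem EqOneAdd.mul {n : ℕ} (hn : n ≠ 0) {p q : A} {P Q : PowerSeries A} (hP : EqOneAdd n p P)
    (hQ : EqOneAdd n q Q) : EqOneAdd n (p + q) (P * Q) := by
  intro m hm
  rw [coeff_mul_congr hP hQ m hm, mul_add, mul_one, add_mul, one_mul, map_add (PowerSeries.monomial n),
    PowerSeries.monomial_mul_monomial, ← add_assoc, map_add, PowerSeries.coeff_monomial,
    if_neg (by omega), add_zero, add_assoc]

theorem EqOneAdd.map {n : ℕ} {p : A} {P : PowerSeries A} (hP : EqOneAdd n p P) (f : A →+* B) :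
    EqOneAdd n (f p) (PowerSeries.map f P) := by
  intro m hm
  rw [PowerSeries.coeff_map, hP m hm, ← PowerSeries.coeff_map, map_add, map_one, map_monomial]

theorem eqOneAdd_self (n : ℕ) (p : A) : EqOneAdd n p (1 + PowerSeries.monomial n p) :=
  fun _ _ => rfl

theorem EqOneAdd.of_mul_right {n : ℕ} (hn : n ≠ 0) {p q : A} {P Q : PowerSeries A}
    (hP : EqOneAdd n p P) (hQ : EqOneAdd n q (Q * P)) : EqOneAdd n (q - p) Q := by
  intro m hm
  have h1 := hP.mul hn (eqOneAdd_self n (-p))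
  have h2 := hQ.mul hn (eqOneAdd_self n (-p))
  rw [add_neg_cancel] at h1
  rw [mul_assoc] at h2
  rw [sub_eq_add_neg, ← h2 m hm, coeff_mul_congr (fun _ _ => rfl) h1 m hm, map_zero, add_zero,
    mul_one]

theorem EqOneAdd.of_mul_left {n : ℕ} (hn : n ≠ 0) {p q : A} {P Q : PowerSeries A}
    (hP : EqOneAdd n p P) (hQ : EqOneAdd n q (P * Q)) : EqOneAdd n (q - p) Q := by
  intro m hm
  have h1 := (eqOneAdd_self n (-p)).mul hn hP
  have h2 := (eqOneAdd_self n (-p)).mul hn hQ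
  rw [neg_add_cancel] at h1
  rw [← mul_assoc] at h2
  rw [sub_eq_neg_add, ← h2 m hm, coeff_mul_congr h1 (fun _ _ => rfl) m hm, map_zero, add_zero,
    one_mul]

theorem coeff_mul_eq_zero {P Q : PowerSeries A} {a b : ℕ}
    (hP : ∀ i < a, PowerSeries.coeff i P = 0) (hQ : ∀ i < b, PowerSeries.coeff i Q = 0) :
    ∀ n < a + b, PowerSeries.coeff n (P * Q) = 0 := by
  intro n hn
  rw [PowerSeries.coeff_mul]
  refine Finset.sum_eq_zero fun p hp => ?_
  have hp' := Finset.HasAntidiagonal.mem_antidiagonal.1 hp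
  by_cases h : p.1 < a
  · rw [hP _ h, zero_mul]
  · rw [hQ _ (by omega), mul_zero]

theorem coeff_pow_eq_zero {P : PowerSeries A} (hP : PowerSeries.coeff 0 P = 0) (m : ℕ) :
    ∀ n < m, PowerSeries.coeff n (P ^ m) = 0 := by
  induction m with
  | zero => simp
  | succ m ih =>
    rw [pow_succ]
    refine coeff_mul_eq_zero ih fun i hi => ?_
    rwa [show i = 0 by omega]

end PowerSeries

/-! ### Exponentials of power series -/

section Exponential

variable (k : Type*) [Field k] {A B : Type*} [Ring A] [Algebra k A] [Ring B] [Algebra k B]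

theorem coeff_exp_eq_sum {Y : PowerSeries A} (hY : PowerSeries.coeff 0 Y = 0) {n N : ℕ}
    (h : n ≤ N) : PowerSeries.coeff n (exp k Y) =
      ∑ m ∈ Finset.range (N + 1), ((m.factorial : k)⁻¹) • PowerSeries.coeff n (Y ^ m) := by
  rw [exp, PowerSeries.coeff_mk]
  refine Finset.sum_subset (Finset.range_mono (by omega)) fun m _ hm => ?_
  rw [coeff_pow_eq_zero hY m n (by simpa using hm), smul_zero]

theorem exp_add [CharZero k] {Y Z : PowerSeries A} (hY : PowerSeries.coeff 0 Y = 0)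
    (hZ : PowerSeries.coeff 0 Z = 0) (hc : Commute Y Z) :
    exp k (Y + Z) = exp k Y * exp k Z := by
  refine PowerSeries.ext fun n => ?_
  have hL : PowerSeries.coeff n (exp k (Y + Z)) = ∑ m ∈ Finset.range (n + 1),
      ∑ p ∈ Finset.HasAntidiagonal.antidiagonal m, ((p.1.factorial : k)⁻¹ * (p.2.factorial : k)⁻¹) •
        PowerSeries.coeff n (Y ^ p.1 * Z ^ p.2) := by
    rw [exp, PowerSeries.coeff_mk]
    refine Finset.sum_congr rfl fun m _ => ?_
    rw [hc.add_pow', map_sum, Finset.smul_sum]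
    refine Finset.sum_congr rfl fun p hp => ?_
    rw [map_nsmul, ← Nat.cast_smul_eq_nsmul k, smul_smul]
    congr 1
    have hp' := Finset.HasAntidiagonal.mem_antidiagonal.1 hp
    have h0 (i : ℕ) : (i.factorial : k) ≠ 0 := by exact_mod_cast i.factorial_ne_zero
    have h1 := Nat.choose_mul_factorial_mul_factorial (show p.1 ≤ m by omega)
    rw [show m - p.1 = p.2 by omega] at h1
    rw [inv_mul_eq_iff_eq_mul₀ (h0 m), ← h1]
    push_cast
    field_simp [h0]
  have hR : PowerSeries.coeff n (exp k Y * exp k Z) = ∑ i ∈ Finset.range (n + 1),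
      ∑ j ∈ Finset.range (n + 1), ((i.factorial : k)⁻¹ * (j.factorial : k)⁻¹) •
        PowerSeries.coeff n (Y ^ i * Z ^ j) := by
    have h1 : ∀ p ∈ Finset.HasAntidiagonal.antidiagonal n,
        PowerSeries.coeff p.1 (exp k Y) * PowerSeries.coeff p.2 (exp k Z) =
        ∑ i ∈ Finset.range (n + 1), ∑ j ∈ Finset.range (n + 1),
          ((i.factorial : k)⁻¹ * (j.factorial : k)⁻¹) •
            (PowerSeries.coeff p.1 (Y ^ i) * PowerSeries.coeff p.2 (Z ^ j)) := by
      intro p hp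
      have hp' := Finset.HasAntidiagonal.mem_antidiagonal.1 hp
      rw [coeff_exp_eq_sum k hY (N := n) (by omega), coeff_exp_eq_sum k hZ (N := n) (by omega),
        Finset.sum_mul_sum]
      simp only [smul_mul_smul_comm]
    rw [PowerSeries.coeff_mul, Finset.sum_congr rfl h1, Finset.sum_comm]
    refine Finset.sum_congr rfl fun i _ => ?_
    rw [Finset.sum_comm]
    refine Finset.sum_congr rfl fun j _ => ?_
    rw [PowerSeries.coeff_mul, Finset.smul_sum]
  -- The two sides sum over the triangle i + j ≤ n and the square i, j ≤ n. The extra terms vanish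
  -- because Yⁱ Zʲ has order at least i + j.
  rw [hL, hR, ← Finset.sum_product']
  refine Eq.symm ((Finset.sum_filter_of_ne (p := fun p : ℕ × ℕ => p.1 + p.2 < n + 1) ?_).symm.trans
    ?_)
  · intro p _ hne
    by_contra hp
    refine hne ?_
    rw [coeff_mul_eq_zero (coeff_pow_eq_zero hY p.1) (coeff_pow_eq_zero hZ p.2) n (by omega),
      smul_zero]
  · rw [← Finset.sum_fiberwise_of_maps_to (g := fun p : ℕ × ℕ => p.1 + p.2)
      (t := Finset.range (n + 1)) fun p hp => by simpa using (Finset.mem_filter.1 hp).2]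
    refine Finset.sum_congr rfl fun m hm => Finset.sum_congr ?_ fun _ _ => rfl
    ext p
    simp only [Finset.HasAntidiagonal.mem_antidiagonal, Finset.mem_filter, Finset.mem_product,
      Finset.mem_range] at hm ⊢
    omega

theorem map_exp (f : A →ₐ[k] B) (Y : PowerSeries A) :
    PowerSeries.map (f : A →+* B) (exp k Y) = exp k (PowerSeries.map (f : A →+* B) Y) := by
  refine PowerSeries.ext fun n => ?_
  rw [PowerSeries.coeff_map, exp, exp, PowerSeries.coeff_mk, PowerSeries.coeff_mk, map_sum]
  refine Finset.sum_congr rfl fun m _ => ?_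
  rw [← map_pow, PowerSeries.coeff_map]
  exact map_smul f _ _

theorem map_exp_monomial (f : A →ₐ[k] B) (n : ℕ) (a : A) :
    PowerSeries.map (f : A →+* B) (exp k (PowerSeries.monomial n a)) =
      exp k (PowerSeries.monomial n (f a)) := by
  rw [map_exp, map_monomial]
  rfl

theorem exp_zero : exp k (0 : PowerSeries A) = 1 := by
  refine PowerSeries.ext fun n => ?_
  rw [exp, PowerSeries.coeff_mk, Finset.sum_eq_single 0]
  · simp
  · intro m _ hm
    rw [zero_pow hm, map_zero, smul_zero]
  · simp

theorem commute_coeff_exp {c : A} {Y : PowerSeries A}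
    (h : ∀ n, Commute c (PowerSeries.coeff n Y)) (n : ℕ) :
    Commute c (PowerSeries.coeff n (exp k Y)) := by
  rw [exp, PowerSeries.coeff_mk]
  refine Commute.sum_right _ _ _ fun m _ => Commute.smul_right ?_ _
  exact commute_C_iff.1 ((commute_C_iff.2 h).pow_right m) n

theorem eqOneAdd_exp_monomial {n : ℕ} (hn : n ≠ 0) (a : A) :
    EqOneAdd n a (exp k (PowerSeries.monomial n a)) := by
  have h : ∀ m < n, PowerSeries.coeff m (exp k (PowerSeries.monomial n a)) =
      PowerSeries.coeff m 1 := by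
    obtain ⟨N, rfl⟩ := Nat.exists_eq_succ_of_ne_zero hn
    intro m hm
    rw [coeff_exp_monomial_succ k a N m (by omega), PowerSeries.coeff_one]
  have hc : PowerSeries.coeff n (exp k (PowerSeries.monomial n a)) = a := by
    have h0 : ∀ i < n, PowerSeries.coeff i (PowerSeries.monomial n a) = 0 := fun i hi => by
      rw [PowerSeries.coeff_monomial, if_neg hi.ne]
    rw [exp, PowerSeries.coeff_mk, Finset.sum_eq_single 1]
    · simp
    · intro m _ hm
      rcases m with _ | _ | m
      · rw [pow_zero, PowerSeries.coeff_one, if_neg hn, smul_zero]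
      · exact absurd rfl hm
      · rw [pow_succ, coeff_mul_eq_zero (a := 1) (b := n) _ h0 n (by omega), smul_zero]
        intro i hi
        exact coeff_pow_eq_zero (h0 0 (by omega)) (m + 1) i (by omega)
    · simp; omega
  have := EqOneAdd.of_coeff_of_lt hn h
  rwa [hc] at this

theorem partialProd_congr {X Y : ℕ+ → A} {N : ℕ} (h : ∀ n < N, X n.succPNat = Y n.succPNat) :
    partialProd k X N = partialProd k Y N := by
  induction N with
  | zero => rfl
  | succ N ih => rw [partialProd, partialProd, ih fun n hn => h n (by omega), h N N.lt_succ_self]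

end Exponential
end FormalTwist

/-! ### The group of invariant twists -/

namespace FormalTwist

section Group

variable (k : Type*) [Field k] (H : Type*) [Ring H] [Bialgebra k H]

local notation "Δ" => Bialgebra.comulAlgHom k H

/-- `f ↦ f ⊗ 1`. -/
def firstTwo : H ⊗[k] H →ₐ[k] H ⊗[k] (H ⊗[k] H) :=
  (Algebra.TensorProduct.assoc k k k H H H).toAlgHom.comp Algebra.TensorProduct.includeLeft

/-- `f ↦ 1 ⊗ f`. -/
def lastTwo : H ⊗[k] H →ₐ[k] H ⊗[k] (H ⊗[k] H) := Algebra.TensorProduct.includeRight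

/-- `Δ ⊗ I`. -/
def comulFirst : H ⊗[k] H →ₐ[k] H ⊗[k] (H ⊗[k] H) :=
  (Algebra.TensorProduct.assoc k k k H H H).toAlgHom.comp
    (Algebra.TensorProduct.map (Δ) (AlgHom.id k H))

/-- `I ⊗ Δ`. -/
def comulLast : H ⊗[k] H →ₐ[k] H ⊗[k] (H ⊗[k] H) :=
  Algebra.TensorProduct.map (AlgHom.id k H) (Δ)

theorem tensorOne_eq : tensorOne k H = PowerSeries.map (firstTwo k H : _ →+* _) := rfl

theorem oneTensor_eq : oneTensor k H = PowerSeries.map (lastTwo k H : _ →+* _) := rfl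

theorem comulTensorId_eq : comulTensorId k H = PowerSeries.map (comulFirst k H : _ →+* _) := rfl

theorem idTensorComul_eq : idTensorComul k H = PowerSeries.map (comulLast k H : _ →+* _) := rfl

variable {k H}

/-- On a pure tensor a ⊗ b the claim is that f ⊗ 1 commutes with Δ(a) ⊗ b, which is the invariance
of f. With its mirror image this lets cocycle identities be multiplied and inverted. -/
theorem commute_firstTwo_comulFirst {f : H ⊗[k] H} (hf : ∀ x : H, Commute (Δ x) f)
    (d : H ⊗[k] H) : Commute (firstTwo k H f) (comulFirst k H d) := by
  induction d using TensorProduct.induction_on with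
  | zero => rw [map_zero]; exact Commute.zero_right _
  | add x y hx hy => rw [map_add]; exact hx.add_right hy
  | tmul a b =>
    have h : Commute (f ⊗ₜ[k] (1 : H)) (Δ a ⊗ₜ[k] b) := by
      rw [commute_iff_eq, Algebra.TensorProduct.tmul_mul_tmul, Algebra.TensorProduct.tmul_mul_tmul,
        (hf a).eq, one_mul, mul_one]
    exact h.map (Algebra.TensorProduct.assoc k k k H H H).toAlgHom

theorem commute_lastTwo_comulLast {f : H ⊗[k] H} (hf : ∀ x : H, Commute (Δ x) f)
    (d : H ⊗[k] H) : Commute (lastTwo k H f) (comulLast k H d) := by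
  induction d using TensorProduct.induction_on with
  | zero => rw [map_zero]; exact Commute.zero_right _
  | add x y hx hy => rw [map_add]; exact hx.add_right hy
  | tmul a b =>
    change (1 : H) ⊗ₜ[k] f * a ⊗ₜ[k] Δ b = a ⊗ₜ[k] Δ b * (1 : H) ⊗ₜ[k] f
    rw [Algebra.TensorProduct.tmul_mul_tmul, Algebra.TensorProduct.tmul_mul_tmul, (hf b).eq, one_mul,
      mul_one]

theorem forall_commute_comul_iff {F : PowerSeries (H ⊗[k] H)} :
    (∀ x : PowerSeries H, F * comul k H x = comul k H x * F) ↔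
      ∀ (x : H) n, Commute (Δ x) (PowerSeries.coeff n F) := by
  constructor
  · intro h x
    rw [← commute_C_iff]
    have := h (PowerSeries.C x)
    rw [comul, PowerSeries.map_C] at this
    exact this.symm
  · intro h x
    refine (commute_of_commute_coeff fun i j => ?_).eq
    rw [comul, PowerSeries.coeff_map]
    exact (h _ _).symm

theorem forall_commute_iff {a : PowerSeries H} :
    (∀ x : PowerSeries H, a * x = x * a) ↔ ∀ (x : H) n, Commute x (PowerSeries.coeff n a) := by
  constructor
  · intro h x
    rw [← commute_C_iff]
    exact (h (PowerSeries.C x)).symm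
  · intro h x
    exact (commute_of_commute_coeff fun i j => (h _ _).symm).eq

theorem IsInvariantTwist.commute_tensorOne {F : PowerSeries (H ⊗[k] H)} (hF : IsInvariantTwist k F)
    (G : PowerSeries (H ⊗[k] H)) : Commute (tensorOne k H F) (comulTensorId k H G) := by
  refine commute_of_commute_coeff fun i j => ?_
  rw [tensorOne_eq, comulTensorId_eq, PowerSeries.coeff_map, PowerSeries.coeff_map]
  exact commute_firstTwo_comulFirst (fun x => forall_commute_comul_iff.1 hF.invariant x i) _

theorem IsInvariantTwist.commute_oneTensor {F : PowerSeries (H ⊗[k] H)} (hF : IsInvariantTwist k F)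
    (G : PowerSeries (H ⊗[k] H)) : Commute (oneTensor k H F) (idTensorComul k H G) := by
  refine commute_of_commute_coeff fun i j => ?_
  rw [oneTensor_eq, idTensorComul_eq, PowerSeries.coeff_map, PowerSeries.coeff_map]
  exact commute_lastTwo_comulLast (fun x => forall_commute_comul_iff.1 hF.invariant x i) _

theorem isInvariantTwist_one : IsInvariantTwist k (1 : PowerSeries (H ⊗[k] H)) where
  isUnit := isUnit_one
  invariant x := by rw [one_mul, mul_one]
  cocycle := by simp only [map_one]
  counit_left := map_one _
  counit_right := map_one _

theorem IsInvariantTwist.mul {F G : PowerSeries (H ⊗[k] H)} (hF : IsInvariantTwist k F)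
    (hG : IsInvariantTwist k G) : IsInvariantTwist k (F * G) where
  isUnit := hF.isUnit.mul hG.isUnit
  invariant x := by rw [mul_assoc, hG.invariant, ← mul_assoc, hF.invariant, mul_assoc]
  cocycle := by
    rw [map_mul, map_mul, map_mul, map_mul, (hG.commute_tensorOne F).mul_mul_mul_comm, hF.cocycle,
      hG.cocycle, (hG.commute_oneTensor F).mul_mul_mul_comm]
  counit_left := by rw [map_mul, hF.counit_left, hG.counit_left, one_mul]
  counit_right := by rw [map_mul, hF.counit_right, hG.counit_right, one_mul]

theorem IsInvariantTwist.of_mul_eq_one {F G : PowerSeries (H ⊗[k] H)} (hF : IsInvariantTwist k F)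
    (hFG : F * G = 1) (hGF : G * F = 1) : IsInvariantTwist k G where
  isUnit := ⟨⟨G, F, hGF, hFG⟩, rfl⟩
  invariant x := by
    calc G * comul k H x = G * (comul k H x * F) * G := by rw [mul_assoc, mul_assoc, hFG, mul_one]
      _ = comul k H x * G := by rw [← hF.invariant, ← mul_assoc, hGF, one_mul]
  cocycle := by
    have h1 : (tensorOne k H F * comulTensorId k H F) * (comulTensorId k H G * tensorOne k H G) =
        1 := by
      rw [mul_assoc, ← mul_assoc (comulTensorId k H F), ← map_mul, hFG, map_one, one_mul, ← map_mul,
        hFG, map_one]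
    have h2 : (idTensorComul k H G * oneTensor k H G) *
        (oneTensor k H F * idTensorComul k H F) = 1 := by
      rw [mul_assoc, ← mul_assoc (oneTensor k H G), ← map_mul, hGF, map_one, one_mul, ← map_mul, hGF,
        map_one]
    have h3 : Commute (comulTensorId k H G) (tensorOne k H G) := by
      have h := hF.commute_tensorOne G
      have hinv : tensorOne k H F * tensorOne k H G = 1 := by rw [← map_mul, hFG, map_one]
      have hinv' : tensorOne k H G * tensorOne k H F = 1 := by rw [← map_mul, hGF, map_one]
      exact (Commute.units_inv_left (u := ⟨_, _, hinv, hinv'⟩) h).symm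
    have h4 : Commute (idTensorComul k H G) (oneTensor k H G) := by
      have h := hF.commute_oneTensor G
      have hinv : oneTensor k H F * oneTensor k H G = 1 := by rw [← map_mul, hFG, map_one]
      have hinv' : oneTensor k H G * oneTensor k H F = 1 := by rw [← map_mul, hGF, map_one]
      exact (Commute.units_inv_left (u := ⟨_, _, hinv, hinv'⟩) h).symm
    rw [← h3.eq, ← h4.eq]
    rw [hF.cocycle] at h1
    exact (left_inv_eq_right_inv h2 h1).symm
  counit_left := by
    have h := congrArg (counitTensorId k H) hFG
    rwa [map_mul, hF.counit_left, one_mul, map_one] at h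
  counit_right := by
    have h := congrArg (idTensorCounit k H) hFG
    rwa [map_mul, hF.counit_right, one_mul, map_one] at h

/-- Each condition on a twist, read at order n, involves only the coefficients up to n. So h-adic
limits of invariant twists are invariant twists. -/
theorem IsInvariantTwist.of_coeff_eq {F : PowerSeries (H ⊗[k] H)}
    (h : ∀ n, ∃ G, IsInvariantTwist k G ∧ ∀ m ≤ n, PowerSeries.coeff m F = PowerSeries.coeff m G) :
    IsInvariantTwist k F where
  isUnit := by
    obtain ⟨G, hG, hFG⟩ := h 0
    have := PowerSeries.isUnit_iff_constantCoeff.1 hG.isUnit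
    rw [PowerSeries.isUnit_iff_constantCoeff]
    rwa [← PowerSeries.coeff_zero_eq_constantCoeff_apply, hFG 0 le_rfl,
      PowerSeries.coeff_zero_eq_constantCoeff_apply]
  invariant := by
    refine forall_commute_comul_iff.2 fun x n => ?_
    obtain ⟨G, hG, hFG⟩ := h n
    rw [hFG n le_rfl]
    exact forall_commute_comul_iff.1 hG.invariant x n
  cocycle := by
    refine PowerSeries.ext fun n => ?_
    obtain ⟨G, hG, hFG⟩ := h n
    have hm (f : H ⊗[k] H →+* H ⊗[k] (H ⊗[k] H)) : ∀ m ≤ n,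
        PowerSeries.coeff m (PowerSeries.map f F) = PowerSeries.coeff m (PowerSeries.map f G) :=
      fun m hm => by rw [PowerSeries.coeff_map, PowerSeries.coeff_map, hFG m hm]
    have hL := coeff_mul_congr (hm (firstTwo k H)) (hm (comulFirst k H)) n le_rfl
    have hR := coeff_mul_congr (hm (lastTwo k H)) (hm (comulLast k H)) n le_rfl
    have hc := congrArg (PowerSeries.coeff n) hG.cocycle
    exact hL.trans (hc.trans hR.symm)
  counit_left := by
    refine PowerSeries.ext fun n => ?_
    obtain ⟨G, hG, hFG⟩ := h n
    rw [← hG.counit_left, counitTensorId, PowerSeries.coeff_map, PowerSeries.coeff_map,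
      hFG n le_rfl]
  counit_right := by
    refine PowerSeries.ext fun n => ?_
    obtain ⟨G, hG, hFG⟩ := h n
    rw [← hG.counit_right, idTensorCounit, PowerSeries.coeff_map, PowerSeries.coeff_map,
      hFG n le_rfl]

end Group

/-! ### Twists arising from central units -/

section Gauge

variable {k : Type*} [Field k] {H : Type*} [Ring H] [Bialgebra k H]

local notation "Δ" => Bialgebra.comulAlgHom k H

theorem commute_tmul {a b : PowerSeries H} (ha : ∀ (x : H) n, Commute x (PowerSeries.coeff n a))
    (hb : ∀ (x : H) n, Commute x (PowerSeries.coeff n b)) (F : PowerSeries (H ⊗[k] H)) :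
    Commute (tmul k H a b) F := by
  refine Commute.mul_left (commute_of_commute_coeff fun i j => ?_)
    (commute_of_commute_coeff fun i j => ?_)
  · rw [PowerSeries.coeff_map]
    generalize PowerSeries.coeff j F = f
    induction f using TensorProduct.induction_on with
    | zero => exact Commute.zero_right _
    | add x y hx hy => exact hx.add_right hy
    | tmul x y =>
      change PowerSeries.coeff i a ⊗ₜ[k] (1 : H) * x ⊗ₜ[k] y =
        x ⊗ₜ[k] y * PowerSeries.coeff i a ⊗ₜ[k] (1 : H)
      rw [Algebra.TensorProduct.tmul_mul_tmul, Algebra.TensorProduct.tmul_mul_tmul, (ha x i).eq,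
        one_mul, mul_one]
  · rw [PowerSeries.coeff_map]
    generalize PowerSeries.coeff j F = f
    induction f using TensorProduct.induction_on with
    | zero => exact Commute.zero_right _
    | add x y hx hy => exact hx.add_right hy
    | tmul x y =>
      change (1 : H) ⊗ₜ[k] PowerSeries.coeff i b * x ⊗ₜ[k] y =
        x ⊗ₜ[k] y * (1 : H) ⊗ₜ[k] PowerSeries.coeff i b
      rw [Algebra.TensorProduct.tmul_mul_tmul, Algebra.TensorProduct.tmul_mul_tmul, (hb y i).eq,
        one_mul, mul_one]

theorem commute_includeLeft_includeRight (a b : PowerSeries H) :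
    Commute (PowerSeries.map ((Algebra.TensorProduct.includeLeft : H →ₐ[k] H ⊗[k] H) :
        H →+* H ⊗[k] H) a)
      (PowerSeries.map ((Algebra.TensorProduct.includeRight : H →ₐ[k] H ⊗[k] H) :
        H →+* H ⊗[k] H) b) := by
  refine commute_of_commute_coeff fun i j => ?_
  rw [PowerSeries.coeff_map, PowerSeries.coeff_map]
  change PowerSeries.coeff i a ⊗ₜ[k] (1 : H) * (1 : H) ⊗ₜ[k] PowerSeries.coeff j b =
    (1 : H) ⊗ₜ[k] PowerSeries.coeff j b * PowerSeries.coeff i a ⊗ₜ[k] (1 : H)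
  rw [Algebra.TensorProduct.tmul_mul_tmul, Algebra.TensorProduct.tmul_mul_tmul, mul_one, one_mul,
    mul_one, one_mul]

theorem tmul_mul_tmul (a b a' b' : PowerSeries H) :
    tmul k H a b * tmul k H a' b' = tmul k H (a * a') (b * b') := by
  rw [tmul, tmul, tmul, map_mul, map_mul,
    (commute_includeLeft_includeRight a' b).symm.mul_mul_mul_comm]

theorem tmul_one_one : tmul k H 1 1 = 1 := by
  rw [tmul, map_one, map_one, one_mul]

theorem comulTensorId_comul (a : PowerSeries H) :
    comulTensorId k H (comul k H a) = idTensorComul k H (comul k H a) := by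
  refine PowerSeries.ext fun n => ?_
  rw [comulTensorId, idTensorComul, comul, PowerSeries.coeff_map, PowerSeries.coeff_map,
    PowerSeries.coeff_map]
  exact Coalgebra.coassoc_apply (R := k) (PowerSeries.coeff n a)

/-- A central unit `a` of `H[[h]]` with `ε(a) = 1` gives the invariant twist `Δ(a) (a ⊗ a)⁻¹`. -/
theorem isInvariantTwist_of_mul_tmul {a : PowerSeries H} (hu : IsUnit a)
    (ha : ∀ (x : H) n, Commute x (PowerSeries.coeff n a))
    (hε : PowerSeries.map (Bialgebra.counitAlgHom k H : H →+* k) a = 1)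
    {S : PowerSeries (H ⊗[k] H)} (hS : S * tmul k H a a = comul k H a) :
    IsInvariantTwist k S := by
  have htu : IsUnit (tmul k H a a) := (hu.map _).mul (hu.map _)
  have hΔu : IsUnit (comul k H a) := hu.map _
  have hcentral (F : PowerSeries (H ⊗[k] H)) : Commute (tmul k H a a) F := commute_tmul ha ha F
  have hSx : ∀ x : PowerSeries H, S * comul k H x = comul k H x * S := by
    intro x
    have h1 : Commute (comul k H x) (comul k H a) :=
      Commute.map ((forall_commute_iff.2 ha x).symm : Commute x a) (comul k H)
    refine htu.mul_right_cancel ?_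
    rw [mul_assoc, ← (hcentral _).eq, ← mul_assoc, hS, mul_assoc, hS, h1.eq]
  have hSu : IsUnit S := by
    obtain ⟨t, ht⟩ := htu
    rw [← ht] at hS
    rw [(Units.eq_mul_inv_iff_mul_eq t).2 hS]
    exact hΔu.mul t⁻¹.isUnit
  have hunital (f : PowerSeries (H ⊗[k] H) →+* PowerSeries H)
      (hf : f (tmul k H a a) = f (comul k H a)) : f S = 1 := by
    refine (htu.map f).mul_right_cancel ?_
    rw [← map_mul, hS, one_mul, hf]
  have hεl : counitTensorId k H (tmul k H a a) = counitTensorId k H (comul k H a) := by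
    have h1 : counitTensorId k H (comul k H a) = a := by
      refine PowerSeries.ext fun n => ?_
      rw [counitTensorId, comul, PowerSeries.coeff_map, PowerSeries.coeff_map]
      change TensorProduct.lid k H ((Coalgebra.counit (R := k)).rTensor H
        (Coalgebra.comul (PowerSeries.coeff n a))) = _
      rw [Coalgebra.rTensor_counit_comul, TensorProduct.lid_tmul, one_smul]
    have h2 : counitTensorId k H (PowerSeries.map ((Algebra.TensorProduct.includeLeft :
        H →ₐ[k] H ⊗[k] H) : H →+* H ⊗[k] H) a) = 1 := by
      refine PowerSeries.ext fun n => ?_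
      have h3 := congrArg (PowerSeries.coeff n) hε
      rw [PowerSeries.coeff_map] at h3
      rw [counitTensorId, PowerSeries.coeff_map, PowerSeries.coeff_map]
      change TensorProduct.lid k H (Bialgebra.counitAlgHom k H (PowerSeries.coeff n a) ⊗ₜ 1) = _
      rw [TensorProduct.lid_tmul]
      refine (congrArg (· • (1 : H)) h3).trans ?_
      rw [PowerSeries.coeff_one, PowerSeries.coeff_one]
      split_ifs <;> simp
    have h4 : counitTensorId k H (PowerSeries.map ((Algebra.TensorProduct.includeRight :
        H →ₐ[k] H ⊗[k] H) : H →+* H ⊗[k] H) a) = a := by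
      refine PowerSeries.ext fun n => ?_
      rw [counitTensorId, PowerSeries.coeff_map, PowerSeries.coeff_map]
      change TensorProduct.lid k H (Bialgebra.counitAlgHom k H 1 ⊗ₜ PowerSeries.coeff n a) = _
      rw [map_one, TensorProduct.lid_tmul, one_smul]
    rw [tmul, map_mul, h1, h2, h4, one_mul]
  have hεr : idTensorCounit k H (tmul k H a a) = idTensorCounit k H (comul k H a) := by
    have h1 : idTensorCounit k H (comul k H a) = a := by
      refine PowerSeries.ext fun n => ?_
      rw [idTensorCounit, comul, PowerSeries.coeff_map, PowerSeries.coeff_map]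
      change TensorProduct.rid k H ((Coalgebra.counit (R := k)).lTensor H
        (Coalgebra.comul (PowerSeries.coeff n a))) = _
      rw [Coalgebra.lTensor_counit_comul, TensorProduct.rid_tmul, one_smul]
    have h2 : idTensorCounit k H (PowerSeries.map ((Algebra.TensorProduct.includeRight :
        H →ₐ[k] H ⊗[k] H) : H →+* H ⊗[k] H) a) = 1 := by
      refine PowerSeries.ext fun n => ?_
      have h3 := congrArg (PowerSeries.coeff n) hε
      rw [PowerSeries.coeff_map] at h3
      rw [idTensorCounit, PowerSeries.coeff_map, PowerSeries.coeff_map]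
      change TensorProduct.rid k H (1 ⊗ₜ Bialgebra.counitAlgHom k H (PowerSeries.coeff n a)) = _
      rw [TensorProduct.rid_tmul]
      refine (congrArg (· • (1 : H)) h3).trans ?_
      rw [PowerSeries.coeff_one, PowerSeries.coeff_one]
      split_ifs <;> simp
    have h4 : idTensorCounit k H (PowerSeries.map ((Algebra.TensorProduct.includeLeft :
        H →ₐ[k] H ⊗[k] H) : H →+* H ⊗[k] H) a) = a := by
      refine PowerSeries.ext fun n => ?_
      rw [idTensorCounit, PowerSeries.coeff_map, PowerSeries.coeff_map]
      change TensorProduct.rid k H (PowerSeries.coeff n a ⊗ₜ Bialgebra.counitAlgHom k H 1) = _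
      rw [map_one, TensorProduct.rid_tmul, one_smul]
    rw [tmul, map_mul, h1, h2, h4, mul_one]
  have hST1 : Commute (tensorOne k H S) (comulTensorId k H S) := by
    refine commute_of_commute_coeff fun i j => ?_
    rw [tensorOne_eq, comulTensorId_eq, PowerSeries.coeff_map, PowerSeries.coeff_map]
    exact commute_firstTwo_comulFirst (fun x => forall_commute_comul_iff.1 hSx x i) _
  have hST2 : Commute (oneTensor k H S) (idTensorComul k H S) := by
    refine commute_of_commute_coeff fun i j => ?_
    rw [oneTensor_eq, idTensorComul_eq, PowerSeries.coeff_map, PowerSeries.coeff_map]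
    exact commute_lastTwo_comulLast (fun x => forall_commute_comul_iff.1 hSx x i) _
  -- the three copies of `a` in the tensor cube
  let i₁ : H →ₐ[k] H ⊗[k] (H ⊗[k] H) := Algebra.TensorProduct.includeLeft
  let i₂ : H →ₐ[k] H ⊗[k] (H ⊗[k] H) := (lastTwo k H).comp Algebra.TensorProduct.includeLeft
  let i₃ : H →ₐ[k] H ⊗[k] (H ⊗[k] H) := (lastTwo k H).comp Algebra.TensorProduct.includeRight
  let a₁ := PowerSeries.map (i₁ : H →+* H ⊗[k] (H ⊗[k] H)) a
  let a₂ := PowerSeries.map (i₂ : H →+* H ⊗[k] (H ⊗[k] H)) a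
  let a₃ := PowerSeries.map (i₃ : H →+* H ⊗[k] (H ⊗[k] H)) a
  have hT1 : tensorOne k H (tmul k H a a) = a₁ * a₂ := by
    rw [tmul, map_mul]
    congr 1
  have hT2 : oneTensor k H (tmul k H a a) = a₂ * a₃ := by
    rw [tmul, map_mul]
    congr 1
  have hC1 : comulTensorId k H (tmul k H a a) = tensorOne k H (comul k H a) * a₃ := by
    rw [tmul, map_mul]
    congr 1
    refine PowerSeries.ext fun n => ?_
    rw [comulTensorId_eq, PowerSeries.coeff_map, PowerSeries.coeff_map, PowerSeries.coeff_map]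
    change TensorProduct.assoc k H H H (Δ 1 ⊗ₜ PowerSeries.coeff n a) =
      1 ⊗ₜ (1 ⊗ₜ PowerSeries.coeff n a)
    rw [map_one, Algebra.TensorProduct.one_def, TensorProduct.assoc_tmul]
  have hC2 : idTensorComul k H (tmul k H a a) = a₁ * oneTensor k H (comul k H a) := by
    rw [tmul, map_mul]
    congr 1
    refine PowerSeries.ext fun n => ?_
    rw [idTensorComul_eq, PowerSeries.coeff_map, PowerSeries.coeff_map, PowerSeries.coeff_map]
    change PowerSeries.coeff n a ⊗ₜ Δ 1 = PowerSeries.coeff n a ⊗ₜ[k] (1 : H ⊗[k] H)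
    rw [map_one]
  have ha₁ (G : PowerSeries (H ⊗[k] H)) : Commute a₁ (oneTensor k H G) := by
    refine commute_of_commute_coeff fun i j => ?_
    rw [oneTensor_eq, PowerSeries.coeff_map, PowerSeries.coeff_map]
    change PowerSeries.coeff i a ⊗ₜ[k] (1 : H ⊗[k] H) * (1 : H) ⊗ₜ[k] PowerSeries.coeff j G =
      (1 : H) ⊗ₜ[k] PowerSeries.coeff j G * PowerSeries.coeff i a ⊗ₜ[k] (1 : H ⊗[k] H)
    rw [Algebra.TensorProduct.tmul_mul_tmul, Algebra.TensorProduct.tmul_mul_tmul, mul_one, one_mul,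
      mul_one, one_mul]
  -- After multiplication by the unit a ⊗ a ⊗ a the two sides of the cocycle identity become (Δ ⊗
  -- 1)Δ(a) and (1 ⊗ Δ)Δ(a), which agree by coassociativity.
  have hau : IsUnit (a₁ * (a₂ * a₃)) := (hu.map _).mul ((hu.map _).mul (hu.map _))
  refine ⟨hSu, hSx, hau.mul_right_cancel ?_, hunital _ hεl, hunital _ hεr⟩
  have hD1 : tensorOne k H S * comulTensorId k H S * (a₁ * (a₂ * a₃)) =
      comulTensorId k H (comul k H a) := by
    rw [hST1.eq, ← mul_assoc a₁, ← hT1, mul_assoc, ← mul_assoc (tensorOne k H S), ← map_mul, hS,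
      ← hC1, ← map_mul, hS]
  have hD2 : oneTensor k H S * idTensorComul k H S * (a₁ * (a₂ * a₃)) =
      idTensorComul k H (comul k H a) := by
    rw [hST2.eq, ← hT2, (ha₁ _).eq, mul_assoc, ← mul_assoc (oneTensor k H S), ← map_mul, hS,
      ← (ha₁ _).eq, ← hC2, ← map_mul, hS]
  rw [hD1, hD2, comulTensorId_comul]

end Gauge

end FormalTwist

/-! ### Existence and uniqueness of the product -/

namespace FormalTwist

section Main

open UniversalEnvelopingAlgebra

variable {k : Type*} [Field k] {g : Type*} [LieRing g] [LieAlgebra k g]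

local notation "U" => UniversalEnvelopingAlgebra k g
local notation "Δ" => Bialgebra.comulAlgHom k (UniversalEnvelopingAlgebra k g)
local notation "ε" => Bialgebra.counitAlgHom k (UniversalEnvelopingAlgebra k g)

/-- By invariance the two exponents on each side of the cocycle identity commute, so each side is a
single exponential, and the exponents agree by the additive cocycle identity. -/
theorem isInvariantTwist_exp [CharZero k] (X : invariantSkew k g) {n : ℕ} (hn : n ≠ 0) :
    IsInvariantTwist k (exp k (PowerSeries.monomial n (toEnvelopingSquare k g X))) := by
  have hX (x : U) : Commute (Δ x) (toEnvelopingSquare k g X) :=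
    commute_comul_toEnvelopingSquare X.2.2 x
  have hco := isTwoCocycle_toEnvelopingSquare (k := k) (X : g ⊗[k] g)
  have h0 {A : Type _} [Ring A] [Algebra k A] (a : A) :
      PowerSeries.coeff 0 (PowerSeries.monomial n a) = 0 := by
    rw [PowerSeries.coeff_monomial, if_neg hn.symm]
  have hmon {A : Type _} [Ring A] [Algebra k A] {a b : A} (h : Commute a b) :
      Commute (PowerSeries.monomial n a) (PowerSeries.monomial n b) := by
    rw [commute_iff_eq, PowerSeries.monomial_mul_monomial, PowerSeries.monomial_mul_monomial, h.eq]
  refine ⟨isUnit_of_coeff_zero ?_, forall_commute_comul_iff.2 fun x =>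
    commute_coeff_exp k fun i => ?_, ?_, ?_, ?_⟩
  · rw [(eqOneAdd_exp_monomial k hn _).coeff_of_lt (Nat.pos_of_ne_zero hn), PowerSeries.coeff_one,
      if_pos rfl]
  · rw [PowerSeries.coeff_monomial]
    split_ifs
    · exact hX x
    · exact Commute.zero_right _
  · rw [tensorOne_eq, comulTensorId_eq, oneTensor_eq, idTensorComul_eq, map_exp_monomial,
      map_exp_monomial, map_exp_monomial, map_exp_monomial,
      ← exp_add k (h0 _) (h0 _) (hmon (commute_firstTwo_comulFirst hX _)),
      ← exp_add k (h0 _) (h0 _) (hmon (commute_lastTwo_comulLast hX _)), ← map_add, ← map_add]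
    congr 2
    exact hco.cocycle
  · rw [counitTensorId, map_exp_monomial]
    refine (congrArg (fun a => exp k (PowerSeries.monomial n a)) (?_ : _ = (0 : U))).trans ?_
    · exact (congrArg (TensorProduct.lid k U) hco.counit_left).trans (map_zero _)
    · rw [map_zero, exp_zero]
  · rw [idTensorCounit, map_exp_monomial]
    refine (congrArg (fun a => exp k (PowerSeries.monomial n a)) (?_ : _ = (0 : U))).trans ?_
    · exact (congrArg (TensorProduct.rid k U) hco.counit_right).trans (map_zero _)
    · rw [map_zero, exp_zero]

theorem isInvariantTwist_partialProd [CharZero k] (X : ℕ+ → invariantSkew k g) (N : ℕ) :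
    IsInvariantTwist k (partialProd k (fun i => toEnvelopingSquare k g (X i : g ⊗[k] g)) N) := by
  induction N with
  | zero => exact isInvariantTwist_one
  | succ N ih => exact ih.mul (isInvariantTwist_exp _ N.succ_ne_zero)

theorem isInvariantTwist_expProduct [CharZero k] (X : ℕ+ → invariantSkew k g) :
    IsInvariantTwist k (expProduct k g X) :=
  IsInvariantTwist.of_coeff_eq fun n => ⟨_, isInvariantTwist_partialProd X n, fun m hm =>
    (coeff_partialProd k _ n m hm).symm⟩

/-- The constant coefficient is a unit, hence a scalar, and the counit condition makes the scalar 1.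
-/
theorem IsInvariantTwist.coeff_zero [CharZero k] {F : PowerSeries (U ⊗[k] U)}
    (hF : IsInvariantTwist k F) : PowerSeries.coeff 0 F = 1 := by
  have hu := PowerSeries.isUnit_iff_constantCoeff.1 hF.isUnit
  rw [← PowerSeries.coeff_zero_eq_constantCoeff_apply] at hu
  obtain ⟨r, hr⟩ := exists_algebraMap_eq_of_isUnit_tensor k g hu
  have h := congrArg (PowerSeries.coeff 0) hF.counit_left
  rw [counitTensorId, PowerSeries.coeff_map, ← hr, PowerSeries.coeff_one, if_pos rfl] at h
  have h1 : algebraMap k U r = 1 := (AlgHom.commutes ((Algebra.TensorProduct.lid k U).toAlgHom.comp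
    (Algebra.TensorProduct.map (ε) (AlgHom.id k U))) r).symm.trans h
  have h2 := congrArg (ε) h1
  rw [AlgHom.commutes, map_one] at h2
  rw [← hr, show r = 1 from h2, map_one]

theorem IsInvariantTwist.isTwoCocycle_coeff {F : PowerSeries (U ⊗[k] U)} (hF : IsInvariantTwist k F)
    {n : ℕ} (hn : n ≠ 0) (h : ∀ m < n, PowerSeries.coeff m F = PowerSeries.coeff m 1) :
    IsTwoCocycle k g (PowerSeries.coeff n F) where
  cocycle := by
    have hF' := EqOneAdd.of_coeff_of_lt hn h
    have hL := ((hF'.map (firstTwo k U : U ⊗[k] U →+* U ⊗[k] (U ⊗[k] U))).mul hn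
      (hF'.map (comulFirst k U : U ⊗[k] U →+* U ⊗[k] (U ⊗[k] U)))).coeff_self hn
    have hR := ((hF'.map (lastTwo k U : U ⊗[k] U →+* U ⊗[k] (U ⊗[k] U))).mul hn
      (hF'.map (comulLast k U : U ⊗[k] U →+* U ⊗[k] (U ⊗[k] U)))).coeff_self hn
    have hc := hF.cocycle
    rw [tensorOne_eq, comulTensorId_eq, oneTensor_eq, idTensorComul_eq] at hc
    rw [hc, hR] at hL
    exact hL.symm
  counit_left := by
    have h1 := congrArg (PowerSeries.coeff n) hF.counit_left
    rw [counitTensorId, PowerSeries.coeff_map, PowerSeries.coeff_one, if_neg hn] at h1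
    exact (TensorProduct.lid k U).injective (h1.trans (map_zero _).symm)
  counit_right := by
    have h1 := congrArg (PowerSeries.coeff n) hF.counit_right
    rw [idTensorCounit, PowerSeries.coeff_map, PowerSeries.coeff_one, if_neg hn] at h1
    exact (TensorProduct.rid k U).injective (h1.trans (map_zero _).symm)

/-- One factor of the product can be split off an invariant twist up to gauge. -/
theorem IsInvariantTwist.exists_step [CharZero k] {F : PowerSeries (U ⊗[k] U)}
    (hF : IsInvariantTwist k F) {n : ℕ} (hn : n ≠ 0)
    (h : ∀ m < n, PowerSeries.coeff m F = PowerSeries.coeff m 1) :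
    ∃ (X : invariantSkew k g) (a : PowerSeries U) (F' : PowerSeries (U ⊗[k] U)),
      IsInvariantTwist k F' ∧
      (∀ m < n + 1, PowerSeries.coeff m F' = PowerSeries.coeff m 1) ∧
      (∀ m < n, PowerSeries.coeff m a = PowerSeries.coeff m 1) ∧
      (∀ (x : U) m, Commute x (PowerSeries.coeff m a)) ∧
      F * comul k U a = tmul k U a a *
        (exp k (PowerSeries.monomial n (toEnvelopingSquare k g X)) * F') := by
  have hF' := EqOneAdd.of_coeff_of_lt hn h
  obtain ⟨X, b, hεb, hb, hf⟩ := (hF.isTwoCocycle_coeff hn h).exists_invariantSkew_add_coboundary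
    fun x => forall_commute_comul_iff.1 hF.invariant x n
  -- With this sign the twist S = Δ(a)(a ⊗ a)⁻¹ has leading coefficient -δb, which cancels the
  -- coboundary in the coefficient of hⁿ in F.
  let a : PowerSeries U := 1 + PowerSeries.monomial n (-b)
  have ha : EqOneAdd n (-b) a := eqOneAdd_self n (-b)
  have ha0 : PowerSeries.coeff 0 a = 1 := by
    rw [ha.coeff_of_lt (Nat.pos_of_ne_zero hn), PowerSeries.coeff_one, if_pos rfl]
  have hac : ∀ (x : U) m, Commute x (PowerSeries.coeff m a) := by
    intro x m
    rw [map_add, PowerSeries.coeff_one, PowerSeries.coeff_monomial]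
    refine Commute.add_right ?_ ?_
    · split_ifs
      · exact Commute.one_right x
      · exact Commute.zero_right x
    · split_ifs
      · exact (hb x).neg_right
      · exact Commute.zero_right x
  have haε : PowerSeries.map (Bialgebra.counitAlgHom k U : U →+* k) a = 1 := by
    rw [map_add, map_one, map_monomial]
    have h0 : (Bialgebra.counitAlgHom k U : U →+* k) (-b) = 0 := by
      rw [map_neg]
      exact neg_eq_zero.2 hεb
    rw [h0, map_zero, add_zero]
  have hau : IsUnit a := isUnit_of_coeff_zero ha0
  have htc (G : PowerSeries (U ⊗[k] U)) : Commute (tmul k U a a) G := commute_tmul hac hac G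
  have htu : IsUnit (tmul k U a a) := (hau.map _).mul (hau.map _)
  obtain ⟨t, ht⟩ := htu
  obtain ⟨S, hS⟩ : ∃ S, S * tmul k U a a = comul k U a :=
    ⟨comul k U a * ↑t⁻¹, by rw [← ht, Units.inv_mul_cancel_right]⟩
  have hSt := isInvariantTwist_of_mul_tmul hau hac haε hS
  have hG := hF.mul hSt
  have hSo : EqOneAdd n (-coboundary k g b) S := by
    have h1 : EqOneAdd n (-(b ⊗ₜ[k] 1) + -(1 ⊗ₜ[k] b)) (tmul k U a a) := by
      have h2 := (ha.map ((Algebra.TensorProduct.includeLeft : U →ₐ[k] U ⊗[k] U) :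
        U →+* U ⊗[k] U)).mul hn (ha.map ((Algebra.TensorProduct.includeRight :
          U →ₐ[k] U ⊗[k] U) : U →+* U ⊗[k] U))
      rw [map_neg, map_neg] at h2
      exact h2
    have h3 := ha.map (Bialgebra.comulAlgHom k U : U →+* U ⊗[k] U)
    have h4 := h1.of_mul_right hn (Q := S) (by rw [hS]; exact h3)
    have h5 : (Bialgebra.comulAlgHom k U : U →+* U ⊗[k] U) (-b) -
        (-(b ⊗ₜ[k] 1) + -(1 ⊗ₜ[k] b)) = -coboundary k g b := by
      rw [map_neg, coboundary]
      change -(Δ b) - _ = _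
      abel
    rwa [h5] at h4
  have hGo : EqOneAdd n (toEnvelopingSquare k g X) (F * S) := by
    have h1 := hF'.mul hn hSo
    rwa [hf, add_neg_cancel_right] at h1
  have hE := isInvariantTwist_exp X hn
  have hEo := eqOneAdd_exp_monomial k hn (toEnvelopingSquare k g (X : g ⊗[k] g))
  set E := exp k (PowerSeries.monomial n (toEnvelopingSquare k g (X : g ⊗[k] g)))
  obtain ⟨E', hEE', hE'E⟩ : ∃ E', E * E' = 1 ∧ E' * E = 1 := by
    obtain ⟨e, he⟩ := hE.isUnit
    exact ⟨↑e⁻¹, by rw [← he, Units.mul_inv], by rw [← he, Units.inv_mul]⟩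
  have hFn : EqOneAdd n 0 (E' * (F * S)) := by
    have h1 := hEo.of_mul_left hn (Q := E' * (F * S)) (q := toEnvelopingSquare k g X)
      (by rw [← mul_assoc, hEE', one_mul]; exact hGo)
    rwa [sub_self] at h1
  refine ⟨X, a, E' * (F * S), (hE.of_mul_eq_one hEE' hE'E).mul hG, fun m hm => ?_,
    fun m hm => ha.coeff_of_lt hm, hac, ?_⟩
  · rw [hFn m (by omega), map_zero, add_zero]
  · rw [← mul_assoc E, hEE', one_mul, (htc _).eq, mul_assoc, hS]

/-- Iteration of `IsInvariantTwist.exists_step`. The n-th gauge factor, counted from 0, is 1 modulo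
hⁿ⁺¹, so the product of the factors converges h-adically to the required gauge. -/
theorem IsInvariantTwist.exists_gaugeIsomorphic [CharZero k] {F : PowerSeries (U ⊗[k] U)}
    (hF : IsInvariantTwist k F) :
    ∃ X : ℕ+ → invariantSkew k g, GaugeIsomorphic k F (expProduct k g X) := by
  let T (n : ℕ) : Type _ := {G : PowerSeries (U ⊗[k] U) // IsInvariantTwist k G ∧
    ∀ m < n + 1, PowerSeries.coeff m G = PowerSeries.coeff m 1}
  have hstep (n : ℕ) (G : T n) := G.2.1.exists_step n.succ_ne_zero G.2.2
  choose Xs as Fs hFs hFs1 has hasc hrel using hstep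
  let Fseq : (n : ℕ) → T n := fun n => Nat.rec
    ⟨F, hF, fun m hm => by
      obtain rfl : m = 0 := Nat.lt_one_iff.1 hm
      rw [hF.coeff_zero, PowerSeries.coeff_one, if_pos rfl]⟩
    (fun n G => ⟨Fs n G, hFs n G, hFs1 n G⟩) n
  have hFseq (n : ℕ) : (Fseq (n + 1)).1 = Fs n (Fseq n) := rfl
  let X : ℕ+ → invariantSkew k g := fun i => Xs i.natPred (Fseq i.natPred)
  have hX (n : ℕ) : X n.succPNat = Xs n (Fseq n) := by
    simp only [X, Nat.natPred_succPNat]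
  let Aseq : ℕ → PowerSeries U := fun n => Nat.rec 1 (fun n a => a * as n (Fseq n)) n
  have hAseq (n : ℕ) : Aseq (n + 1) = Aseq n * as n (Fseq n) := rfl
  have hAc (n : ℕ) : ∀ (x : U) m, Commute x (PowerSeries.coeff m (Aseq n)) := by
    induction n with
    | zero => exact forall_commute_iff.1 fun x => by rw [show Aseq 0 = 1 from rfl, one_mul, mul_one]
    | succ n ih =>
      refine forall_commute_iff.1 fun x => ?_
      have h1 := forall_commute_iff.2 ih
      have h2 := forall_commute_iff.2 (hasc n (Fseq n))
      rw [hAseq, mul_assoc, h2, ← mul_assoc, h1, mul_assoc]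
  let P (n : ℕ) := partialProd k (fun i => toEnvelopingSquare k g (X i : g ⊗[k] g)) n
  have hmain (n : ℕ) : F * comul k U (Aseq n) =
      tmul k U (Aseq n) (Aseq n) * (P n * (Fseq n).1) := by
    induction n with
    | zero =>
      change F * comul k U 1 = tmul k U 1 1 * (1 * F)
      rw [map_one, tmul_one_one, one_mul, one_mul, mul_one]
    | succ n ih =>
      have hP : P (n + 1) = P n * exp k (PowerSeries.monomial (n + 1)
          (toEnvelopingSquare k g (Xs n (Fseq n) : g ⊗[k] g))) := by
        simp only [P, partialProd, hX]
      have hc := commute_tmul (hasc n (Fseq n)) (hasc n (Fseq n)) (P n)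
      rw [hAseq, map_mul, ← mul_assoc, ih, mul_assoc, mul_assoc, hrel, ← mul_assoc (P n), ← hc.eq,
        hP, hFseq, ← tmul_mul_tmul]
      simp only [mul_assoc]
  have hAmono (n N : ℕ) (h : n ≤ N) : ∀ m ≤ n, PowerSeries.coeff m (Aseq N) =
      PowerSeries.coeff m (Aseq n) := by
    induction N, h using Nat.le_induction with
    | base => exact fun _ _ => rfl
    | succ N hN ih =>
      intro m hm
      rw [hAseq, coeff_mul_congr ih (fun i hi => has N (Fseq N) i (by omega)) m hm, mul_one]
  let a : PowerSeries U := PowerSeries.mk fun n => PowerSeries.coeff n (Aseq n)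
  have haA (n : ℕ) : ∀ m ≤ n, PowerSeries.coeff m a = PowerSeries.coeff m (Aseq n) := by
    intro m hm
    rw [PowerSeries.coeff_mk, hAmono m n hm m le_rfl]
  have hmap (n : ℕ) (f : U →+* U ⊗[k] U) : ∀ m ≤ n, PowerSeries.coeff m (PowerSeries.map f a) =
      PowerSeries.coeff m (PowerSeries.map f (Aseq n)) := fun m hm => by
    rw [PowerSeries.coeff_map, PowerSeries.coeff_map, haA n m hm]
  refine ⟨X, a, isUnit_of_coeff_zero ?_, forall_commute_iff.2 fun x n => ?_,
    PowerSeries.ext fun n => ?_⟩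
  · rw [haA 0 0 le_rfl, show Aseq 0 = 1 from rfl, PowerSeries.coeff_one, if_pos rfl]
  · rw [haA n n le_rfl]
    exact hAc n x n
  · have h1 := coeff_mul_congr (fun m (_ : m ≤ n) => (rfl : PowerSeries.coeff m F = _))
      (hmap n (Bialgebra.comulAlgHom k U : U →+* U ⊗[k] U)) n le_rfl
    have h2 := coeff_mul_congr (coeff_mul_congr
      (hmap n ((Algebra.TensorProduct.includeLeft : U →ₐ[k] U ⊗[k] U) : U →+* U ⊗[k] U))
      (hmap n ((Algebra.TensorProduct.includeRight : U →ₐ[k] U ⊗[k] U) : U →+* U ⊗[k] U)))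
      (fun m (hm : m ≤ n) => (coeff_partialProd k
        (fun i => toEnvelopingSquare k g (X i : g ⊗[k] g)) n m hm).symm) n le_rfl
    -- The remaining twist after n steps is 1 up to order n, so at that order it drops out of the
    -- relation `hmain`.
    have h3 := coeff_mul_congr (fun m (_ : m ≤ n) =>
        (rfl : PowerSeries.coeff m (tmul k U (Aseq n) (Aseq n) * P n) = _))
      (fun m (hm : m ≤ n) => (Fseq n).2.2 m (by omega)) n le_rfl
    rw [mul_one, mul_assoc, ← hmain] at h3
    exact h1.trans (h3.trans h2.symm)

theorem comm_comul (x : U) : Algebra.TensorProduct.comm k U U (Δ x) = Δ x := by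
  have h : (Algebra.TensorProduct.comm k U U).toAlgHom.comp (Δ) = Δ := by
    refine algHom_ext_ι k g fun x => ?_
    change Algebra.TensorProduct.comm k U U (Δ (ι k x)) = Δ (ι k x)
    rw [comul_ι, map_add, Algebra.TensorProduct.comm_tmul, Algebra.TensorProduct.comm_tmul, add_comm]
  exact congrArg (fun f : U →ₐ[k] U ⊗[k] U => f x) h

variable (k g) in
/-- The flip of the two tensor factors. -/
def flipTensor : PowerSeries (U ⊗[k] U) →+* PowerSeries (U ⊗[k] U) :=
  PowerSeries.map ((Algebra.TensorProduct.comm k U U).toAlgHom : U ⊗[k] U →+* U ⊗[k] U)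

theorem flipTensor_comul (a : PowerSeries U) : flipTensor k g (comul k U a) = comul k U a := by
  refine PowerSeries.ext fun n => ?_
  rw [flipTensor, comul, PowerSeries.coeff_map, PowerSeries.coeff_map]
  exact comm_comul _

theorem flipTensor_tmul (a : PowerSeries U) : flipTensor k g (tmul k U a a) = tmul k U a a := by
  rw [tmul, map_mul, (commute_includeLeft_includeRight a a).eq]
  congr 1

theorem comm_toEnvelopingSquare (X : g ⊗[k] g) :
    TensorProduct.comm k U U (toEnvelopingSquare k g X) =
      toEnvelopingSquare k g (TensorProduct.comm k g g X) := by
  induction X using TensorProduct.induction_on with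
  | zero => simp
  | tmul x y => rfl
  | add x y hx hy => simp only [map_add, hx, hy]

/-- The two products differ by a factor S that the flip fixes, because U(g) is cocommutative and the
gauges enter only through Δ(a) and a ⊗ a. No normalization of the gauges is needed. -/
theorem eq_of_gaugeIsomorphic [CharZero k] {F : PowerSeries (U ⊗[k] U)}
    {X Y : ℕ+ → invariantSkew k g} (hX : GaugeIsomorphic k F (expProduct k g X))
    (hY : GaugeIsomorphic k F (expProduct k g Y)) : X = Y := by
  obtain ⟨a, hau, hac, ha⟩ := hX
  obtain ⟨b, hbu, hbc, hb⟩ := hY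
  obtain ⟨a', haa', ha'a⟩ : ∃ a', a * a' = 1 ∧ a' * a = 1 := by
    obtain ⟨u, rfl⟩ := hau
    exact ⟨↑u⁻¹, u.mul_inv, u.inv_mul⟩
  obtain ⟨b', hbb', hb'b⟩ : ∃ b', b * b' = 1 ∧ b' * b = 1 := by
    obtain ⟨u, rfl⟩ := hbu
    exact ⟨↑u⁻¹, u.mul_inv, u.inv_mul⟩
  have hta := commute_tmul (k := k) (forall_commute_iff.1 hac) (forall_commute_iff.1 hac)
  have htb := commute_tmul (k := k) (forall_commute_iff.1 hbc) (forall_commute_iff.1 hbc)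
  let S := comul k U a' * comul k U b * tmul k U b' b' * tmul k U a a
  have hS : expProduct k g Y = expProduct k g X * S := by
    have h1 : tmul k U b b * tmul k U b' b' = 1 := by rw [tmul_mul_tmul, hbb', tmul_one_one]
    have h2 : comul k U a * comul k U a' = 1 := by rw [← map_mul, haa', map_one]
    calc expProduct k g Y = (tmul k U b b * expProduct k g Y) * tmul k U b' b' := by
          rw [(htb _).eq, mul_assoc, h1, mul_one]
      _ = F * comul k U a * comul k U a' * comul k U b * tmul k U b' b' := by
          rw [← hb, mul_assoc F (comul k U a), h2, mul_one]
      _ = expProduct k g X * S := by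
          rw [ha]
          simp only [S, mul_assoc]
          rw [(hta _).eq]
          simp only [mul_assoc]
  have hflip : flipTensor k g S = S := by
    simp only [S, map_mul, flipTensor_comul, flipTensor_tmul]
  have hall (n : ℕ) : X n.succPNat = Y n.succPNat := by
    induction n using Nat.strong_induction_on with
    | _ n ih =>
    let x := toEnvelopingSquare k g (X n.succPNat : g ⊗[k] g)
    let y := toEnvelopingSquare k g (Y n.succPNat : g ⊗[k] g)
    let E (z : U ⊗[k] U) := exp k (PowerSeries.monomial (n + 1) z)
    have hE (z : U ⊗[k] U) : EqOneAdd (n + 1) z (E z) := eqOneAdd_exp_monomial k n.succ_ne_zero z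
    let Q := partialProd k (fun i => toEnvelopingSquare k g (X i : g ⊗[k] g)) n
    have hQ : Q = partialProd k (fun i => toEnvelopingSquare k g (Y i : g ⊗[k] g)) n :=
      partialProd_congr k fun m hm => by rw [ih m hm]
    obtain ⟨Q', hQ'⟩ : ∃ Q', Q' * Q = 1 := by
      obtain ⟨u, hu⟩ := (isInvariantTwist_partialProd X n).isUnit
      exact ⟨↑u⁻¹, by rw [← u.inv_mul, hu]⟩
    have hPX : ∀ m ≤ n + 1, PowerSeries.coeff m (Q * E x) =
        PowerSeries.coeff m (expProduct k g X) := coeff_partialProd k _ (n + 1)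
    have hPY : ∀ m ≤ n + 1, PowerSeries.coeff m (Q * E y) =
        PowerSeries.coeff m (expProduct k g Y) := by
      rw [hQ]
      exact coeff_partialProd k _ (n + 1)
    have h1 : ∀ m ≤ n + 1, PowerSeries.coeff m (Q * E y) = PowerSeries.coeff m (Q * E x * S) := by
      intro m hm
      rw [hPY m hm, hS]
      exact (coeff_mul_congr hPX (fun _ _ => rfl) m hm).symm
    -- The first n factors agree and cancel from the left, which leaves exp(y hⁿ⁺¹) = exp(x hⁿ⁺¹) S
    -- modulo hⁿ⁺².
    have h2 : EqOneAdd (n + 1) y (E x * S) := by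
      intro m hm
      have h3 := coeff_mul_congr (fun i _ => (rfl : PowerSeries.coeff i Q' = _)) h1 m hm
      rw [mul_assoc, ← mul_assoc Q', ← mul_assoc Q', hQ', one_mul, one_mul] at h3
      rw [← h3, hE y m hm]
    have h3 := ((hE x).of_mul_left n.succ_ne_zero h2).coeff_self n.succ_ne_zero
    -- y - x is the coefficient of hⁿ⁺¹ in S, hence symmetric; as a difference of skew tensors it is
    -- also skew, so it vanishes.
    have h4 : TensorProduct.comm k U U (y - x) = y - x := by
      have h5 := congrArg (PowerSeries.coeff (n + 1)) hflip
      rw [flipTensor, PowerSeries.coeff_map, h3] at h5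
      exact h5
    rw [map_sub, comm_toEnvelopingSquare, comm_toEnvelopingSquare, (X n.succPNat).2.1,
      (Y n.succPNat).2.1, map_neg, map_neg, ← sub_eq_zero] at h4
    have h5 : (2 : k) • (x - y) = 0 := by
      rw [← h4, two_smul]
      simp only [x, y]
      abel
    have h6 : x = y := sub_eq_zero.1 ((smul_eq_zero.1 h5).resolve_left two_ne_zero)
    exact Subtype.ext (toEnvelopingSquare_injective h6)
  funext i
  have := hall i.natPred
  rwa [PNat.succPNat_natPred] at this

end Main

end FormalTwist

end

theorem mainTheorem3 (k : Type*) [Field k] [IsAlgClosed k] [CharZero k]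
    (g : Type*) [LieRing g] [LieAlgebra k g] :
    (∀ X : ℕ+ → FormalTwist.invariantSkew k g,
      FormalTwist.IsInvariantTwist k (FormalTwist.expProduct k g X)) ∧
    ∀ F : PowerSeries (UniversalEnvelopingAlgebra k g ⊗[k] UniversalEnvelopingAlgebra k g),
      FormalTwist.IsInvariantTwist k F →
        ∃! X : ℕ+ → FormalTwist.invariantSkew k g,
          FormalTwist.GaugeIsomorphic k F (FormalTwist.expProduct k g X) := by
  refine ⟨FormalTwist.isInvariantTwist_expProduct, fun F hF => ?_⟩
  obtain ⟨X, hX⟩ := hF.exists_gaugeIsomorphic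
  exact ⟨X, hX, fun Y hY => FormalTwist.eq_of_gaugeIsomorphic hY hX⟩
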